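/- **Setting.** Let $n\ge 2$, let $U\subset\mathbb R^n$ be a bounded domain with boundary $\Gamma$, let $N\ge 1$ and let $0=\alpha_0<\alpha_1<\dots<\alpha_N$ be real numbers. Put $a=\frac{\alpha_N}{\alpha_N+1}\in(0,1)$ and $\kappa_0=\frac{a}{2-a}+\frac12$. Let $\phi:U\to(0,1]$ and $a_0,\dots,a_N:U\to[0,\infty)$ be measurable with $a_0,a_N>0$ on $U$ and $\int_U a_N\,dx<\infty$. Let $g(x,s)=\sum_{j=0}^N a_j(x)s^{\alpha_j}$ and, for $\xi\ge0$, $K(x,\xi)=1/g(x,s(x,\xi))$, where $s=s(x,\xi)\ge 0$ is the unique solution of $s\,g(x,s)=\xi$. Put $$H(x,\xi)=\int_0^{\xi^2}K(x,\sqrt s)\,ds,\qquad W_1(x)=\frac{a_N(x)^a}{2N\max_{0\le j\le N}a_j(x)},\qquad \|u\|_{L^q_f}=\Big(\int_U f|u|^q\,dx\Big)^{1/q},$$ and $B_*=\max\{\int_U a_N\,dx,1\}$. **Solutions.** A function $u(x,t)$ on $U\times[0,\infty)$ is called *regular* if $u\in C([0,\infty);L^2_\phi)$ and $\nabla u\in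 C([0,\infty);L^2_{1/a_0})$, $u$ is twice differentiable on $(0,\infty)$ with values in $L^2_\phi$, and $\nabla u$ is differentiable on $(0,\infty)$ with values in $L^2_{1/a_0}$, with derivative $\nabla u_t$; here gradients are weak gradients (of locally integrable functions, and locally integrable themselves). Let $p_1,p_2,\Psi_1,\Psi_2$ be regular. For $i=1,2$, assume that $p_i$ is a solution with boundary data $\Psi_i|_\Gamma$, that is, with $\bar p_i=p_i-\Psi_i$, $$\phi\, p_{i,t}=\nabla\cdot(K(x,|\nabla p_i|)\nabla p_i)\ \text{ on }U\times(0,\infty),\qquad \bar p_i=0\ \text{ on }\Gamma\times(0,\infty).$$ The equation is understood weakly in $x$ for each $t>0$, against $\eta\in C_c^\infty(U)$ with $\nabla\eta\in L^2_{1/a_0}$; the boundary condition means that, for each $t>0$, $(\bar p_i,\nabla\bar p_i)(t)$ is a limit in $L^2_\phi\times L^2_{1/a_0}$ of pairs $(\eta,\nabla\eta)$ with such $\eta$. Put $\Phi=\Psi_1-\Psi_2$ and $\bar P=\bar p_1-\bar p_2$. Assume that for some constant $c_P>0$ the inequality $$\|u\|_{L^2_\phi}\le c_P\|\nabla u\|_{L^{2-a}_{W_1}}$$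 holds for $u=\bar p_1(t),\ \bar p_2(t),\ \bar P(t)$ and all $t>0$. **Quantities.** For $\Psi=\Psi_1,\Psi_2$ let $$G[\Psi](t)=B_*+\int_U a_0^{-1}|\nabla\Psi|^2dx+\int_U W_1|\nabla\Psi|^{2-a}dx+\Big(\int_U|\Psi_t|^2\phi\,dx\Big)^{\frac{2-a}{2(1-a)}},$$ $$G_1[\Psi](t)=\int_U a_0^{-1}|\nabla\Psi_t|^2dx,\qquad G_2[\Psi](t)=\int_U|\Psi_{tt}|^2\phi\,dx,$$ and assume that these are continuous functions of $t\in[0,\infty)$. Let $$D(t)=\int_U a_0^{-1}|\nabla\Phi|^2dx+\Big(\int_U a_0^{-1}|\nabla\Phi|^2dx\Big)^{\frac12}+\Big(\int_U|\Phi_t|^2\phi\,dx\Big)^{\frac12},$$ $$\mathcal H_0=\sum_{i=1}^2\int_U H(x,|\nabla p_i(x,0)|)\,dx,\quad \bar{\mathcal P}_0=\sum_{i=1}^2\int_U\bar p_i(x,0)^2\phi\,dx,\quad \tilde G_k=G_k[\Psi_1]+G_k[\Psi_2]\ (k=1,2).$$ Given continuous increasing functions $\mathcal M[\Psi_i]$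 on $[0,\infty)$ with $\mathcal M[\Psi_i]\ge G[\Psi_i]$, let $\tilde{\mathcal M}=\mathcal M[\Psi_1]+\mathcal M[\Psi_2]$ and, for $t_0\in(0,1]$, $$\mathcal M_1(t)=\mathcal H_0+\bar{\mathcal P}_0+\tilde{\mathcal M}(t)^{\frac2{2-a}}+\sup_{[0,t]}\tilde G_1,\qquad \mathcal M_2(t)=t_0^{-1}(\mathcal H_0+\bar{\mathcal P}_0)+\tilde{\mathcal M}(t)^{\frac2{2-a}}+\sup_{[0,t]}(\tilde G_1+\tilde G_2).$$ Finally let $\tilde{\mathcal A}=\sum_{i}\limsup_{t\to\infty}G[\Psi_i](t)$, $\mathcal G_k=\sum_i\limsup_{t\to\infty}G_k[\Psi_i](t)$ for $k=1,2$, and $\mathcal D=\limsup_{t\to\infty}D(t)$, all in $[0,\infty]$. **Theorem.** There are constants $C,d_4>0$ depending only on $n$, $U$, $N$, $\alpha_0,\dots,\alpha_N$ and $c_P$ (not on $\phi$, the functions $a_j$, the solutions, the data $\Psi_i$, the functions $\mathcal M[\Psi_i]$ or $t_0$) such that, in the above setting, the following hold. (i) For all $t_0\in(0,1]$ and $t\ge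 t_0$, $$\|\nabla\bar P(t)\|_{L^{2-a}_{W_1}}^2\le C\mathcal M_2(t)^{\kappa_0}\Big(e^{-d_4\int_0^t\mathcal M_1(\tau)^{-\frac a{2-a}}d\tau}\|\bar P(0)\|_{L^2_\phi}^2+D(t)^2+\int_0^te^{-d_4\int_s^t\mathcal M_1(\tau)^{-\frac a{2-a}}d\tau}\mathcal M_1(s)^{\frac12}D(s)\,ds\Big)^{\frac12}.$$ (ii) If $\mathcal D>0$, or if $\tilde{\mathcal A},\mathcal G_1,\mathcal G_2<\infty$ (so that the right-hand side below is not of the form $\infty\cdot 0$), then $$\limsup_{t\to\infty}\|\nabla\bar P(t)\|_{L^{2-a}_{W_1}}^2\le C\Big[\big(\tilde{\mathcal A}^{\frac2{2-a}}+\mathcal G_1+\mathcal G_2\big)^{3\kappa_0}\mathcal D\Big]^{\frac12}+C\big(\tilde{\mathcal A}^{\frac2{2-a}}+\mathcal G_1\big)^{\kappa_0}\mathcal D.$$ -/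

import Mathlib

open MeasureTheory Filter Set
open scoped ENNReal Topology ContDiff RealInnerProductSpace

noncomputable section

namespace Forchheimer

/-! ### The Forchheimer polynomial, the function `K` and the function `H` -/

/-- The generalized polynomial `g(s) = c₀ s^{α₀} + ⋯ + c_N s^{α_N}`. -/
def forchPoly {N : ℕ} (α c : Fin (N + 1) → ℝ) (s : ℝ) : ℝ :=
  ∑ j, c j * s ^ α j

/-- The non-negative solution `s` of `s g(s) = ξ`
(it exists and is unique by `existsUnique_forchRoot`). -/
def forchRoot {N : ℕ} (α c : Fin (N + 1) → ℝ) (ξ : ℝ) : ℝ :=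
  Classical.epsilon fun s : ℝ => 0 ≤ s ∧ s * forchPoly α c s = ξ

/-- `K(ξ) = 1 / g(s(ξ))`. -/
def forchK {N : ℕ} (α c : Fin (N + 1) → ℝ) (ξ : ℝ) : ℝ :=
  1 / forchPoly α c (forchRoot α c ξ)

/-- `H(ξ) = ∫₀^{ξ²} K(√s) ds`. -/
def forchH {N : ℕ} (α c : Fin (N + 1) → ℝ) (ξ : ℝ) : ℝ :=
  ∫ s in (0 : ℝ)..ξ ^ 2, forchK α c (Real.sqrt s)

/-- The exponent `a = α_N / (α_N + 1)`. -/
def expA {N : ℕ} (α : Fin (N + 1) → ℝ) : ℝ :=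
  α (Fin.last N) / (α (Fin.last N) + 1)

/-- `κ₀ = a / (2 - a) + 1 / 2`. -/
def kappa {N : ℕ} (α : Fin (N + 1) → ℝ) : ℝ :=
  expA α / (2 - expA α) + 1 / 2

theorem existsUnique_forchRoot {N : ℕ} {α c : Fin (N + 1) → ℝ} (h0 : α 0 = 0)
    (hα : StrictMono α) (hc : ∀ j, 0 ≤ c j) (hc0 : 0 < c 0) {ξ : ℝ} (hξ : 0 ≤ ξ) :
    ∃! s : ℝ, 0 ≤ s ∧ s * forchPoly α c s = ξ := by
  have hα0 : ∀ j, 0 ≤ α j := fun j => h0 ▸ hα.monotone (Fin.zero_le j)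
  have hmono : ∀ s t : ℝ, 0 ≤ s → s ≤ t → forchPoly α c s ≤ forchPoly α c t := by
    intro s t hs hst
    exact Finset.sum_le_sum fun j _ =>
      mul_le_mul_of_nonneg_left (Real.rpow_le_rpow hs hst (hα0 j)) (hc j)
  have hlow : ∀ s : ℝ, 0 ≤ s → c 0 ≤ forchPoly α c s := by
    intro s hs
    have h := Finset.single_le_sum (f := fun j => c j * s ^ α j)
      (fun j _ => mul_nonneg (hc j) (Real.rpow_nonneg hs _)) (Finset.mem_univ 0)
    simpa [forchPoly, h0] using h
  have hcont : Continuous fun s : ℝ => s * forchPoly α c s := by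
    unfold forchPoly
    exact continuous_id.mul (continuous_finsetSum _ fun j _ =>
      continuous_const.mul (Real.continuous_rpow_const (hα0 j)))
  have hstrict : ∀ s t : ℝ, 0 ≤ s → s < t →
      s * forchPoly α c s < t * forchPoly α c t := by
    intro s t hs hst
    have h1 := hmono s t hs hst.le
    have h2 := hlow t (hs.trans hst.le)
    nlinarith
  have hmem : ξ ∈ Icc ((0 : ℝ) * forchPoly α c 0) ((ξ / c 0) * forchPoly α c (ξ / c 0)) := by
    constructor
    · simpa using hξ
    · have h1 := hlow (ξ / c 0) (by positivity)
      have h2 : ξ / c 0 * c 0 = ξ := by field_simp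
      have h3 : 0 ≤ ξ / c 0 := by positivity
      nlinarith
  obtain ⟨s, hs, hse⟩ := intermediate_value_Icc (by positivity) hcont.continuousOn hmem
  refine ⟨s, ⟨hs.1, hse⟩, ?_⟩
  rintro t ⟨ht, hte⟩
  rcases lt_trichotomy t s with h | h | h
  · have := hstrict t s ht h
    simp only at hse
    linarith
  · exact h
  · have := hstrict s t hs.1 h
    simp only at hse
    linarith

theorem forchRoot_spec {N : ℕ} {α c : Fin (N + 1) → ℝ} (h0 : α 0 = 0)
    (hα : StrictMono α) (hc : ∀ j, 0 ≤ c j) (hc0 : 0 < c 0) {ξ : ℝ} (hξ : 0 ≤ ξ) :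
    0 ≤ forchRoot α c ξ ∧ forchRoot α c ξ * forchPoly α c (forchRoot α c ξ) = ξ :=
  Classical.epsilon_spec (p := fun s : ℝ => 0 ≤ s ∧ s * forchPoly α c s = ξ)
    (existsUnique_forchRoot h0 hα hc hc0 hξ).exists

/-! ### The heterogeneous medium -/

/-- The porosity `φ` and the coefficient functions `a₀, …, a_N` on `U`.
Values outside `U` play no role. -/
structure Medium {n : ℕ} (U : Set (EuclideanSpace ℝ (Fin n))) {N : ℕ}
    (α : Fin (N + 1) → ℝ) where
  /-- the porosity -/
  phi : EuclideanSpace ℝ (Fin n) → ℝ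
  /-- the coefficient functions -/
  coef : Fin (N + 1) → EuclideanSpace ℝ (Fin n) → ℝ
  measurable_phi : Measurable phi
  measurable_coef : ∀ j, Measurable (coef j)
  phi_mem : ∀ x ∈ U, phi x ∈ Ioc (0 : ℝ) 1
  coef_nonneg : ∀ j, ∀ x ∈ U, 0 ≤ coef j x
  coef_zero_pos : ∀ x ∈ U, 0 < coef 0 x
  coef_last_pos : ∀ x ∈ U, 0 < coef (Fin.last N) x
  integrable_coef_last : IntegrableOn (coef (Fin.last N)) U volume

namespace Medium

variable {n : ℕ} {U : Set (EuclideanSpace ℝ (Fin n))} {N : ℕ} {α : Fin (N + 1) → ℝ}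

/-- `K(x, ξ)`. -/
def K (m : Medium U α) (x : EuclideanSpace ℝ (Fin n)) (ξ : ℝ) : ℝ :=
  forchK α (fun j => m.coef j x) ξ

/-- `H(x, ξ)`. -/
def H (m : Medium U α) (x : EuclideanSpace ℝ (Fin n)) (ξ : ℝ) : ℝ :=
  forchH α (fun j => m.coef j x) ξ

/-- `M(x) = max_j a_j(x)`. -/
def coefMax (m : Medium U α) (x : EuclideanSpace ℝ (Fin n)) : ℝ :=
  Finset.univ.sup' Finset.univ_nonempty fun j => m.coef j x

/-- `W₁(x) = a_N(x)^a / (2 N M(x))`. -/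
def W1 (m : Medium U α) (x : EuclideanSpace ℝ (Fin n)) : ℝ :=
  m.coef (Fin.last N) x ^ expA α / (2 * N * m.coefMax x)

/-- The measure `φ(x) dx` on `U`. -/
def muPhi (m : Medium U α) : Measure (EuclideanSpace ℝ (Fin n)) :=
  (volume.restrict U).withDensity fun x => ENNReal.ofReal (m.phi x)

/-- The measure `a₀(x)⁻¹ dx` on `U`. -/
def muA (m : Medium U α) : Measure (EuclideanSpace ℝ (Fin n)) :=
  (volume.restrict U).withDensity fun x => ENNReal.ofReal ((m.coef 0 x)⁻¹)

/-- The weighted space `L²_φ(U)`. -/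
abbrev L2Phi (m : Medium U α) : Type := Lp ℝ 2 m.muPhi

/-- The weighted space `L²_{1/a₀}(U)` of vector fields. -/
abbrev L2A (m : Medium U α) : Type := Lp (EuclideanSpace ℝ (Fin n)) 2 m.muA

end Medium

/-! ### Weak gradients, test functions, boundary values -/

/-- `η ∈ C_c^∞(U)`. -/
def IsTestFunction {n : ℕ} (U : Set (EuclideanSpace ℝ (Fin n)))
    (η : EuclideanSpace ℝ (Fin n) → ℝ) : Prop :=
  ContDiff ℝ ∞ η ∧ HasCompactSupport η ∧ tsupport η ⊆ U

/-- `v` is the weak (distributional) gradient of `u` on `U`. -/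
def HasWeakGradient {n : ℕ} (U : Set (EuclideanSpace ℝ (Fin n)))
    (u : EuclideanSpace ℝ (Fin n) → ℝ)
    (v : EuclideanSpace ℝ (Fin n) → EuclideanSpace ℝ (Fin n)) : Prop :=
  LocallyIntegrableOn u U volume ∧ LocallyIntegrableOn v U volume ∧
    ∀ η, IsTestFunction U η →
      ∫ x in U, u x • gradient η x = -∫ x in U, η x • v x

section Solutions

variable {n : ℕ} {U : Set (EuclideanSpace ℝ (Fin n))} {N : ℕ} {α : Fin (N + 1) → ℝ}

/-- Test functions whose gradient has finite `L²_{1/a₀}` norm. If `1/a₀` is locally integrable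
on `U`, these are all test functions. -/
def IsAdmissibleTest (m : Medium U α) (η : EuclideanSpace ℝ (Fin n) → ℝ) : Prop :=
  IsTestFunction U η ∧ MemLp (gradient η) 2 m.muA

/-- `u`, with gradient `v`, vanishes on the boundary of `U`: the pair `(u, v)` is the limit in
`L²_φ × L²_{1/a₀}` of pairs `(η, ∇η)` with `η ∈ C_c^∞(U)`. -/
def VanishesOnBoundary (m : Medium U α) (u : m.L2Phi) (v : m.L2A) : Prop :=
  (u, v) ∈ closure {w : m.L2Phi × m.L2A | ∃ η, IsAdmissibleTest m η ∧
    w.1 =ᵐ[volume.restrict U] η ∧ w.2 =ᵐ[volume.restrict U] gradient η}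

/-- A function `u(x,t)` on `U × [0,∞)` with `u ∈ C([0,∞); L²_φ)`, `∇u ∈ C([0,∞); L²_{1/a₀})`
(`∇` is the weak gradient), `u` twice differentiable on `(0,∞)` in `L²_φ`, and `∇u`
differentiable on `(0,∞)` in `L²_{1/a₀}`, with `∂ₜ∇u = ∇uₜ`. The values at `t = 0` of the
fields for time derivatives are not constrained here. -/
structure RegularPath (m : Medium U α) where
  /-- `u(·,t)` -/
  val : ℝ → m.L2Phi
  /-- `∇u(·,t)` -/
  grad : ℝ → m.L2A
  /-- `uₜ(·,t)` -/
  dval : ℝ → m.L2Phi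
  /-- `∇uₜ(·,t)` -/
  dgrad : ℝ → m.L2A
  /-- `uₜₜ(·,t)` -/
  ddval : ℝ → m.L2Phi
  hasWeakGradient : ∀ t, 0 ≤ t → HasWeakGradient U (val t) (grad t)
  hasWeakGradient_deriv : ∀ t, 0 < t → HasWeakGradient U (dval t) (dgrad t)
  continuousOn_val : ContinuousOn val (Ici 0)
  continuousOn_grad : ContinuousOn grad (Ici 0)
  hasDerivAt_val : ∀ t, 0 < t → HasDerivAt val (dval t) t
  hasDerivAt_grad : ∀ t, 0 < t → HasDerivAt grad (dgrad t) t
  hasDerivAt_dval : ∀ t, 0 < t → HasDerivAt dval (ddval t) t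

/-- `φ pₜ = ∇ · (K(x,|∇p|) ∇p)` on `U × (0,∞)`, in the weak sense in `x` at each time. -/
def SolvesEquation (m : Medium U α) (p : RegularPath m) : Prop :=
  ∀ t, 0 < t → ∀ η, IsAdmissibleTest m η →
    ∫ x in U, m.phi x * p.dval t x * η x =
      -∫ x in U, m.K x ‖p.grad t x‖ * ⟪p.grad t x, gradient η x⟫

/-- `p` solves the equation, and `p = Ψ` on `∂U × (0,∞)`. -/
def IsSolution (m : Medium U α) (p Ψ : RegularPath m) : Prop :=
  SolvesEquation m p ∧
    ∀ t, 0 < t → VanishesOnBoundary m (p.val t - Ψ.val t) (p.grad t - Ψ.grad t)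

/-! ### Norms and the quantities built from the data -/

/-- The weighted norm `‖u‖_{L^q_f(U)} = (∫_U f |u|^q dx)^{1/q}`. -/
def wNorm {F : Type*} [NormedAddCommGroup F] (U : Set (EuclideanSpace ℝ (Fin n)))
    (f : EuclideanSpace ℝ (Fin n) → ℝ) (q : ℝ) (u : EuclideanSpace ℝ (Fin n) → F) : ℝ :=
  (∫ x in U, f x * ‖u x‖ ^ q) ^ (1 / q)

/-- The two-weight Poincaré–Sobolev inequality with constant `c` for `u` with gradient `v`. -/
def PoincareSobolev (m : Medium U α) (c : ℝ) (u : m.L2Phi) (v : m.L2A) : Prop :=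
  wNorm U m.phi 2 u ≤ c * wNorm U m.W1 (2 - expA α) v

/-- `B_* = max {∫_U a_N dx, 1}`. -/
def Bstar (m : Medium U α) : ℝ :=
  max (∫ x in U, m.coef (Fin.last N) x) 1

/-- `G[Ψ](t)`. -/
def G (m : Medium U α) (Ψ : RegularPath m) (t : ℝ) : ℝ :=
  Bstar m + (∫ x in U, (m.coef 0 x)⁻¹ * ‖Ψ.grad t x‖ ^ 2)
    + (∫ x in U, m.W1 x * ‖Ψ.grad t x‖ ^ (2 - expA α))
    + (∫ x in U, (Ψ.dval t x) ^ 2 * m.phi x) ^ ((2 - expA α) / (2 * (1 - expA α)))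

/-- `G₁[Ψ](t) = ∫_U a₀⁻¹ |∇Ψₜ|² dx`. -/
def G1 (m : Medium U α) (Ψ : RegularPath m) (t : ℝ) : ℝ :=
  ∫ x in U, (m.coef 0 x)⁻¹ * ‖Ψ.dgrad t x‖ ^ 2

/-- `G₂[Ψ](t) = ∫_U |Ψₜₜ|² φ dx`. -/
def G2 (m : Medium U α) (Ψ : RegularPath m) (t : ℝ) : ℝ :=
  ∫ x in U, (Ψ.ddval t x) ^ 2 * m.phi x

/-- `M` is a continuous increasing function on `[0,∞)` with `M ≥ g`. -/
def IsMajorant (M g : ℝ → ℝ) : Prop :=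
  ContinuousOn M (Ici 0) ∧ MonotoneOn M (Ici 0) ∧ ∀ t, 0 ≤ t → g t ≤ M t

/-- `D(t)`, with `Φ = Ψ₁ - Ψ₂`. -/
def D (m : Medium U α) (Ψ₁ Ψ₂ : RegularPath m) (t : ℝ) : ℝ :=
  (∫ x in U, (m.coef 0 x)⁻¹ * ‖(Ψ₁.grad t - Ψ₂.grad t) x‖ ^ 2)
    + (∫ x in U, (m.coef 0 x)⁻¹ * ‖(Ψ₁.grad t - Ψ₂.grad t) x‖ ^ 2) ^ (1 / 2 : ℝ)
    + (∫ x in U, ((Ψ₁.dval t - Ψ₂.dval t) x) ^ 2 * m.phi x) ^ (1 / 2 : ℝ)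

/-- `P̄(t) = (p₁ - Ψ₁)(t) - (p₂ - Ψ₂)(t)`. -/
def Pbar {m : Medium U α} (p₁ Ψ₁ p₂ Ψ₂ : RegularPath m) (t : ℝ) : m.L2Phi :=
  (p₁.val t - Ψ₁.val t) - (p₂.val t - Ψ₂.val t)

/-- `∇P̄(t)`. -/
def gradPbar {m : Medium U α} (p₁ Ψ₁ p₂ Ψ₂ : RegularPath m) (t : ℝ) : m.L2A :=
  (p₁.grad t - Ψ₁.grad t) - (p₂.grad t - Ψ₂.grad t)

/-- `𝒫̄₀ = ∑ᵢ ∫_U p̄ᵢ(x,0)² φ dx`. -/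
def P0 (m : Medium U α) (p₁ Ψ₁ p₂ Ψ₂ : RegularPath m) : ℝ :=
  (∫ x in U, ((p₁.val 0 - Ψ₁.val 0) x) ^ 2 * m.phi x)
    + (∫ x in U, ((p₂.val 0 - Ψ₂.val 0) x) ^ 2 * m.phi x)

/-- `ℋ₀ = ∑ᵢ ∫_U H(x,|∇pᵢ(x,0)|) dx`. -/
def H0 (m : Medium U α) (p₁ p₂ : RegularPath m) : ℝ :=
  (∫ x in U, m.H x ‖p₁.grad 0 x‖) + (∫ x in U, m.H x ‖p₂.grad 0 x‖)

/-- `ℳ₁(t) = ℋ₀ + 𝒫̄₀ + ℳ̃(t)^{2/(2-a)} + sup_{[0,t]} G̃₁`, where `ℳ̃ = M₁ + M₂`. -/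
def calM1 (m : Medium U α) (p₁ Ψ₁ p₂ Ψ₂ : RegularPath m) (M₁ M₂ : ℝ → ℝ) (t : ℝ) : ℝ :=
  H0 m p₁ p₂ + P0 m p₁ Ψ₁ p₂ Ψ₂ + (M₁ t + M₂ t) ^ (2 / (2 - expA α))
    + sSup ((fun τ => G1 m Ψ₁ τ + G1 m Ψ₂ τ) '' Icc 0 t)

/-- `ℳ₂(t) = t₀⁻¹(ℋ₀ + 𝒫̄₀) + ℳ̃(t)^{2/(2-a)} + sup_{[0,t]} (G̃₁ + G̃₂)`. -/
def calM2 (m : Medium U α) (p₁ Ψ₁ p₂ Ψ₂ : RegularPath m) (M₁ M₂ : ℝ → ℝ) (t₀ t : ℝ) : ℝ :=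
  t₀⁻¹ * (H0 m p₁ p₂ + P0 m p₁ Ψ₁ p₂ Ψ₂) + (M₁ t + M₂ t) ^ (2 / (2 - expA α))
    + sSup ((fun τ => (G1 m Ψ₁ τ + G1 m Ψ₂ τ) + (G2 m Ψ₁ τ + G2 m Ψ₂ τ)) '' Icc 0 t)

/-- `limsup_{t → ∞} f(t)` of a non-negative function, in `[0,∞]`. -/
def limsupInfty (f : ℝ → ℝ) : ℝ≥0∞ :=
  limsup (fun t => ENNReal.ofReal (f t)) atTop

end Solutions

end Forchheimer

end

open Forchheimer

/-! The flux `y ↦ K(|y|) y` is the inverse of the explicit radial map `w ↦ g(|w|) w`. Computing in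
the variable `w` gives two pointwise facts. The first is cocoercivity, `flux_cocoercive`: after
multiplication by `a₀` the flux is a firmly nonexpansive operator on `L²_{1/a₀}`
(`fluxLp_cocoercive`), so every cross term with boundary data is absorbed at the price of an
`L²_{1/a₀}` norm of the data. The second is degenerate strong monotonicity, `K_mul_norm_sub_sq_le`,
with a constant depending only on `α_N`. Hölder's inequality and the comparison of `W₁` with `K`
turn it into `wNorm_sq_le`: the squared norm of `∇P̄` is at most a constant times `(R + ‖∇Φ‖²)
J^{a/(2-a)}`. Here `R` is the pairing of the flux difference with `∇(p₁ - p₂)`, and `J` is the sum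
of the two dissipations and `B_*`.

Subtracting the two equations and testing with `P̄` gives `(p₁ₜ - p₂ₜ, P̄) = -R +` (a term with
`∇Φ`). This identity is used twice in `exists_pair_estimate`. Read as a formula for the time
derivative of `‖P̄‖²`, it gives, with the Poincaré inequality, a linear damping of order
`J^{-a/(2-a)}` and a forcing of order `J^{1/2} D`. Read as a bound for `R`, it controls `∇P̄` by
`‖pᵢₜ‖ ‖P̄‖` and `D`. The product `J^{a/(2-a)} ‖pₜ‖` is the source of `κ₀ = a/(2-a) + 1/2`.

It remains to bound the energies and `‖pᵢₜ‖`. Testing one equation with `p̄` and with `p̄ₜ`, and its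
time increments with the increments of `p̄`, gives `exists_energyIneq`; comparison arguments then
give `exists_energy_bound` and `exists_eventual_energy_bound`. Part (i) follows by Gronwall's
inequality, part (ii) from the same inequalities with eventual bounds on the data in place of
majorants. -/

namespace Forchheimer

/-! ### The scalar functions `g`, `s`, `K`, `H` and the flux at a single point -/

/-- Admissible exponents and coefficients of a Forchheimer polynomial. -/
structure IsForch {N : ℕ} (α c : Fin (N + 1) → ℝ) : Prop where
  zero : α 0 = 0
  mono : StrictMono α
  nonneg : ∀ j, 0 ≤ c j
  pos : 0 < c 0

namespace IsForch

variable {N : ℕ} {α c : Fin (N + 1) → ℝ}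

theorem exponent_nonneg (h : IsForch α c) (j : Fin (N + 1)) : 0 ≤ α j :=
  h.zero ▸ h.mono.monotone (Fin.zero_le j)

theorem poly_mono (h : IsForch α c) {s t : ℝ} (hs : 0 ≤ s) (hst : s ≤ t) :
    forchPoly α c s ≤ forchPoly α c t :=
  Finset.sum_le_sum fun j _ =>
    mul_le_mul_of_nonneg_left (Real.rpow_le_rpow hs hst (h.exponent_nonneg j)) (h.nonneg j)

theorem le_poly (h : IsForch α c) {s : ℝ} (hs : 0 ≤ s) : c 0 ≤ forchPoly α c s := by
  have h1 := Finset.single_le_sum (f := fun j => c j * s ^ α j)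
    (fun j _ => mul_nonneg (h.nonneg j) (Real.rpow_nonneg hs _)) (Finset.mem_univ 0)
  simpa [forchPoly, h.zero] using h1

theorem last_le_poly (h : IsForch α c) {s : ℝ} (hs : 0 ≤ s) :
    c (Fin.last N) * s ^ α (Fin.last N) ≤ forchPoly α c s :=
  Finset.single_le_sum (f := fun j => c j * s ^ α j)
    (fun j _ => mul_nonneg (h.nonneg j) (Real.rpow_nonneg hs _)) (Finset.mem_univ (Fin.last N))

theorem poly_pos (h : IsForch α c) {s : ℝ} (hs : 0 ≤ s) : 0 < forchPoly α c s :=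
  h.pos.trans_le (h.le_poly hs)

theorem root_nonneg (h : IsForch α c) {ξ : ℝ} (hξ : 0 ≤ ξ) : 0 ≤ forchRoot α c ξ :=
  (forchRoot_spec h.zero h.mono h.nonneg h.pos hξ).1

theorem root_mul (h : IsForch α c) {ξ : ℝ} (hξ : 0 ≤ ξ) :
    forchRoot α c ξ * forchPoly α c (forchRoot α c ξ) = ξ :=
  (forchRoot_spec h.zero h.mono h.nonneg h.pos hξ).2

/-- `s g(s)` is increasing, so the sublevel sets of the root are described by the polynomial alone.
Monotonicity in `ξ` and joint measurability both come from this. -/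
theorem root_le_iff (h : IsForch α c) {ξ r : ℝ} (hξ : 0 ≤ ξ) (hr : 0 ≤ r) :
    forchRoot α c ξ ≤ r ↔ ξ ≤ r * forchPoly α c r := by
  have h0 := h.root_nonneg hξ
  have h1 := h.root_mul hξ
  constructor
  · intro h2
    rw [← h1]
    exact mul_le_mul h2 (h.poly_mono h0 h2) (h.poly_pos h0).le hr
  · intro h2
    by_contra! h3
    have h4 := h.poly_mono hr h3.le
    have h5 := h.poly_pos hr
    nlinarith

theorem root_mono (h : IsForch α c) {ξ η : ℝ} (hξ : 0 ≤ ξ) (hη : ξ ≤ η) :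
    forchRoot α c ξ ≤ forchRoot α c η := by
  rw [h.root_le_iff hξ (h.root_nonneg (hξ.trans hη)), h.root_mul (hξ.trans hη)]
  exact hη

theorem K_eq (α c : Fin (N + 1) → ℝ) (ξ : ℝ) :
    forchK α c ξ = 1 / forchPoly α c (forchRoot α c ξ) := rfl

theorem K_pos (h : IsForch α c) {ξ : ℝ} (hξ : 0 ≤ ξ) : 0 < forchK α c ξ :=
  one_div_pos.2 (h.poly_pos (h.root_nonneg hξ))

theorem K_mul_poly (h : IsForch α c) {ξ : ℝ} (hξ : 0 ≤ ξ) :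
    forchK α c ξ * forchPoly α c (forchRoot α c ξ) = 1 :=
  one_div_mul_cancel (h.poly_pos (h.root_nonneg hξ)).ne'

theorem K_le (h : IsForch α c) {ξ : ℝ} (hξ : 0 ≤ ξ) : forchK α c ξ ≤ (c 0)⁻¹ := by
  rw [K_eq, one_div]
  exact inv_anti₀ h.pos (h.le_poly (h.root_nonneg hξ))

theorem K_anti (h : IsForch α c) {ξ η : ℝ} (hξ : 0 ≤ ξ) (hη : ξ ≤ η) :
    forchK α c η ≤ forchK α c ξ :=
  one_div_le_one_div_of_le (h.poly_pos (h.root_nonneg hξ))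
    (h.poly_mono (h.root_nonneg hξ) (h.root_mono hξ hη))

theorem K_mul (h : IsForch α c) {ξ : ℝ} (hξ : 0 ≤ ξ) :
    forchK α c ξ * ξ = forchRoot α c ξ := by
  linear_combination forchRoot α c ξ * h.K_mul_poly hξ - forchK α c ξ * h.root_mul hξ

/-- The flux `K(|y|) y`. -/
noncomputable def _root_.Forchheimer.flux {E : Type*} [NormedAddCommGroup E] [InnerProductSpace ℝ E]
    {N : ℕ} (α c : Fin (N + 1) → ℝ) (y : E) : E := forchK α c ‖y‖ • y

section Flux

variable {E : Type*} [NormedAddCommGroup E] [InnerProductSpace ℝ E]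

theorem norm_flux (h : IsForch α c) (y : E) : ‖flux α c y‖ = forchRoot α c ‖y‖ := by
  rw [flux, norm_smul, Real.norm_of_nonneg (h.K_pos (norm_nonneg y)).le, h.K_mul (norm_nonneg y)]

/-- The inverse of the flux is explicit. Passing to `w = flux y` replaces the implicitly defined `K`
by the polynomial. -/
theorem eq_poly_smul_flux (h : IsForch α c) (y : E) :
    y = forchPoly α c ‖flux α c y‖ • flux α c y := by
  rw [h.norm_flux, flux, smul_smul, mul_comm, h.K_mul_poly (norm_nonneg y), one_smul]

theorem inner_sub_smul (A B : ℝ) (w z : E) :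
    ⟪w - z, A • w - B • z⟫ =
      (A + B) / 2 * ‖w - z‖ ^ 2 + (A - B) / 2 * (‖w‖ ^ 2 - ‖z‖ ^ 2) := by
  rw [@norm_sub_sq_real]
  simp only [inner_sub_left, inner_sub_right, real_inner_smul_right, real_inner_self_eq_norm_sq,
    real_inner_comm w z]
  ring

theorem norm_smul_sub_sq (A B : ℝ) (w z : E) :
    ‖A • w - B • z‖ ^ 2 =
      A * B * ‖w - z‖ ^ 2 + (A - B) * (A * ‖w‖ ^ 2 - B * ‖z‖ ^ 2) := by
  rw [@norm_sub_sq_real, @norm_sub_sq_real]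
  simp only [real_inner_smul_right, real_inner_smul_left, norm_smul, mul_pow, Real.norm_eq_abs,
    sq_abs]
  ring

/-- With `w`, `v` the two fluxes and `A`, `B` the values of `g` at their norms, the pairing is `(A +
B)/2 |w - v|² + (A - B)/2 (|w|² - |v|²)`. The last term is nonnegative because `g` increases, and
`A`, `B` are at least `c 0`. -/
theorem flux_cocoercive (h : IsForch α c) (y z : E) :
    c 0 * ‖flux α c y - flux α c z‖ ^ 2 ≤ ⟪flux α c y - flux α c z, y - z⟫ := by
  set w := flux α c y with hw
  set v := flux α c z with hv
  have h1 : y - z = forchPoly α c ‖w‖ • w - forchPoly α c ‖v‖ • v := by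
    rw [hw, hv, ← h.eq_poly_smul_flux, ← h.eq_poly_smul_flux]
  rw [h1, inner_sub_smul]
  have h2 := h.le_poly (norm_nonneg w)
  have h3 := h.le_poly (norm_nonneg v)
  have h4 : 0 ≤ (forchPoly α c ‖w‖ - forchPoly α c ‖v‖) / 2 * (‖w‖ ^ 2 - ‖v‖ ^ 2) := by
    rcases le_total ‖w‖ ‖v‖ with hle | hle
    · have := h.poly_mono (norm_nonneg w) hle
      have h5 : ‖w‖ ^ 2 ≤ ‖v‖ ^ 2 := by gcongr
      nlinarith
    · have := h.poly_mono (norm_nonneg v) hle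
      have h5 : ‖v‖ ^ 2 ≤ ‖w‖ ^ 2 := by gcongr
      nlinarith
  have h6 := sq_nonneg ‖w - v‖
  nlinarith

/-- The polynomial grows at most like its top power. -/
theorem poly_sub_mul_sq_le (h : IsForch α c) {s t : ℝ} (ht : 0 ≤ t) (hts : t ≤ s) :
    (forchPoly α c s - forchPoly α c t) * t ^ 2 ≤
      max 1 (α (Fin.last N)) * forchPoly α c s * (s ^ 2 - t ^ 2) := by
  rcases eq_or_lt_of_le ht with rfl | htpos
  · have := (h.poly_pos hts).le
    simp only [ne_eq, OfNat.ofNat_ne_zero, not_false_eq_true, zero_pow, mul_zero, sub_zero]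
    positivity
  have hs : 0 < s := htpos.trans_le hts
  set r := t / s with hr
  have hr0 : 0 < r := by positivity
  have hr1 : r ≤ 1 := (div_le_one hs).2 hts
  have htr : t = r * s := by rw [hr]; field_simp
  set A := α (Fin.last N)
  have hA0 : 0 ≤ A := h.exponent_nonneg _
  -- Term by term: `r ≤ 1` and every exponent is at most the top one.
  have h1 : r ^ A * forchPoly α c s ≤ forchPoly α c t := by
    unfold forchPoly
    rw [Finset.mul_sum]
    refine Finset.sum_le_sum fun j _ => ?_
    rw [htr, Real.mul_rpow hr0.le hs.le]
    have h2 : r ^ A ≤ r ^ α j :=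
      Real.rpow_le_rpow_of_exponent_ge hr0 hr1 (h.mono.monotone (Fin.le_last j))
    have h3 := mul_nonneg (h.nonneg j) (Real.rpow_nonneg hs.le (α j))
    nlinarith
  -- Bernoulli's inequality if `A ≥ 1`; if `A ≤ 1`, simply `r ≤ r ^ A`.
  have h2 : 1 - r ^ A ≤ max 1 A * (1 - r) := by
    rcases le_total 1 A with hA | hA
    · have := one_add_mul_self_le_rpow_one_add (s := r - 1) (by linarith) hA
      rw [max_eq_right hA]
      rw [show 1 + (r - 1) = r by ring] at this
      linarith
    · have : r ^ (1 : ℝ) ≤ r ^ A := Real.rpow_le_rpow_of_exponent_ge hr0 hr1 hA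
      rw [Real.rpow_one] at this
      rw [max_eq_left hA]
      linarith
  have hp := h.poly_pos hs.le
  have hm : 0 ≤ max 1 A * (1 - r) := mul_nonneg (by positivity) (by linarith)
  calc (forchPoly α c s - forchPoly α c t) * t ^ 2
      ≤ ((1 - r ^ A) * forchPoly α c s) * t ^ 2 := by
        gcongr; linarith
    _ ≤ (max 1 A * (1 - r) * forchPoly α c s) * t ^ 2 := by gcongr
    _ = max 1 A * forchPoly α c s * s ^ 2 * ((1 - r) * r ^ 2) := by rw [htr]; ring
    _ ≤ max 1 A * forchPoly α c s * s ^ 2 * (1 - r ^ 2) := by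
        gcongr
        nlinarith [mul_nonneg hr0.le (sub_nonneg.2 hr1)]
    _ = _ := by rw [htr]; ring

/-- Let `|v| ≤ |w|`, so that `K` at the larger norm is `1/A`. In `|y - z|² = AB|w - v|² + (A -
B)(A|w|² - B|v|²)` the last bracket is `A(|w|² - |v|²) + (A - B)|v|²`. By `poly_sub_mul_sq_le` its
second summand is at most a multiple of its first, so the constant does not see the coefficients. -/
theorem K_mul_norm_sub_sq_le (h : IsForch α c) (y z : E) :
    forchK α c (max ‖y‖ ‖z‖) * ‖y - z‖ ^ 2 ≤
      (2 + 2 * max 1 (α (Fin.last N))) * ⟪flux α c y - flux α c z, y - z⟫ := by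
  wlog hle : ‖z‖ ≤ ‖y‖ generalizing y z
  · have := this z y (not_le.1 hle).le
    rw [max_comm, norm_sub_rev, ← neg_sub (flux α c z), ← neg_sub z, inner_neg_neg]
    exact this
  rw [max_eq_left hle]
  set w := flux α c y with hw
  set v := flux α c z with hv
  have h1 : y - z = forchPoly α c ‖w‖ • w - forchPoly α c ‖v‖ • v := by
    rw [hw, hv, ← h.eq_poly_smul_flux, ← h.eq_poly_smul_flux]
  have hwv : ‖v‖ ≤ ‖w‖ := by
    rw [hw, hv, h.norm_flux, h.norm_flux]
    exact h.root_mono (norm_nonneg z) hle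
  rw [h1, inner_sub_smul, norm_smul_sub_sq, K_eq, ← h.norm_flux y, ← hw, one_div,
    inv_mul_le_iff₀ (h.poly_pos (norm_nonneg w))]
  have hAB := h.poly_mono (norm_nonneg v) hwv
  have hmain := h.poly_sub_mul_sq_le (norm_nonneg v) hwv
  have hB := h.poly_pos (norm_nonneg v)
  set A := forchPoly α c ‖w‖
  set B := forchPoly α c ‖v‖
  set m := max 1 (α (Fin.last N))
  have hm : 1 ≤ m := le_max_left _ _
  have hd : 0 ≤ ‖w‖ ^ 2 - ‖v‖ ^ 2 := sub_nonneg.2 (by gcongr)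
  have hx := sq_nonneg ‖w - v‖
  have e1 : (A - B) * ((A - B) * ‖v‖ ^ 2) ≤ (A - B) * (m * A * (‖w‖ ^ 2 - ‖v‖ ^ 2)) :=
    mul_le_mul_of_nonneg_left hmain (by linarith)
  have e2 : A * B * ‖w - v‖ ^ 2 ≤ A * ((2 + 2 * m) * ((A + B) / 2)) * ‖w - v‖ ^ 2 := by
    gcongr
    · linarith
    · nlinarith
  nlinarith [mul_nonneg (mul_nonneg (sub_nonneg.2 hAB) hd) (hB.le.trans hAB)]

end Flux

/-- On the half line the root is the one-dimensional flux, so this is cocoercivity in `ℝ` with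
Cauchy–Schwarz. -/
theorem root_lipschitz (h : IsForch α c) {ξ η : ℝ} (hξ : 0 ≤ ξ) (hη : 0 ≤ η) :
    |forchRoot α c ξ - forchRoot α c η| ≤ (c 0)⁻¹ * |ξ - η| := by
  have key := h.flux_cocoercive ξ η
  have hf : ∀ x : ℝ, 0 ≤ x → flux α c x = forchRoot α c x := by
    intro x hx
    rw [flux, Real.norm_of_nonneg hx, smul_eq_mul, h.K_mul hx]
  rw [hf ξ hξ, hf η hη, Real.norm_eq_abs] at key
  have h2 : ⟪forchRoot α c ξ - forchRoot α c η, ξ - η⟫ ≤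
      |forchRoot α c ξ - forchRoot α c η| * |ξ - η| := real_inner_le_norm _ _
  rw [inv_mul_eq_div, le_div_iff₀ h.pos]
  rcases eq_or_lt_of_le (abs_nonneg (forchRoot α c ξ - forchRoot α c η)) with h3 | h3
  · rw [← h3, zero_mul]; positivity
  · have : |forchRoot α c ξ - forchRoot α c η| * (|forchRoot α c ξ - forchRoot α c η| * c 0) ≤
      |forchRoot α c ξ - forchRoot α c η| * |ξ - η| := by nlinarith
    exact le_of_mul_le_mul_left this h3

theorem continuousOn_root (h : IsForch α c) : ContinuousOn (forchRoot α c) (Ici 0) := by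
  refine (LipschitzOnWith.of_dist_le_mul (K := ⟨(c 0)⁻¹, (inv_pos.2 h.pos).le⟩) ?_).continuousOn
  intro x hx y hy
  exact h.root_lipschitz hx hy

theorem continuous_poly (h : IsForch α c) : Continuous (forchPoly α c) := by
  unfold forchPoly
  exact continuous_finsetSum _ fun j _ =>
    continuous_const.mul (Real.continuous_rpow_const (h.exponent_nonneg j))

theorem continuousOn_K (h : IsForch α c) : ContinuousOn (forchK α c) (Ici 0) :=
  continuousOn_const.div (h.continuous_poly.comp_continuousOn h.continuousOn_root)
    fun _ hx => (h.poly_pos (h.root_nonneg hx)).ne'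

theorem continuous_K_sqrt (h : IsForch α c) : Continuous fun s => forchK α c (Real.sqrt s) :=
  h.continuousOn_K.comp_continuous Real.continuous_sqrt fun x => Real.sqrt_nonneg x

theorem hasDerivAt_H (h : IsForch α c) {ξ : ℝ} (hξ : 0 ≤ ξ) :
    HasDerivAt (forchH α c) (2 * forchRoot α c ξ) ξ := by
  have h1 : HasDerivAt (fun u => ∫ s in (0 : ℝ)..u, forchK α c (Real.sqrt s))
      (forchK α c (Real.sqrt (ξ ^ 2))) (ξ ^ 2) :=
    intervalIntegral.integral_hasDerivAt_right (h.continuous_K_sqrt.intervalIntegrable _ _)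
      (h.continuous_K_sqrt.stronglyMeasurableAtFilter _ _) h.continuous_K_sqrt.continuousAt
  have h2 : HasDerivAt (forchH α c) _ ξ := h1.comp (h := fun x : ℝ => x ^ 2) ξ (hasDerivAt_pow 2 ξ)
  convert h2 using 1
  rw [Real.sqrt_sq hξ, ← h.K_mul hξ]
  push_cast
  ring

theorem H_zero (α c : Fin (N + 1) → ℝ) : forchH α c 0 = 0 := by simp [forchH]

/-- The derivative of `H` is twice the root, which increases; the mean value theorem gives the
tangent inequality on either side. -/
theorem H_convex (h : IsForch α c) {ξ η : ℝ} (hξ : 0 ≤ ξ) (hη : 0 ≤ η) :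
    2 * forchRoot α c ξ * (η - ξ) ≤ forchH α c η - forchH α c ξ := by
  have hc : ContinuousOn (forchH α c) (Ici 0) := fun x hx =>
    (h.hasDerivAt_H hx).continuousAt.continuousWithinAt
  rcases lt_trichotomy ξ η with hlt | rfl | hlt
  · obtain ⟨z, hz, hzeq⟩ := exists_hasDerivAt_eq_slope (forchH α c)
      (fun x => 2 * forchRoot α c x) hlt (hc.mono fun x hx => hξ.trans hx.1)
      fun x hx => h.hasDerivAt_H (hξ.trans hx.1.le)
    rw [eq_div_iff (by linarith)] at hzeq
    rw [← hzeq]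
    have := h.root_mono hξ hz.1.le
    gcongr
  · simp
  · obtain ⟨z, hz, hzeq⟩ := exists_hasDerivAt_eq_slope (forchH α c)
      (fun x => 2 * forchRoot α c x) hlt (hc.mono fun x hx => hη.trans hx.1)
      fun x hx => h.hasDerivAt_H (hη.trans hx.1.le)
    rw [eq_div_iff (by linarith)] at hzeq
    have := h.root_mono (hη.trans hz.1.le) hz.2.le
    nlinarith

theorem H_le (h : IsForch α c) {ξ : ℝ} (hξ : 0 ≤ ξ) :
    forchH α c ξ ≤ 2 * (forchK α c ξ * ξ ^ 2) := by
  have h1 := h.H_convex hξ le_rfl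
  rw [H_zero, ← h.K_mul hξ] at h1
  nlinarith

theorem le_H (h : IsForch α c) {ξ : ℝ} (hξ : 0 ≤ ξ) :
    forchK α c ξ * ξ ^ 2 ≤ forchH α c ξ := by
  have h1 : ∫ _ in (0 : ℝ)..ξ ^ 2, forchK α c ξ ≤ forchH α c ξ := by
    refine intervalIntegral.integral_mono_on (sq_nonneg ξ) intervalIntegrable_const
      (h.continuous_K_sqrt.intervalIntegrable _ _) fun s hs => ?_
    exact h.K_anti (Real.sqrt_nonneg s) (Real.sqrt_le_iff.2 ⟨hξ, hs.2⟩)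
  simpa [mul_comm] using h1

/-- Cauchy–Schwarz reduces this to the scalar inequality: `H(|·|)` is a convex potential for twice
the flux. -/
theorem H_norm_convex {E : Type*} [NormedAddCommGroup E] [InnerProductSpace ℝ E]
    (h : IsForch α c) (y z : E) :
    2 * ⟪flux α c y, z - y⟫ ≤ forchH α c ‖z‖ - forchH α c ‖y‖ := by
  refine le_trans ?_ (h.H_convex (norm_nonneg y) (norm_nonneg z))
  rw [inner_sub_right, flux, real_inner_smul_left, real_inner_smul_left,
    real_inner_self_eq_norm_sq, ← h.K_mul (norm_nonneg y)]
  have h1 := mul_le_mul_of_nonneg_left (real_inner_le_norm y z) (h.K_pos (norm_nonneg y)).le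
  nlinarith

/-- The root is picked by a choice operator, so measurability cannot come from its construction; it
comes from the sublevel sets. -/
theorem root_measurable {X : Type*} [MeasurableSpace X] {c : X → Fin (N + 1) → ℝ}
    (h : ∀ x, IsForch α (c x)) (hc : ∀ j, Measurable fun x => c x j) {ξ : X → ℝ}
    (hξ : Measurable ξ) (hξ0 : ∀ x, 0 ≤ ξ x) :
    Measurable fun x => forchRoot α (c x) (ξ x) := by
  refine measurable_of_Iic fun r => ?_
  rcases lt_or_ge r 0 with hr | hr
  · convert MeasurableSet.empty
    ext x
    simpa using hr.trans_le ((h x).root_nonneg (hξ0 x))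
  · have : (fun x => forchRoot α (c x) (ξ x)) ⁻¹' Iic r =
        {x | ξ x ≤ r * forchPoly α (c x) r} := by
      ext x
      exact (h x).root_le_iff (hξ0 x) hr
    rw [this]
    refine measurableSet_le hξ (measurable_const.mul ?_)
    unfold forchPoly
    exact Finset.measurable_sum _ fun j _ => (hc j).mul_const _

theorem K_measurable {X : Type*} [MeasurableSpace X] {c : X → Fin (N + 1) → ℝ}
    (h : ∀ x, IsForch α (c x)) (hc : ∀ j, Measurable fun x => c x j) {ξ : X → ℝ}
    (hξ : Measurable ξ) (hξ0 : ∀ x, 0 ≤ ξ x) :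
    Measurable fun x => forchK α (c x) (ξ x) := by
  have h1 := root_measurable h hc hξ hξ0
  unfold forchK forchPoly
  exact measurable_const.div
    (Finset.measurable_sum _ fun j _ => (hc j).mul (h1.pow_const _))

/-- Rescaling to a fixed interval makes `H` a parameter integral, whose measurability follows from
joint measurability of the integrand. -/
theorem H_eq_integral (α c : Fin (N + 1) → ℝ) (ξ : ℝ) :
    forchH α c ξ = ξ ^ 2 * ∫ r in (0 : ℝ)..1, forchK α c (Real.sqrt (ξ ^ 2 * r)) := by
  rw [← smul_eq_mul, intervalIntegral.smul_integral_comp_mul_left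
    (fun s => forchK α c (Real.sqrt s)), mul_zero, mul_one, forchH]

theorem H_measurable {X : Type*} [MeasurableSpace X] {c : X → Fin (N + 1) → ℝ}
    (h : ∀ x, IsForch α (c x)) (hc : ∀ j, Measurable fun x => c x j) {ξ : X → ℝ}
    (hξ : Measurable ξ) : Measurable fun x => forchH α (c x) (ξ x) := by
  simp only [H_eq_integral, intervalIntegral.integral_of_le zero_le_one]
  refine (hξ.pow_const 2).mul ?_
  have h1 : Measurable fun p : X × ℝ => forchK α (c p.1) (Real.sqrt (ξ p.1 ^ 2 * p.2)) :=
    K_measurable (c := fun p : X × ℝ => c p.1) (fun p => h p.1)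
      (fun j => (hc j).comp measurable_fst)
      (((hξ.comp measurable_fst).pow_const 2).mul measurable_snd).sqrt
      fun _ => Real.sqrt_nonneg _
  exact h1.stronglyMeasurable.integral_prod_right.measurable

section Degenerate

variable {M : ℝ}

theorem expA_pos (h : IsForch α c) (hN : 1 ≤ N) : 0 < expA α := by
  have : 0 < α (Fin.last N) := by
    rw [← h.zero]
    exact h.mono (Fin.lt_def.2 (by simpa using Nat.lt_of_lt_of_le Nat.zero_lt_one hN))
  unfold expA
  positivity

theorem expA_lt_one (h : IsForch α c) : expA α < 1 := by
  have := h.exponent_nonneg (Fin.last N)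
  rw [expA, div_lt_one (by linarith)]
  linarith

/-- The degeneracy of `K` is at most that of `ξ ^ (-a)` away from `0`. -/
theorem weight_le_K_mul (h : IsForch α c) (hN : 1 ≤ N) (hM : ∀ j, c j ≤ M)
    (hcN : 0 < c (Fin.last N)) {ξ : ℝ} (hξ : 0 ≤ ξ) :
    c (Fin.last N) ^ expA α / (2 * N * M) ≤
      forchK α c ξ * max ξ (c (Fin.last N)) ^ expA α := by
  have ha := h.expA_pos hN
  have hM0 : 0 < M := hcN.trans_le (hM _)
  have hN0 : (1 : ℝ) ≤ N := by exact_mod_cast hN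
  set s := forchRoot α c ξ with hs
  have hs0 : 0 ≤ s := h.root_nonneg hξ
  have hg := h.poly_pos hs0
  -- There are `N + 1 ≤ 2N` terms, whence the factor `2N` in `W₁`.
  have hbound : forchPoly α c s ≤ 2 * N * M * max 1 (s ^ α (Fin.last N)) := by
    calc forchPoly α c s ≤ ∑ _j : Fin (N + 1), M * max 1 (s ^ α (Fin.last N)) := by
          refine Finset.sum_le_sum fun j _ => ?_
          have : s ^ α j ≤ max 1 (s ^ α (Fin.last N)) := by
            rcases le_total s 1 with h1 | h1
            · exact (Real.rpow_le_one hs0 h1 (h.exponent_nonneg j)).trans (le_max_left _ _)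
            · exact (Real.rpow_le_rpow_of_exponent_le h1 (h.mono.monotone (Fin.le_last j))).trans
                (le_max_right _ _)
          gcongr
          exact hM j
      _ = (N + 1) * (M * max 1 (s ^ α (Fin.last N))) := by simp
      _ ≤ (2 * N) * (M * max 1 (s ^ α (Fin.last N))) := by gcongr; linarith
      _ = _ := by ring
  have hpow : c (Fin.last N) ^ expA α * max 1 (s ^ α (Fin.last N)) ≤
      max ξ (c (Fin.last N)) ^ expA α := by
    rcases le_total (s ^ α (Fin.last N)) 1 with h1 | h1
    · rw [max_eq_left h1, mul_one]
      exact Real.rpow_le_rpow hcN.le (le_max_right _ _) ha.le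
    · rw [max_eq_right h1]
      -- By definition `a (α_N + 1) = α_N`, and `a_N s^{α_N + 1} ≤ s g(s) = ξ`.
      have h2 : s ^ α (Fin.last N) = (s ^ (α (Fin.last N) + 1)) ^ expA α := by
        rw [← Real.rpow_mul hs0, expA, mul_div_cancel₀]
        have := h.exponent_nonneg (Fin.last N)
        positivity
      rw [h2, ← Real.mul_rpow hcN.le (Real.rpow_nonneg hs0 _)]
      refine Real.rpow_le_rpow (by positivity) (le_trans ?_ (le_max_left _ _)) ha.le
      have h3 := h.root_mul hξ
      rw [← hs] at h3
      rw [Real.rpow_add_one' hs0 (by have := h.exponent_nonneg (Fin.last N); positivity), ← h3]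
      have := mul_le_mul_of_nonneg_left (h.last_le_poly hs0) hs0
      linarith
  rw [K_eq, ← hs, div_le_iff₀ (by positivity), one_div, mul_assoc, ← div_eq_inv_mul,
    le_div_iff₀ hg]
  calc c (Fin.last N) ^ expA α * forchPoly α c s
      ≤ c (Fin.last N) ^ expA α * (2 * N * M * max 1 (s ^ α (Fin.last N))) := by gcongr
    _ = c (Fin.last N) ^ expA α * max 1 (s ^ α (Fin.last N)) * (2 * N * M) := by ring
    _ ≤ _ := by gcongr

/-- For `ξ ≥ c_N` multiply `weight_le_K_mul` by `ξ^{2-a}`. For smaller `ξ` the left side is `c_N² /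
(2NM)`, at most `c_N / 2` because `c_N ≤ M`; this is where the integral of `a_N` enters the
estimates. -/
theorem weight_mul_max_le (h : IsForch α c) (hN : 1 ≤ N) (hM : ∀ j, c j ≤ M)
    (hcN : 0 < c (Fin.last N)) {ξ : ℝ} (hξ : 0 ≤ ξ) :
    c (Fin.last N) ^ expA α / (2 * N * M) * max ξ (c (Fin.last N)) ^ (2 - expA α) ≤
      forchK α c ξ * ξ ^ 2 + c (Fin.last N) / 2 := by
  have ha := h.expA_pos hN
  have hM0 : 0 < M := hcN.trans_le (hM _)
  have hN0 : (1 : ℝ) ≤ N := by exact_mod_cast hN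
  have hK := h.K_pos hξ
  rcases le_total ξ (c (Fin.last N)) with h1 | h1
  · rw [max_eq_right h1, div_mul_eq_mul_div, ← Real.rpow_add hcN]
    have h2 : c (Fin.last N) ^ (expA α + (2 - expA α)) / (2 * N * M) ≤ c (Fin.last N) / 2 := by
      rw [show expA α + (2 - expA α) = (2 : ℕ) by push_cast; ring, Real.rpow_natCast,
        div_le_iff₀ (by positivity)]
      have := hM (Fin.last N)
      nlinarith [mul_le_mul hN0 this hcN.le (by positivity)]
    have : 0 ≤ forchK α c ξ * ξ ^ 2 := by positivity
    linarith
  · have h2 := h.weight_le_K_mul hN hM hcN hξ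
    have hξ0 : 0 < ξ := hcN.trans_le h1
    rw [max_eq_left h1] at h2 ⊢
    calc _ ≤ forchK α c ξ * ξ ^ expA α * ξ ^ (2 - expA α) := by gcongr
      _ = forchK α c ξ * ξ ^ 2 := by
        rw [mul_assoc, ← Real.rpow_add hξ0,
          show expA α + (2 - expA α) = (2 : ℕ) by push_cast; ring, Real.rpow_natCast]
      _ ≤ _ := by linarith

theorem weight_mul_rpow_le (h : IsForch α c) (hN : 1 ≤ N) (hM : ∀ j, c j ≤ M)
    (hcN : 0 < c (Fin.last N)) {ξ : ℝ} (hξ : 0 ≤ ξ) :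
    c (Fin.last N) ^ expA α / (2 * N * M) * ξ ^ (2 - expA α) ≤
      forchK α c ξ * ξ ^ 2 + c (Fin.last N) / 2 := by
  refine le_trans ?_ (h.weight_mul_max_le hN hM hcN hξ)
  have hM0 : 0 < M := hcN.trans_le (hM _)
  have := h.expA_lt_one
  gcongr
  · linarith
  · exact le_max_left _ _

/-- The integrand for Hölder's inequality. Put `m = max ξ c_N` and split the weight into powers
`(2-a)/2` and `a/2`: the first is bounded through `K m^a`, the second, joined with `m^{2-a}`, by
`weight_mul_max_le`. The two powers of `m` agree. -/
theorem weight_mul_rpow_le_mul (h : IsForch α c) (hN : 1 ≤ N) (hM : ∀ j, c j ≤ M)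
    (hcN : 0 < c (Fin.last N)) {ξ r : ℝ} (hξ : 0 ≤ ξ) (hr : 0 ≤ r) :
    c (Fin.last N) ^ expA α / (2 * N * M) * r ^ (2 - expA α) ≤
      (forchK α c ξ * r ^ 2) ^ ((2 - expA α) / 2) *
        (forchK α c ξ * ξ ^ 2 + c (Fin.last N) / 2) ^ (expA α / 2) := by
  have ha := h.expA_pos hN
  have ha1 := h.expA_lt_one
  have hM0 : 0 < M := hcN.trans_le (hM _)
  have hN0 : (1 : ℝ) ≤ N := by exact_mod_cast hN
  have hK := h.K_pos hξ
  have h1 := h.weight_le_K_mul hN hM hcN hξ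
  have h2 := h.weight_mul_max_le hN hM hcN hξ
  set a := expA α
  set W := c (Fin.last N) ^ a / (2 * N * M)
  set m := max ξ (c (Fin.last N))
  have hW : 0 < W := by positivity
  have hm : 0 < m := hcN.trans_le (le_max_right _ _)
  have e1 : W = W ^ ((2 - a) / 2) * W ^ (a / 2) := by
    rw [← Real.rpow_add hW, show (2 - a) / 2 + a / 2 = 1 by ring, Real.rpow_one]
  have e2 : r ^ (2 - a) = (r ^ 2) ^ ((2 - a) / 2) := by
    rw [← Real.rpow_natCast, ← Real.rpow_mul hr]
    congr 1
    push_cast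
    ring
  have e3 : (m ^ a) ^ ((2 - a) / 2) = (m ^ (2 - a)) ^ (a / 2) := by
    rw [← Real.rpow_mul hm.le, ← Real.rpow_mul hm.le]
    congr 1
    ring
  calc W * r ^ (2 - a) = W ^ ((2 - a) / 2) * W ^ (a / 2) * r ^ (2 - a) := by rw [← e1]
    _ ≤ (forchK α c ξ * m ^ a) ^ ((2 - a) / 2) * W ^ (a / 2) * r ^ (2 - a) := by
        gcongr
        linarith
    _ = (forchK α c ξ * r ^ 2) ^ ((2 - a) / 2) * (W * m ^ (2 - a)) ^ (a / 2) := by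
        rw [Real.mul_rpow hK.le (by positivity), Real.mul_rpow hK.le (by positivity),
          Real.mul_rpow hW.le (by positivity), e2, e3]
        ring
    _ ≤ _ := by gcongr

end Degenerate

end IsForch

/-! ### Weighted measures and Hölder's inequality -/

section WeightedMeasure

variable {X : Type*} [MeasurableSpace X] {μ : Measure X} {ρ : X → ℝ}

theorem ae_withDensity_ofReal (hρ : Measurable ρ) (hpos : ∀ᵐ x ∂μ, 0 < ρ x) :
    ae (μ.withDensity fun x => ENNReal.ofReal (ρ x)) = ae μ := by
  refine le_antisymm (withDensity_absolutelyContinuous μ _).ae_le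
    (withDensity_absolutelyContinuous' hρ.ennreal_ofReal.aemeasurable ?_).ae_le
  filter_upwards [hpos] with x hx
  simpa using hx

theorem integral_withDensity_ofReal (hρ : Measurable ρ) (hpos : ∀ᵐ x ∂μ, 0 < ρ x) (f : X → ℝ) :
    ∫ x, f x ∂(μ.withDensity fun x => ENNReal.ofReal (ρ x)) = ∫ x, ρ x * f x ∂μ := by
  rw [integral_withDensity_eq_integral_toReal_smul hρ.ennreal_ofReal (by simp)]
  refine integral_congr_ae ?_
  filter_upwards [hpos] with x hx
  rw [ENNReal.toReal_ofReal hx.le, smul_eq_mul]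

theorem integrable_withDensity_ofReal (hρ : Measurable ρ) (hpos : ∀ᵐ x ∂μ, 0 < ρ x) {f : X → ℝ} :
    Integrable f (μ.withDensity fun x => ENNReal.ofReal (ρ x)) ↔
      Integrable (fun x => ρ x * f x) μ := by
  rw [integrable_withDensity_iff_integrable_smul' hρ.ennreal_ofReal (by simp)]
  refine integrable_congr ?_
  filter_upwards [hpos] with x hx
  rw [ENNReal.toReal_ofReal hx.le, smul_eq_mul]

theorem inner_withDensity_ofReal {E : Type*} [NormedAddCommGroup E] [InnerProductSpace ℝ E]
    (hρ : Measurable ρ) (hpos : ∀ᵐ x ∂μ, 0 < ρ x)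
    (f g : Lp E 2 (μ.withDensity fun x => ENNReal.ofReal (ρ x))) :
    ⟪f, g⟫ = ∫ x, ρ x * ⟪f x, g x⟫ ∂μ := by
  rw [L2.inner_def, integral_withDensity_ofReal hρ hpos]

theorem integrable_inner_withDensity_ofReal {E : Type*} [NormedAddCommGroup E]
    [InnerProductSpace ℝ E] (hρ : Measurable ρ) (hpos : ∀ᵐ x ∂μ, 0 < ρ x)
    (f g : Lp E 2 (μ.withDensity fun x => ENNReal.ofReal (ρ x))) :
    Integrable (fun x => ρ x * ⟪f x, g x⟫) μ :=
  (integrable_withDensity_ofReal hρ hpos).1 (L2.integrable_inner (𝕜 := ℝ) f g)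

/-- Hölder's inequality with exponents `θ` and `1 - θ`, from a pointwise bound. -/
theorem integral_le_rpow_mul_rpow {θ : ℝ} (h0 : 0 ≤ θ) (h1 : θ ≤ 1) {f g h : X → ℝ}
    (hf : Integrable f μ) (hg : Integrable g μ) (hh : Integrable h μ)
    (hf0 : ∀ᵐ x ∂μ, 0 ≤ f x) (hg0 : ∀ᵐ x ∂μ, 0 ≤ g x)
    (hle : ∀ᵐ x ∂μ, h x ≤ f x ^ θ * g x ^ (1 - θ)) :
    ∫ x, h x ∂μ ≤ (∫ x, f x ∂μ) ^ θ * (∫ x, g x ∂μ) ^ (1 - θ) := by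
  -- Adding `ε` makes both integrals positive; then normalise by them and use the weighted
  -- arithmetic–geometric mean inequality.
  have key : ∀ ε : ℝ, 0 < ε → ∫ x, h x ∂μ ≤
      (∫ x, f x ∂μ + ε) ^ θ * (∫ x, g x ∂μ + ε) ^ (1 - θ) := by
    intro ε hε
    have hF0 := integral_nonneg_of_ae hf0
    have hG0 := integral_nonneg_of_ae hg0
    set F := ∫ x, f x ∂μ + ε with hF
    set G := ∫ x, g x ∂μ + ε with hG
    have hFp : 0 < F := by positivity
    have hGp : 0 < G := by positivity
    have hpt : ∀ᵐ x ∂μ, h x ≤ F ^ θ * G ^ (1 - θ) * (θ * (f x / F) + (1 - θ) * (g x / G)) := by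
      filter_upwards [hf0, hg0, hle] with x hfx hgx hx
      refine hx.trans ?_
      have := Real.geom_mean_le_arith_mean2_weighted h0 (sub_nonneg.2 h1)
        (div_nonneg hfx hFp.le) (div_nonneg hgx hGp.le) (by ring)
      calc f x ^ θ * g x ^ (1 - θ)
          = F ^ θ * G ^ (1 - θ) * ((f x / F) ^ θ * (g x / G) ^ (1 - θ)) := by
            rw [Real.div_rpow hfx hFp.le, Real.div_rpow hgx hGp.le]
            field_simp
        _ ≤ _ := by gcongr
    refine (integral_mono_ae hh ?_ hpt).trans ?_
    · exact (((hf.div_const F).const_mul θ).add ((hg.div_const G).const_mul _)).const_mul _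
    · rw [integral_const_mul, integral_add ((hf.div_const F).const_mul θ)
        ((hg.div_const G).const_mul _), integral_const_mul, integral_const_mul, integral_div,
        integral_div]
      refine mul_le_of_le_one_right (by positivity) ?_
      have e1 : (∫ x, f x ∂μ) / F ≤ 1 := (div_le_one hFp).2 (by linarith)
      have e2 : (∫ x, g x ∂μ) / G ≤ 1 := (div_le_one hGp).2 (by linarith)
      nlinarith [mul_le_mul_of_nonneg_left e1 h0, mul_le_mul_of_nonneg_left e2 (sub_nonneg.2 h1)]
  have hlim : Tendsto (fun ε : ℝ => (∫ x, f x ∂μ + ε) ^ θ * (∫ x, g x ∂μ + ε) ^ (1 - θ))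
      (𝓝[>] 0) (𝓝 ((∫ x, f x ∂μ + 0) ^ θ * (∫ x, g x ∂μ + 0) ^ (1 - θ))) := by
    refine Tendsto.mono_left (Continuous.tendsto ?_ 0) nhdsWithin_le_nhds
    exact ((Real.continuous_rpow_const h0).comp (continuous_const.add continuous_id)).mul
      ((Real.continuous_rpow_const (sub_nonneg.2 h1)).comp (continuous_const.add continuous_id))
  rw [add_zero, add_zero] at hlim
  exact ge_of_tendsto hlim (by filter_upwards [self_mem_nhdsWithin] with ε hε using key ε hε)

end WeightedMeasure

/-! ### The weighted `L²` spaces over `U` and measurability -/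

variable {n : ℕ} {U : Set (EuclideanSpace ℝ (Fin n))} {N : ℕ} {α : Fin (N + 1) → ℝ}

/-- The standing assumptions on the domain and the exponents. -/
structure IsSetting (U : Set (EuclideanSpace ℝ (Fin n))) (α : Fin (N + 1) → ℝ) : Prop where
  isOpen : IsOpen U
  zero : α 0 = 0
  mono : StrictMono α
  one_le : 1 ≤ N

namespace IsSetting

theorem isForch (h : IsSetting U α) (m : Medium U α) {x : EuclideanSpace ℝ (Fin n)} (hx : x ∈ U) :
    IsForch α fun j => m.coef j x :=
  ⟨h.zero, h.mono, fun j => m.coef_nonneg j x hx, m.coef_zero_pos x hx⟩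

theorem ae_isForch (h : IsSetting U α) (m : Medium U α) :
    ∀ᵐ x ∂volume.restrict U, IsForch α fun j => m.coef j x :=
  (ae_restrict_mem h.isOpen.measurableSet).mono fun _ hx => h.isForch m hx

theorem expA_pos (h : IsSetting U α) : 0 < expA α :=
  IsForch.expA_pos (c := fun _ => 1) ⟨h.zero, h.mono, fun _ => zero_le_one, one_pos⟩ h.one_le

theorem expA_lt_one (h : IsSetting U α) : expA α < 1 :=
  IsForch.expA_lt_one (c := fun _ => 1) ⟨h.zero, h.mono, fun _ => zero_le_one, one_pos⟩

theorem ae_inv_coef_pos (h : IsSetting U α) (m : Medium U α) :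
    ∀ᵐ x ∂volume.restrict U, 0 < (m.coef 0 x)⁻¹ :=
  (h.ae_isForch m).mono fun _ hx => inv_pos.2 hx.pos

theorem ae_phi_pos (h : IsSetting U α) (m : Medium U α) :
    ∀ᵐ x ∂volume.restrict U, 0 < m.phi x :=
  (ae_restrict_mem h.isOpen.measurableSet).mono fun x hx => (m.phi_mem x hx).1

theorem ae_muA (h : IsSetting U α) (m : Medium U α) : ae m.muA = ae (volume.restrict U) :=
  ae_withDensity_ofReal (m.measurable_coef 0).inv (h.ae_inv_coef_pos m)

theorem ae_muPhi (h : IsSetting U α) (m : Medium U α) : ae m.muPhi = ae (volume.restrict U) :=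
  ae_withDensity_ofReal m.measurable_phi (h.ae_phi_pos m)

theorem inner_L2A (h : IsSetting U α) (m : Medium U α) (v w : m.L2A) :
    ⟪v, w⟫ = ∫ x in U, (m.coef 0 x)⁻¹ * ⟪v x, w x⟫ :=
  inner_withDensity_ofReal (m.measurable_coef 0).inv (h.ae_inv_coef_pos m) v w

theorem integrable_inner_L2A (h : IsSetting U α) (m : Medium U α) (v w : m.L2A) :
    IntegrableOn (fun x => (m.coef 0 x)⁻¹ * ⟪v x, w x⟫) U :=
  integrable_inner_withDensity_ofReal (m.measurable_coef 0).inv (h.ae_inv_coef_pos m) v w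

theorem normSq_L2A (h : IsSetting U α) (m : Medium U α) (v : m.L2A) :
    ‖v‖ ^ 2 = ∫ x in U, (m.coef 0 x)⁻¹ * ‖v x‖ ^ 2 := by
  rw [← real_inner_self_eq_norm_sq, h.inner_L2A]
  simp only [real_inner_self_eq_norm_sq]

theorem integrable_normSq_L2A (h : IsSetting U α) (m : Medium U α) (v : m.L2A) :
    IntegrableOn (fun x => (m.coef 0 x)⁻¹ * ‖v x‖ ^ 2) U := by
  simpa only [real_inner_self_eq_norm_sq] using h.integrable_inner_L2A m v v

theorem inner_L2Phi (h : IsSetting U α) (m : Medium U α) (u w : m.L2Phi) :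
    ⟪u, w⟫ = ∫ x in U, m.phi x * ⟪u x, w x⟫ :=
  inner_withDensity_ofReal m.measurable_phi (h.ae_phi_pos m) u w

theorem normSq_L2Phi (h : IsSetting U α) (m : Medium U α) (u : m.L2Phi) :
    ‖u‖ ^ 2 = ∫ x in U, m.phi x * ‖u x‖ ^ 2 := by
  rw [← real_inner_self_eq_norm_sq, h.inner_L2Phi]
  simp only [real_inner_self_eq_norm_sq]

theorem normSq_L2Phi' (h : IsSetting U α) (m : Medium U α) (u : m.L2Phi) :
    ‖u‖ ^ 2 = ∫ x in U, (u x) ^ 2 * m.phi x := by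
  rw [h.normSq_L2Phi]
  simp only [Real.norm_eq_abs, sq_abs, mul_comm]

theorem wNorm_phi (h : IsSetting U α) (m : Medium U α) (u : m.L2Phi) :
    wNorm U m.phi 2 u = ‖u‖ := by
  rw [wNorm, ← Real.sqrt_eq_rpow, Real.sqrt_eq_iff_mul_self_eq ?_ (norm_nonneg u), ← pow_two,
    h.normSq_L2Phi]
  · simp only [Real.rpow_two]
  · refine integral_nonneg_of_ae ?_
    filter_upwards [h.ae_phi_pos m] with x hx
    positivity

end IsSetting

namespace Medium

/-- The coefficients, extended by `1` outside `U`. -/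
noncomputable def coefExt (m : Medium U α) (x : EuclideanSpace ℝ (Fin n)) (j : Fin (N + 1)) : ℝ := by
  classical exact if x ∈ U then m.coef j x else 1

theorem coefExt_of_mem (m : Medium U α) {x : EuclideanSpace ℝ (Fin n)} (hx : x ∈ U) :
    m.coefExt x = fun j => m.coef j x := by
  ext j
  simp [coefExt, hx]

theorem measurable_coefExt (m : Medium U α) (hU : MeasurableSet U) (j : Fin (N + 1)) :
    Measurable fun x => m.coefExt x j := by
  classical
  exact Measurable.ite hU (m.measurable_coef j) measurable_const

/-- The measurability lemmas need admissible coefficients at every point, while the given ones are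
arbitrary off `U`. -/
theorem isForch_coefExt (m : Medium U α) (h : IsSetting U α) (x : EuclideanSpace ℝ (Fin n)) :
    IsForch α (m.coefExt x) := by
  by_cases hx : x ∈ U
  · rw [m.coefExt_of_mem hx]
    exact h.isForch m hx
  · have : m.coefExt x = fun _ => 1 := by ext j; simp [coefExt, hx]
    rw [this]
    exact ⟨h.zero, h.mono, fun _ => zero_le_one, one_pos⟩

end Medium

theorem aestronglyMeasurable_K (h : IsSetting U α) (m : Medium U α)
    {ξ : EuclideanSpace ℝ (Fin n) → ℝ} (hξ : Measurable ξ) (hξ0 : ∀ x, 0 ≤ ξ x) :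
    AEStronglyMeasurable (fun x => m.K x (ξ x)) (volume.restrict U) := by
  have hU := h.isOpen.measurableSet
  refine (IsForch.K_measurable (m.isForch_coefExt h) (m.measurable_coefExt hU) hξ
    hξ0).aestronglyMeasurable.congr ?_
  filter_upwards [ae_restrict_mem hU] with x hx
  rw [m.coefExt_of_mem hx, Medium.K]

theorem aestronglyMeasurable_H (h : IsSetting U α) (m : Medium U α)
    {ξ : EuclideanSpace ℝ (Fin n) → ℝ} (hξ : Measurable ξ) :
    AEStronglyMeasurable (fun x => m.H x (ξ x)) (volume.restrict U) := by
  have hU := h.isOpen.measurableSet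
  refine (IsForch.H_measurable (m.isForch_coefExt h) (m.measurable_coefExt hU)
    hξ).aestronglyMeasurable.congr ?_
  filter_upwards [ae_restrict_mem hU] with x hx
  rw [m.coefExt_of_mem hx, Medium.H]

theorem measurable_Lp {m : Medium U α} (v : m.L2A) : Measurable v :=
  (Lp.stronglyMeasurable v).measurable

/-! ### The flux operator on `L²_{1/a₀}` and its energy -/

/-- The vector field `a₀ K(x,|v|) v`, which represents `K(x,|v|) v` in `L²_{1/a₀}`. -/
noncomputable def fluxFun (m : Medium U α) (v : m.L2A) (x : EuclideanSpace ℝ (Fin n)) :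
    EuclideanSpace ℝ (Fin n) :=
  m.coef 0 x • flux α (fun j => m.coef j x) (v x)

/-- Since `a₀ K ≤ 1`, the field is pointwise no longer than `v`. -/
theorem memLp_fluxFun (h : IsSetting U α) (m : Medium U α) (v : m.L2A) :
    MemLp (fluxFun m v) 2 m.muA := by
  refine (Lp.memLp v).mono ?_ ?_
  · have hac : m.muA ≪ volume.restrict U := withDensity_absolutelyContinuous _ _
    refine AEStronglyMeasurable.mono_ac hac ?_
    exact ((m.measurable_coef 0).aestronglyMeasurable).smul
      ((aestronglyMeasurable_K h m (measurable_Lp v).norm fun _ => norm_nonneg _).smul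
        (measurable_Lp v).aestronglyMeasurable)
  · rw [h.ae_muA]
    filter_upwards [h.ae_isForch m] with x hx
    rw [fluxFun, norm_smul, hx.norm_flux, Real.norm_of_nonneg hx.pos.le,
      ← hx.K_mul (norm_nonneg _), ← mul_assoc]
    refine mul_le_of_le_one_left (norm_nonneg _) ?_
    have h1 := hx.K_le (norm_nonneg (v x))
    have h2 := mul_le_mul_of_nonneg_left h1 hx.pos.le
    rwa [mul_inv_cancel₀ hx.pos.ne'] at h2

open Classical in
/-- The flux `a₀ K(x,|v|) v` as an element of `L²_{1/a₀}`. -/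
noncomputable def fluxLp (m : Medium U α) (v : m.L2A) : m.L2A :=
  if h : MemLp (fluxFun m v) 2 m.muA then h.toLp else 0

theorem coeFn_fluxLp (h : IsSetting U α) (m : Medium U α) (v : m.L2A) :
    ∀ᵐ x ∂volume.restrict U,
      fluxLp m v x = m.coef 0 x • flux α (fun j => m.coef j x) (v x) := by
  have h1 := (memLp_fluxFun h m v).coeFn_toLp
  rw [EventuallyEq, h.ae_muA] at h1
  rw [fluxLp, dif_pos (memLp_fluxFun h m v)]
  exact h1

theorem inner_fluxLp_congr (h : IsSetting U α) (m : Medium U α) (v w : m.L2A) :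
    (fun x => (m.coef 0 x)⁻¹ * ⟪fluxLp m v x, w x⟫) =ᵐ[volume.restrict U]
      fun x => m.K x ‖v x‖ * ⟪v x, w x⟫ := by
  filter_upwards [h.ae_isForch m, coeFn_fluxLp h m v] with x hx hv
  rw [hv, real_inner_smul_left, ← mul_assoc, inv_mul_cancel₀ hx.pos.ne', one_mul, flux,
    real_inner_smul_left, Medium.K]

theorem inner_fluxLp (h : IsSetting U α) (m : Medium U α) (v w : m.L2A) :
    ⟪fluxLp m v, w⟫ = ∫ x in U, m.K x ‖v x‖ * ⟪v x, w x⟫ := by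
  rw [h.inner_L2A]
  exact integral_congr_ae (inner_fluxLp_congr h m v w)

theorem integrable_K_inner (h : IsSetting U α) (m : Medium U α) (v w : m.L2A) :
    IntegrableOn (fun x => m.K x ‖v x‖ * ⟪v x, w x⟫) U :=
  (h.integrable_inner_L2A m (fluxLp m v) w).congr (inner_fluxLp_congr h m v w)

/-- `∫_U K(x,|v|) |v|² dx`. -/
noncomputable def dissip (m : Medium U α) (v : m.L2A) : ℝ := ⟪fluxLp m v, v⟫

theorem dissip_eq (h : IsSetting U α) (m : Medium U α) (v : m.L2A) :
    dissip m v = ∫ x in U, m.K x ‖v x‖ * ‖v x‖ ^ 2 := by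
  rw [dissip, inner_fluxLp h]
  simp only [real_inner_self_eq_norm_sq]

theorem integrable_dissip (h : IsSetting U α) (m : Medium U α) (v : m.L2A) :
    IntegrableOn (fun x => m.K x ‖v x‖ * ‖v x‖ ^ 2) U := by
  simpa only [real_inner_self_eq_norm_sq] using integrable_K_inner h m v v

theorem coeFn_sub_L2A (h : IsSetting U α) {m : Medium U α} (v w : m.L2A) :
    ∀ᵐ x ∂volume.restrict U, (v - w) x = v x - w x := by
  have := Lp.coeFn_sub v w
  rwa [EventuallyEq, h.ae_muA] at this

theorem inner_fluxLp_sub_congr (h : IsSetting U α) (m : Medium U α) (v w z : m.L2A) :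
    (fun x => (m.coef 0 x)⁻¹ * ⟪(fluxLp m v - fluxLp m w) x, z x⟫) =ᵐ[volume.restrict U]
      fun x => ⟪flux α (fun j => m.coef j x) (v x) - flux α (fun j => m.coef j x) (w x),
        z x⟫ := by
  filter_upwards [h.ae_isForch m, coeFn_fluxLp h m v, coeFn_fluxLp h m w,
    coeFn_sub_L2A h (fluxLp m v) (fluxLp m w)] with x hx hv hw hs
  rw [hs, hv, hw, ← smul_sub, real_inner_smul_left, ← mul_assoc, inv_mul_cancel₀ hx.pos.ne',
    one_mul]

/-- The factor `a₀` in the field and the weight `1/a₀` turn the pointwise constant `a₀` into exactly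
one, so no norm of the coefficients appears in any estimate below. -/
theorem fluxLp_cocoercive (h : IsSetting U α) (m : Medium U α) (v w : m.L2A) :
    ‖fluxLp m v - fluxLp m w‖ ^ 2 ≤ ⟪fluxLp m v - fluxLp m w, v - w⟫ := by
  rw [h.normSq_L2A, h.inner_L2A]
  refine integral_mono_ae (h.integrable_normSq_L2A m _) (h.integrable_inner_L2A m _ _) ?_
  filter_upwards [h.ae_isForch m, coeFn_fluxLp h m v, coeFn_fluxLp h m w,
    coeFn_sub_L2A h (fluxLp m v) (fluxLp m w), coeFn_sub_L2A h v w] with x hx hv hw hs hs'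
  have hp := hx.pos
  have := hx.flux_cocoercive (v x) (w x)
  rw [hs, hv, hw, hs', ← smul_sub, real_inner_smul_left, norm_smul, mul_pow,
    Real.norm_of_nonneg hx.pos.le]
  have e1 : (m.coef 0 x)⁻¹ * (m.coef 0 x * ⟪flux α (fun j => m.coef j x) (v x) -
      flux α (fun j => m.coef j x) (w x), v x - w x⟫) = ⟪flux α (fun j => m.coef j x) (v x) -
      flux α (fun j => m.coef j x) (w x), v x - w x⟫ := by field_simp
  rw [e1]
  refine le_trans (le_of_eq ?_) this
  field_simp

theorem fluxLp_zero (h : IsSetting U α) (m : Medium U α) : fluxLp m 0 = 0 := by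
  have h1 : ∀ᵐ x ∂volume.restrict U, (0 : m.L2A) x = 0 := by
    have := Lp.coeFn_zero (EuclideanSpace ℝ (Fin n)) 2 m.muA
    rwa [EventuallyEq, h.ae_muA] at this
  refine Lp.ext ?_
  rw [EventuallyEq, h.ae_muA]
  filter_upwards [h1, coeFn_fluxLp h m 0] with x hx hf
  rw [hf, hx, flux, smul_zero, smul_zero]

theorem normSq_fluxLp_le (h : IsSetting U α) (m : Medium U α) (v : m.L2A) :
    ‖fluxLp m v‖ ^ 2 ≤ dissip m v := by
  have := fluxLp_cocoercive h m v 0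
  rwa [fluxLp_zero h, sub_zero, sub_zero] at this

theorem dissip_nonneg (h : IsSetting U α) (m : Medium U α) (v : m.L2A) : 0 ≤ dissip m v :=
  (sq_nonneg _).trans (normSq_fluxLp_le h m v)

/-- `∫_U H(x,|v|) dx`. -/
noncomputable def energy (m : Medium U α) (v : m.L2A) : ℝ := ∫ x in U, m.H x ‖v x‖

theorem integrable_energy (h : IsSetting U α) (m : Medium U α) (v : m.L2A) :
    IntegrableOn (fun x => m.H x ‖v x‖) U := by
  refine ((integrable_dissip h m v).const_mul 2).mono'
    (aestronglyMeasurable_H h m (measurable_Lp v).norm) ?_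
  filter_upwards [h.ae_isForch m] with x hx
  have h1 := hx.le_H (norm_nonneg (v x))
  have h2 := hx.K_pos (norm_nonneg (v x))
  rw [Real.norm_of_nonneg]
  · exact hx.H_le (norm_nonneg (v x))
  · exact le_trans (by positivity) h1

theorem dissip_le_energy (h : IsSetting U α) (m : Medium U α) (v : m.L2A) :
    dissip m v ≤ energy m v := by
  rw [dissip_eq h]
  refine integral_mono_ae (integrable_dissip h m v) (integrable_energy h m v) ?_
  filter_upwards [h.ae_isForch m] with x hx
  exact hx.le_H (norm_nonneg (v x))

theorem energy_le (h : IsSetting U α) (m : Medium U α) (v : m.L2A) :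
    energy m v ≤ 2 * dissip m v := by
  rw [dissip_eq h, ← integral_const_mul]
  refine integral_mono_ae (integrable_energy h m v) ((integrable_dissip h m v).const_mul 2) ?_
  filter_upwards [h.ae_isForch m] with x hx
  exact hx.H_le (norm_nonneg (v x))

theorem energy_nonneg (h : IsSetting U α) (m : Medium U α) (v : m.L2A) : 0 ≤ energy m v :=
  (dissip_nonneg h m v).trans (dissip_le_energy h m v)

theorem energy_convex (h : IsSetting U α) (m : Medium U α) (v w : m.L2A) :
    2 * ⟪fluxLp m v, w - v⟫ ≤ energy m w - energy m v := by
  rw [inner_fluxLp h, ← integral_const_mul, energy, energy,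
    ← integral_sub (integrable_energy h m w) (integrable_energy h m v)]
  refine integral_mono_ae ((integrable_K_inner h m v _).const_mul 2)
    ((integrable_energy h m w).sub (integrable_energy h m v)) ?_
  filter_upwards [h.ae_isForch m, coeFn_sub_L2A h w v] with x hx hs
  have := hx.H_norm_convex (v x) (w x)
  rw [flux, real_inner_smul_left] at this
  rwa [hs]

/-- Convexity at `v` and at `v + w` puts the remainder between `0` and twice the pairing of the flux
increment with `w`. That is at most `2‖w‖²`, since the flux is nonexpansive; no limit under the
integral is needed. -/
theorem hasFDerivAt_energy (h : IsSetting U α) (m : Medium U α) (v : m.L2A) :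
    HasFDerivAt (energy m) ((2 : ℝ) • innerSL ℝ (fluxLp m v)) v := by
  rw [hasFDerivAt_iff_isLittleO_nhds_zero]
  have hbig : (fun w : m.L2A => energy m (v + w) - energy m v -
      ((2 : ℝ) • innerSL ℝ (fluxLp m v)) w) =O[𝓝 0] fun w => ‖w‖ ^ 2 := by
    refine Asymptotics.IsBigO.of_bound 2 (Eventually.of_forall fun w => ?_)
    have h1 := energy_convex h m v (v + w)
    have h2 := energy_convex h m (v + w) v
    have h3 := fluxLp_cocoercive h m (v + w) v
    have h4 := real_inner_le_norm (fluxLp m (v + w) - fluxLp m v) w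
    rw [add_sub_cancel_left] at h1 h3
    rw [sub_add_cancel_left, inner_neg_right] at h2
    rw [inner_sub_left] at h3 h4
    have h5 : ‖fluxLp m (v + w) - fluxLp m v‖ ≤ ‖w‖ := by
      by_contra! h6
      have := norm_nonneg w
      nlinarith
    have h6 := norm_nonneg w
    have h7 : ((2 : ℝ) • innerSL ℝ (fluxLp m v)) w = 2 * ⟪fluxLp m v, w⟫ := rfl
    rw [h7, Real.norm_eq_abs, Real.norm_of_nonneg (sq_nonneg _), abs_le]
    constructor <;> nlinarith
  refine hbig.trans_isLittleO ?_
  have := (Asymptotics.isLittleO_norm_pow_id (E' := m.L2A) (n := 2) (by norm_num))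
  exact this

theorem hasDerivAt_energy (h : IsSetting U α) (m : Medium U α) {v : ℝ → m.L2A} {v' : m.L2A}
    {t : ℝ} (hv : HasDerivAt v v' t) :
    HasDerivAt (fun s => energy m (v s)) (2 * ⟪fluxLp m (v t), v'⟫) t := by
  exact (hasFDerivAt_energy h m (v t)).comp_hasDerivAt t hv

theorem continuous_energy (h : IsSetting U α) (m : Medium U α) : Continuous (energy m) :=
  continuous_iff_continuousAt.2 fun v => (hasFDerivAt_energy h m v).continuousAt

/-! ### The weight `W₁` and the degenerate gradient norm -/

theorem Medium.coef_le_coefMax (m : Medium U α) (x : EuclideanSpace ℝ (Fin n)) (j : Fin (N + 1)) :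
    m.coef j x ≤ m.coefMax x :=
  Finset.le_sup' (fun j => m.coef j x) (Finset.mem_univ j)

theorem Medium.measurable_coefMax (m : Medium U α) : Measurable m.coefMax := by
  have := Finset.measurable_sup' (s := Finset.univ) Finset.univ_nonempty
    (f := fun j x => m.coef j x) fun j _ => m.measurable_coef j
  convert this using 1
  ext x
  simp [Medium.coefMax, Finset.sup'_apply]

theorem Medium.measurable_W1 (m : Medium U α) : Measurable m.W1 :=
  ((m.measurable_coef _).pow_const _).div (measurable_const.mul m.measurable_coefMax)

theorem Medium.W1_nonneg (m : Medium U α) {x : EuclideanSpace ℝ (Fin n)} (hx : x ∈ U) :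
    0 ≤ m.W1 x := by
  have h1 := m.coef_last_pos x hx
  have h2 := h1.trans_le (m.coef_le_coefMax x _)
  unfold Medium.W1
  positivity

theorem one_le_Bstar (m : Medium U α) : 1 ≤ Bstar m := le_max_right _ _

namespace IsSetting

theorem ae_mem (h : IsSetting U α) : ∀ᵐ x ∂volume.restrict U, x ∈ U :=
  ae_restrict_mem h.isOpen.measurableSet

theorem ae_W1_nonneg (h : IsSetting U α) (m : Medium U α) :
    ∀ᵐ x ∂volume.restrict U, 0 ≤ m.W1 x :=
  h.ae_mem.mono fun _ hx => m.W1_nonneg hx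

end IsSetting

/-- `∫_U W₁ |v|^{2-a} dx`. -/
noncomputable def W1Int (m : Medium U α) (v : m.L2A) : ℝ :=
  ∫ x in U, m.W1 x * ‖v x‖ ^ (2 - expA α)

theorem integrable_W1Int (h : IsSetting U α) (m : Medium U α) (v : m.L2A) :
    IntegrableOn (fun x => m.W1 x * ‖v x‖ ^ (2 - expA α)) U := by
  refine ((integrable_dissip h m v).add (m.integrable_coef_last.div_const 2)).mono'
    (m.measurable_W1.mul ((measurable_Lp v).norm.pow_const _)).aestronglyMeasurable ?_
  filter_upwards [h.ae_mem] with x hx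
  rw [Real.norm_of_nonneg (mul_nonneg (m.W1_nonneg hx) (by positivity))]
  exact (h.isForch m hx).weight_mul_rpow_le h.one_le (m.coef_le_coefMax x) (m.coef_last_pos x hx)
    (norm_nonneg _)

theorem W1Int_nonneg (h : IsSetting U α) (m : Medium U α) (v : m.L2A) : 0 ≤ W1Int m v := by
  refine integral_nonneg_of_ae ?_
  filter_upwards [h.ae_W1_nonneg m] with x hx
  exact mul_nonneg hx (by positivity)

theorem W1Int_le (h : IsSetting U α) (m : Medium U α) (v : m.L2A) :
    W1Int m v ≤ dissip m v + Bstar m := by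
  have h1 : W1Int m v ≤ dissip m v + (∫ x in U, m.coef (Fin.last N) x) / 2 := by
    rw [dissip_eq h, ← integral_div, ← integral_add (integrable_dissip h m v)
      (m.integrable_coef_last.div_const 2)]
    refine integral_mono_ae (integrable_W1Int h m v)
      ((integrable_dissip h m v).add (m.integrable_coef_last.div_const 2)) ?_
    filter_upwards [h.ae_mem] with x hx
    exact (h.isForch m hx).weight_mul_rpow_le h.one_le (m.coef_le_coefMax x)
      (m.coef_last_pos x hx) (norm_nonneg _)
  have h2 : ∫ x in U, m.coef (Fin.last N) x ≤ Bstar m := le_max_left _ _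
  have h3 := one_le_Bstar m
  linarith

theorem add_rpow_le_four_mul {x y q : ℝ} (hx : 0 ≤ x) (hy : 0 ≤ y) (hq : 0 ≤ q) (hq2 : q ≤ 2) :
    (x + y) ^ q ≤ 4 * (x ^ q + y ^ q) := by
  have h4 : (2 : ℝ) ^ q ≤ 4 := by
    refine (Real.rpow_le_rpow_of_exponent_le one_le_two hq2).trans ?_
    norm_num
  have h1 : x + y ≤ 2 * max x y := by
    have := le_max_left x y
    have := le_max_right x y
    linarith
  have h2 : max x y ^ q ≤ x ^ q + y ^ q := by
    have := Real.rpow_nonneg hx q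
    have := Real.rpow_nonneg hy q
    rcases max_choice x y with h | h <;> rw [h] <;> linarith
  calc (x + y) ^ q ≤ (2 * max x y) ^ q := by gcongr
    _ = 2 ^ q * max x y ^ q := Real.mul_rpow zero_le_two (hx.trans (le_max_left _ _))
    _ ≤ _ := by gcongr

theorem W1Int_sub_le (h : IsSetting U α) (m : Medium U α) (v w : m.L2A) :
    W1Int m (v - w) ≤ 4 * (W1Int m v + W1Int m w) := by
  have ha := h.expA_pos
  have ha1 := h.expA_lt_one
  unfold W1Int
  rw [← integral_add (integrable_W1Int h m v) (integrable_W1Int h m w), ← integral_const_mul]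
  refine integral_mono_ae (integrable_W1Int h m _)
    (((integrable_W1Int h m v).add (integrable_W1Int h m w)).const_mul 4) ?_
  filter_upwards [h.ae_W1_nonneg m, coeFn_sub_L2A h v w] with x hx hs
  rw [hs]
  have h1 : ‖v x - w x‖ ^ (2 - expA α) ≤ (‖v x‖ + ‖w x‖) ^ (2 - expA α) :=
    Real.rpow_le_rpow (norm_nonneg _) (norm_sub_le _ _) (by linarith)
  have h2 := add_rpow_le_four_mul (norm_nonneg (v x)) (norm_nonneg (w x))
    (q := 2 - expA α) (by linarith) (by linarith)
  have h3 := mul_le_mul_of_nonneg_left (h1.trans h2) hx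
  linarith

theorem wNorm_nonneg (h : IsSetting U α) (m : Medium U α) (v : m.L2A) :
    0 ≤ wNorm U m.W1 (2 - expA α) v :=
  Real.rpow_nonneg (W1Int_nonneg h m v) _

theorem wNorm_rpow (h : IsSetting U α) (m : Medium U α) (v : m.L2A) :
    wNorm U m.W1 (2 - expA α) v ^ (2 - expA α) = W1Int m v := by
  have ha1 := h.expA_lt_one
  change (W1Int m v ^ (1 / (2 - expA α))) ^ (2 - expA α) = _
  rw [← Real.rpow_mul (W1Int_nonneg h m v), one_div,
    inv_mul_cancel₀ (by linarith), Real.rpow_one]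

theorem wNorm_sq (h : IsSetting U α) (m : Medium U α) (v : m.L2A) :
    wNorm U m.W1 (2 - expA α) v ^ 2 = W1Int m v ^ (2 / (2 - expA α)) := by
  change (W1Int m v ^ (1 / (2 - expA α))) ^ 2 = _
  rw [← Real.rpow_natCast, ← Real.rpow_mul (W1Int_nonneg h m v)]
  congr 1
  push_cast
  ring

/-- The degenerate gradient norm of `v₁ - v₂ - w` is controlled by the monotonicity of the flux. -/
theorem wNorm_sq_le (h : IsSetting U α) (m : Medium U α) (v₁ v₂ w : m.L2A) :
    wNorm U m.W1 (2 - expA α) (v₁ - v₂ - w : m.L2A) ^ 2 ≤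
      (2 * (2 + 2 * max 1 (α (Fin.last N)))) *
        (⟪fluxLp m v₁ - fluxLp m v₂, v₁ - v₂⟫ + ‖w‖ ^ 2) *
        (dissip m v₁ + dissip m v₂ + Bstar m) ^ (expA α / (2 - expA α)) := by
  have ha := h.expA_pos
  have ha1 := h.expA_lt_one
  set u : m.L2A := v₁ - v₂ - w with hu
  -- At the larger of the two norms, `K` is the coefficient of strong monotonicity, and `K ξ²` is
  -- still dominated by the sum of the two dissipation densities.
  set ξ : EuclideanSpace ℝ (Fin n) → ℝ := fun x => max ‖v₁ x‖ ‖v₂ x‖ with hξ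
  have hξ0 : ∀ x, 0 ≤ ξ x := fun x => (norm_nonneg _).trans (le_max_left _ _)
  have hξm : Measurable ξ := (measurable_Lp v₁).norm.max (measurable_Lp v₂).norm
  have hKm := aestronglyMeasurable_K h m hξm hξ0
  have hf : IntegrableOn (fun x => m.K x (ξ x) * ‖u x‖ ^ 2) U := by
    refine (h.integrable_normSq_L2A m u).mono'
      (hKm.mul ((measurable_Lp u).norm.pow_const 2).aestronglyMeasurable) ?_
    filter_upwards [h.ae_isForch m] with x hx
    have h1 : 0 < m.K x (ξ x) := hx.K_pos (hξ0 x)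
    have h2 := hx.K_le (hξ0 x)
    rw [Real.norm_of_nonneg (mul_nonneg h1.le (sq_nonneg _))]
    exact mul_le_mul_of_nonneg_right h2 (sq_nonneg _)
  have hgle : ∀ᵐ x ∂volume.restrict U, m.K x (ξ x) * ξ x ^ 2 + m.coef (Fin.last N) x / 2 ≤
      m.K x ‖v₁ x‖ * ‖v₁ x‖ ^ 2 + m.K x ‖v₂ x‖ * ‖v₂ x‖ ^ 2 + m.coef (Fin.last N) x / 2 := by
    filter_upwards [h.ae_isForch m] with x hx
    have h1 : 0 ≤ m.K x ‖v₁ x‖ * ‖v₁ x‖ ^ 2 :=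
      mul_nonneg (hx.K_pos (norm_nonneg _)).le (sq_nonneg _)
    have h2 : 0 ≤ m.K x ‖v₂ x‖ * ‖v₂ x‖ ^ 2 :=
      mul_nonneg (hx.K_pos (norm_nonneg _)).le (sq_nonneg _)
    rcases max_choice ‖v₁ x‖ ‖v₂ x‖ with hm | hm <;> simp only [hξ, hm] <;> linarith
  have hg0 : ∀ᵐ x ∂volume.restrict U,
      0 ≤ m.K x (ξ x) * ξ x ^ 2 + m.coef (Fin.last N) x / 2 := by
    filter_upwards [h.ae_isForch m] with x hx
    have h1 := mul_nonneg (hx.K_pos (hξ0 x)).le (sq_nonneg (ξ x))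
    have h2 := hx.nonneg (Fin.last N)
    unfold Medium.K
    linarith
  have hI := ((integrable_dissip h m v₁).add (integrable_dissip h m v₂)).add
    (m.integrable_coef_last.div_const 2)
  have hg : IntegrableOn (fun x => m.K x (ξ x) * ξ x ^ 2 + m.coef (Fin.last N) x / 2) U := by
    refine hI.mono' ((hKm.mul (hξm.pow_const 2).aestronglyMeasurable).add
      ((m.measurable_coef _).div_const 2).aestronglyMeasurable) ?_
    filter_upwards [hgle, hg0] with x h1 h2
    rw [Real.norm_of_nonneg h2]
    exact h1
  have hf0 : ∀ᵐ x ∂volume.restrict U, 0 ≤ m.K x (ξ x) * ‖u x‖ ^ 2 := by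
    filter_upwards [h.ae_isForch m] with x hx
    exact mul_nonneg (hx.K_pos (hξ0 x)).le (sq_nonneg _)
  -- With this `θ`, raising to the power `2/(2-a)` at the end leaves the first integral to the power
  -- one and the second to the power `a/(2-a)`.
  have hHolder := integral_le_rpow_mul_rpow (θ := (2 - expA α) / 2) (by linarith) (by linarith)
    hf hg (integrable_W1Int h m u) hf0 hg0 (by
      filter_upwards [h.ae_mem] with x hx
      have := (h.isForch m hx).weight_mul_rpow_le_mul h.one_le (m.coef_le_coefMax x)
        (m.coef_last_pos x hx) (hξ0 x) (norm_nonneg (u x))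
      rw [show 1 - (2 - expA α) / 2 = expA α / 2 by ring]
      exact this)
  have hF0 := integral_nonneg_of_ae hf0
  have hG0 := integral_nonneg_of_ae hg0
  have hG : ∫ x in U, (m.K x (ξ x) * ξ x ^ 2 + m.coef (Fin.last N) x / 2) ≤
      dissip m v₁ + dissip m v₂ + Bstar m := by
    refine (integral_mono_ae hg hI hgle).trans ?_
    rw [integral_add' ((integrable_dissip h m v₁).add (integrable_dissip h m v₂))
      (m.integrable_coef_last.div_const 2),
      integral_add' (integrable_dissip h m v₁) (integrable_dissip h m v₂), integral_div,
      dissip_eq h, dissip_eq h]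
    have h2 : ∫ x in U, m.coef (Fin.last N) x ≤ Bstar m := le_max_left _ _
    have h3 := one_le_Bstar m
    linarith
  -- The part in `v₁ - v₂` is handled by strong monotonicity, the part in `w` by `K ≤ 1/a₀`.
  have hF : ∫ x in U, m.K x (ξ x) * ‖u x‖ ^ 2 ≤ (2 * (2 + 2 * max 1 (α (Fin.last N)))) *
        (⟪fluxLp m v₁ - fluxLp m v₂, v₁ - v₂⟫ + ‖w‖ ^ 2) := by
    rw [h.normSq_L2A, h.inner_L2A, ← integral_add (h.integrable_inner_L2A m _ _)
      (h.integrable_normSq_L2A m _), ← integral_const_mul]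
    refine integral_mono_ae hf (((h.integrable_inner_L2A m _ _).add
      (h.integrable_normSq_L2A m _)).const_mul _) ?_
    filter_upwards [h.ae_isForch m, inner_fluxLp_sub_congr h m v₁ v₂ (v₁ - v₂),
      coeFn_sub_L2A h v₁ v₂, coeFn_sub_L2A h (v₁ - v₂) w] with x hx hi hs hs'
    rw [hi, hu, hs', hs]
    have h1 := hx.K_mul_norm_sub_sq_le (v₁ x) (v₂ x)
    have h2 := hx.K_le (hξ0 x)
    have h3 := hx.K_pos (hξ0 x)
    have h4 : 1 ≤ max 1 (α (Fin.last N)) := le_max_left _ _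
    have h5 : ‖v₁ x - v₂ x - w x‖ ^ 2 ≤ 2 * (‖v₁ x - v₂ x‖ ^ 2 + ‖w x‖ ^ 2) := by
      have := norm_sub_le (v₁ x - v₂ x) (w x)
      have h6 := norm_nonneg (v₁ x - v₂ x - w x)
      nlinarith [sq_nonneg (‖v₁ x - v₂ x‖ - ‖w x‖)]
    have h6 : m.K x (ξ x) * ‖w x‖ ^ 2 ≤
        (2 + 2 * max 1 (α (Fin.last N))) * ((m.coef 0 x)⁻¹ * ‖w x‖ ^ 2) := by
      have h7 : m.K x (ξ x) * ‖w x‖ ^ 2 ≤ (m.coef 0 x)⁻¹ * ‖w x‖ ^ 2 := by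
        gcongr
        exact h2
      have h8 : 0 ≤ (m.coef 0 x)⁻¹ * ‖w x‖ ^ 2 := by
        have := hx.pos
        positivity
      nlinarith
    have h9 := mul_le_mul_of_nonneg_left h5 h3.le
    unfold Medium.K at *
    simp only [hξ] at *
    nlinarith
  rw [wNorm_sq h]
  have hq : (2 - expA α) / 2 * (2 / (2 - expA α)) = 1 := by
    have : 2 - expA α ≠ 0 := by linarith
    field_simp
  have hq' : (1 - (2 - expA α) / 2) * (2 / (2 - expA α)) = expA α / (2 - expA α) := by
    have : 2 - expA α ≠ 0 := by linarith
    field_simp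
    ring
  calc W1Int m u ^ (2 / (2 - expA α))
      ≤ ((∫ x in U, m.K x (ξ x) * ‖u x‖ ^ 2) ^ ((2 - expA α) / 2) *
        (∫ x in U, (m.K x (ξ x) * ξ x ^ 2 + m.coef (Fin.last N) x / 2)) ^
          (1 - (2 - expA α) / 2)) ^ (2 / (2 - expA α)) :=
        Real.rpow_le_rpow (W1Int_nonneg h m u) hHolder (div_nonneg zero_le_two (by linarith))
    _ = (∫ x in U, m.K x (ξ x) * ‖u x‖ ^ 2) *
        (∫ x in U, (m.K x (ξ x) * ξ x ^ 2 + m.coef (Fin.last N) x / 2)) ^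
          (expA α / (2 - expA α)) := by
        rw [Real.mul_rpow (Real.rpow_nonneg hF0 _) (Real.rpow_nonneg hG0 _),
          ← Real.rpow_mul hF0, ← Real.rpow_mul hG0, hq, hq', Real.rpow_one]
    _ ≤ _ := by
        refine mul_le_mul hF (Real.rpow_le_rpow hG0 hG (div_nonneg ha.le (by linarith)))
          (Real.rpow_nonneg hG0 _) (hF0.trans hF)

/-! ### Test functions, zero boundary values and the weak equation -/

section Weak

theorem gradient_add {E : Type*} [NormedAddCommGroup E] [InnerProductSpace ℝ E] [CompleteSpace E]
    {f g : E → ℝ} (hf : Differentiable ℝ f) (hg : Differentiable ℝ g) :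
    gradient (f + g) = gradient f + gradient g := by
  ext1 x
  simp [gradient, fderiv_add (hf x) (hg x)]

theorem gradient_const_smul {E : Type*} [NormedAddCommGroup E] [InnerProductSpace ℝ E]
    [CompleteSpace E] {f : E → ℝ} (hf : Differentiable ℝ f) (c : ℝ) :
    gradient (c • f) = c • gradient f := by
  ext1 x
  simp [gradient, fderiv_const_smul (hf x)]

theorem IsTestFunction.differentiable {η : EuclideanSpace ℝ (Fin n) → ℝ}
    (hη : IsTestFunction U η) : Differentiable ℝ η :=
  hη.1.differentiable (by simp)

theorem IsAdmissibleTest.zero (m : Medium U α) : IsAdmissibleTest m 0 := by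
  refine ⟨⟨contDiff_const, HasCompactSupport.zero, by simp⟩, ?_⟩
  have : gradient (0 : EuclideanSpace ℝ (Fin n) → ℝ) = 0 := by
    ext1 x
    simp [gradient]
  rw [this]
  exact MemLp.zero'

theorem IsAdmissibleTest.add {m : Medium U α} {η ζ : EuclideanSpace ℝ (Fin n) → ℝ}
    (hη : IsAdmissibleTest m η) (hζ : IsAdmissibleTest m ζ) : IsAdmissibleTest m (η + ζ) := by
  refine ⟨⟨hη.1.1.add hζ.1.1, hη.1.2.1.add hζ.1.2.1,
    (tsupport_add η ζ).trans (union_subset hη.1.2.2 hζ.1.2.2)⟩, ?_⟩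
  rw [gradient_add hη.1.differentiable hζ.1.differentiable]
  exact hη.2.add hζ.2

theorem IsAdmissibleTest.smul {m : Medium U α} {η : EuclideanSpace ℝ (Fin n) → ℝ}
    (hη : IsAdmissibleTest m η) (c : ℝ) : IsAdmissibleTest m (c • η) := by
  refine ⟨⟨contDiff_const.smul hη.1.1, hη.1.2.1.smul_left (f := fun _ => c),
    (tsupport_smul_subset_right (fun _ => c) η).trans hη.1.2.2⟩, ?_⟩
  rw [gradient_const_smul hη.1.differentiable]
  exact hη.2.const_smul c

/-- The pairs `(η, ∇η)` with `η` an admissible test function. -/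
noncomputable def testPairs (h : IsSetting U α) (m : Medium U α) : Submodule ℝ (m.L2Phi × m.L2A) where
  carrier := {w | ∃ η, IsAdmissibleTest m η ∧
    w.1 =ᵐ[volume.restrict U] η ∧ w.2 =ᵐ[volume.restrict U] gradient η}
  zero_mem' := by
    refine ⟨0, IsAdmissibleTest.zero m, ?_, ?_⟩
    · rw [EventuallyEq, ← h.ae_muPhi m]
      exact Lp.coeFn_zero _ _ _
    · have : gradient (0 : EuclideanSpace ℝ (Fin n) → ℝ) = 0 := by
        ext1 x
        simp [gradient]
      rw [this, EventuallyEq, ← h.ae_muA m]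
      exact Lp.coeFn_zero _ _ _
  add_mem' := by
    rintro w z ⟨η, hη, hw1, hw2⟩ ⟨ζ, hζ, hz1, hz2⟩
    refine ⟨η + ζ, hη.add hζ, ?_, ?_⟩
    · have h1 := Lp.coeFn_add w.1 z.1
      rw [EventuallyEq, h.ae_muPhi m] at h1
      exact EventuallyEq.trans h1 (hw1.add hz1)
    · have h1 := Lp.coeFn_add w.2 z.2
      rw [EventuallyEq, h.ae_muA m] at h1
      rw [gradient_add hη.1.differentiable hζ.1.differentiable]
      exact EventuallyEq.trans h1 (hw2.add hz2)
  smul_mem' := by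
    rintro c w ⟨η, hη, hw1, hw2⟩
    refine ⟨c • η, hη.smul c, ?_, ?_⟩
    · have h1 := Lp.coeFn_smul c w.1
      rw [EventuallyEq, h.ae_muPhi m] at h1
      exact EventuallyEq.trans h1 (hw1.const_smul c)
    · have h1 := Lp.coeFn_smul c w.2
      rw [EventuallyEq, h.ae_muA m] at h1
      rw [gradient_const_smul hη.1.differentiable]
      exact EventuallyEq.trans h1 (hw2.const_smul c)

/-- The pairs `(u, ∇u)` with `u` vanishing on the boundary. -/
noncomputable def zeroTrace (h : IsSetting U α) (m : Medium U α) : Submodule ℝ (m.L2Phi × m.L2A) :=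
  (testPairs h m).topologicalClosure

theorem isClosed_zeroTrace (h : IsSetting U α) (m : Medium U α) :
    IsClosed (zeroTrace h m : Set (m.L2Phi × m.L2A)) :=
  (testPairs h m).isClosed_topologicalClosure

/-- Both sides are continuous in the pair `w`, so the weak form extends from test functions to their
closure. This allows testing with `p̄`, `p̄ₜ` and `P̄`. -/
theorem SolvesEquation.inner_eq (h : IsSetting U α) {m : Medium U α} {p : RegularPath m}
    (hp : SolvesEquation m p) {t : ℝ} (ht : 0 < t) {w : m.L2Phi × m.L2A}
    (hw : w ∈ zeroTrace h m) : ⟪p.dval t, w.1⟫ = -⟪fluxLp m (p.grad t), w.2⟫ := by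
  have hcl : IsClosed {w : m.L2Phi × m.L2A |
      ⟪p.dval t, w.1⟫ = -⟪fluxLp m (p.grad t), w.2⟫} :=
    isClosed_eq (continuous_const.inner continuous_fst)
      (continuous_const.inner continuous_snd).neg
  refine closure_minimal ?_ hcl hw
  rintro z ⟨η, hη, h1, h2⟩
  have h3 := hp t ht η hη
  rw [mem_ofPred_eq]
  rw [h.inner_L2Phi, inner_fluxLp h]
  convert h3 using 1
  · refine integral_congr_ae ?_
    filter_upwards [h1] with x hx
    rw [hx, mul_assoc, real_inner_comm]
    rfl
  · congr 1
    refine integral_congr_ae ?_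
    filter_upwards [h2] with x hx
    rw [hx]

/-- Difference quotients stay in the closed subspace. Applied to `zeroTrace`, it makes `p̄ₜ` an
allowed test function. -/
theorem HasDerivAt.mem_of_isClosed {E : Type*} [NormedAddCommGroup E] [NormedSpace ℝ E]
    {V : Submodule ℝ E} (hV : IsClosed (V : Set E)) {f : ℝ → E} {f' : E} {t : ℝ} (ht : 0 < t)
    (hf : HasDerivAt f f' t) (hmem : ∀ s, 0 < s → f s ∈ V) : f' ∈ V := by
  have h1 := hasDerivAt_iff_tendsto_slope.1 hf
  refine hV.mem_of_tendsto h1 ?_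
  have h2 : ∀ᶠ s in 𝓝[≠] t, 0 < s := nhdsWithin_le_nhds (lt_mem_nhds ht)
  filter_upwards [h2] with s hs
  exact V.smul_mem _ (V.sub_mem (hmem s hs) (hmem t ht))

end Weak

/-! ### Data quantities and differential inequalities for one solution -/

section Data

theorem G_eq (h : IsSetting U α) (m : Medium U α) (Ψ : RegularPath m) (t : ℝ) :
    G m Ψ t = Bstar m + ‖Ψ.grad t‖ ^ 2 + W1Int m (Ψ.grad t)
      + (‖Ψ.dval t‖ ^ 2) ^ ((2 - expA α) / (2 * (1 - expA α))) := by
  rw [h.normSq_L2A, h.normSq_L2Phi']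
  rfl

theorem G1_eq (h : IsSetting U α) (m : Medium U α) (Ψ : RegularPath m) (t : ℝ) :
    G1 m Ψ t = ‖Ψ.dgrad t‖ ^ 2 := (h.normSq_L2A m _).symm

theorem G2_eq (h : IsSetting U α) (m : Medium U α) (Ψ : RegularPath m) (t : ℝ) :
    G2 m Ψ t = ‖Ψ.ddval t‖ ^ 2 := (h.normSq_L2Phi' m _).symm

theorem D_eq (h : IsSetting U α) (m : Medium U α) (Ψ₁ Ψ₂ : RegularPath m) (t : ℝ) :
    D m Ψ₁ Ψ₂ t = ‖Ψ₁.grad t - Ψ₂.grad t‖ ^ 2 + ‖Ψ₁.grad t - Ψ₂.grad t‖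
      + ‖Ψ₁.dval t - Ψ₂.dval t‖ := by
  unfold D
  rw [← h.normSq_L2A, ← h.normSq_L2Phi', ← Real.sqrt_eq_rpow, ← Real.sqrt_eq_rpow,
    Real.sqrt_sq (norm_nonneg _), Real.sqrt_sq (norm_nonneg _)]

/-- The bound on `‖Ψₜ‖²` uses `x ≤ 1 + x^p` for `p ≥ 1`, the `1` being absorbed by `B_*`. -/
theorem G_bounds (h : IsSetting U α) (m : Medium U α) (Ψ : RegularPath m) (t : ℝ) :
    1 ≤ G m Ψ t ∧ Bstar m + W1Int m (Ψ.grad t) ≤ G m Ψ t ∧ ‖Ψ.grad t‖ ^ 2 ≤ G m Ψ t ∧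
      ‖Ψ.dval t‖ ^ ((2 - expA α) / (1 - expA α)) ≤ G m Ψ t ∧ ‖Ψ.dval t‖ ^ 2 ≤ G m Ψ t := by
  have ha := h.expA_pos
  have ha1 := h.expA_lt_one
  have h1 := one_le_Bstar m
  have h2 := W1Int_nonneg h m (Ψ.grad t)
  have h3 := sq_nonneg ‖Ψ.grad t‖
  have h4 : 0 ≤ (‖Ψ.dval t‖ ^ 2) ^ ((2 - expA α) / (2 * (1 - expA α))) := by positivity
  have h5 : ‖Ψ.dval t‖ ^ ((2 - expA α) / (1 - expA α)) =
      (‖Ψ.dval t‖ ^ 2) ^ ((2 - expA α) / (2 * (1 - expA α))) := by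
    rw [← Real.rpow_natCast, ← Real.rpow_mul (norm_nonneg _)]
    congr 1
    push_cast
    have : 1 - expA α ≠ 0 := by linarith
    field_simp
  have h6 : ‖Ψ.dval t‖ ^ 2 ≤
      1 + (‖Ψ.dval t‖ ^ 2) ^ ((2 - expA α) / (2 * (1 - expA α))) := by
    rcases le_total (‖Ψ.dval t‖ ^ 2) 1 with h7 | h7
    · linarith
    · have h8 : (‖Ψ.dval t‖ ^ 2) ^ (1 : ℝ) ≤
          (‖Ψ.dval t‖ ^ 2) ^ ((2 - expA α) / (2 * (1 - expA α))) := by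
        refine Real.rpow_le_rpow_of_exponent_le h7 ?_
        rw [le_div_iff₀ (by linarith)]
        linarith
      rw [Real.rpow_one] at h8
      linarith
  rw [G_eq h, h5]
  refine ⟨?_, ?_, ?_, ?_, ?_⟩ <;> linarith

end Data

/-- `p` solves the problem with boundary data `Ψ`, and the Poincaré inequality holds along it. -/
structure IsGoodSolution (m : Medium U α) (cP : ℝ) (p Ψ : RegularPath m) : Prop where
  sol : IsSolution m p Ψ
  poincare : ∀ t, 0 < t → PoincareSobolev m cP (p.val t - Ψ.val t) (p.grad t - Ψ.grad t)

/-- The Poincaré inequality bounds `‖p̄‖^{2-a}` by `W₁`-integrals of `∇p` and `∇Ψ`, hence by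
dissipation and `G`. Young's inequality then uses the exponent conjugate to `2 - a`, namely
`(2-a)/(1-a)`, which is why that power of `‖Ψₜ‖` sits in `G`. -/
theorem exists_young_const (U : Set (EuclideanSpace ℝ (Fin n))) {α : Fin (N + 1) → ℝ}
    (h : IsSetting U α) {cP : ℝ} (hcP : 0 < cP) :
    ∃ C : ℝ, 1 ≤ C ∧ ∀ (m : Medium U α) (p Ψ : RegularPath m), IsGoodSolution m cP p Ψ →
      ∀ t, 0 < t →
        ‖p.val t - Ψ.val t‖ ^ (2 - expA α) ≤ C * (dissip m (p.grad t) + G m Ψ t) ∧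
        2 * ‖Ψ.dval t‖ * ‖p.val t - Ψ.val t‖ ≤ dissip m (p.grad t) / 2 + C * G m Ψ t := by
  have ha := h.expA_pos
  have ha1 := h.expA_lt_one
  set q := 2 - expA α with hq
  have hq1 : 1 < q := by linarith
  have hconj : q.HolderConjugate (q / (1 - expA α)) := by
    rw [Real.holderConjugate_iff]
    refine ⟨hq1, ?_⟩
    have : 1 - expA α ≠ 0 := by linarith
    have : q ≠ 0 := by linarith
    field_simp
    linarith
  set k : ℝ := 4 * cP ^ q with hk
  have hk0 : 0 < k := by positivity
  -- Chosen so that `l^q k = 1/2`: Young's inequality then costs at most half of the dissipation.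
  set l : ℝ := (1 / (2 * k)) ^ (1 / q) with hl
  have hl0 : 0 < l := by positivity
  have hlq : l ^ q = 1 / (2 * k) := by
    rw [hl, ← Real.rpow_mul (by positivity), one_div_mul_cancel (by linarith), Real.rpow_one]
  set k' : ℝ := (2 / l) ^ (q / (1 - expA α)) with hk'
  have hk'0 : 0 < k' := by positivity
  refine ⟨max 1 (max k (1 / 2 + k')), le_max_left _ _, fun m p Ψ hp t ht => ?_⟩
  obtain ⟨g1, g2, g3, g4, g5⟩ := G_bounds h m Ψ t
  have hQ := dissip_nonneg h m (p.grad t)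
  have e1 : ‖p.val t - Ψ.val t‖ ^ q ≤ k * (dissip m (p.grad t) + G m Ψ t) := by
    have h1 := hp.poincare t ht
    rw [PoincareSobolev, h.wNorm_phi] at h1
    have h2 := Real.rpow_le_rpow (norm_nonneg _) h1 (z := q) (by linarith)
    rw [Real.mul_rpow hcP.le (wNorm_nonneg h m _), wNorm_rpow h] at h2
    have h3 := W1Int_sub_le h m (p.grad t) (Ψ.grad t)
    have h4 := W1Int_le h m (p.grad t)
    refine h2.trans ?_
    rw [hk, mul_comm 4, mul_assoc]
    gcongr
    linarith
  constructor
  · refine e1.trans ?_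
    gcongr
    exact (le_max_left _ _).trans (le_max_right _ _)
  · have h1 := Real.young_inequality_of_nonneg (a := l * ‖p.val t - Ψ.val t‖)
      (b := 2 / l * ‖Ψ.dval t‖) (by positivity) (by positivity) hconj
    have h2 : l * ‖p.val t - Ψ.val t‖ * (2 / l * ‖Ψ.dval t‖) =
        2 * ‖Ψ.dval t‖ * ‖p.val t - Ψ.val t‖ := by field_simp
    rw [h2, Real.mul_rpow hl0.le (norm_nonneg _), hlq,
      Real.mul_rpow (by positivity) (norm_nonneg _), ← hk'] at h1
    have h3 : 1 / (2 * k) * ‖p.val t - Ψ.val t‖ ^ q / q ≤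
        (dissip m (p.grad t) + G m Ψ t) / 2 := by
      calc 1 / (2 * k) * ‖p.val t - Ψ.val t‖ ^ q / q
          ≤ 1 / (2 * k) * ‖p.val t - Ψ.val t‖ ^ q :=
            div_le_self (by positivity) hq1.le
        _ ≤ 1 / (2 * k) * (k * (dissip m (p.grad t) + G m Ψ t)) := by gcongr
        _ = _ := by field_simp
    have h4 : k' * ‖Ψ.dval t‖ ^ (q / (1 - expA α)) / (q / (1 - expA α)) ≤ k' * G m Ψ t := by
      calc _ ≤ k' * ‖Ψ.dval t‖ ^ (q / (1 - expA α)) :=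
            div_le_self (by positivity) hconj.symm.lt.le
        _ ≤ _ := by gcongr
    have h5 : (1 / 2 + k') * G m Ψ t ≤ max 1 (max k (1 / 2 + k')) * G m Ψ t := by
      gcongr
      exact (le_max_right _ _).trans (le_max_right _ _)
    linarith

namespace IsGoodSolution

variable {m : Medium U α} {cP : ℝ} {p Ψ : RegularPath m}

theorem mem_zeroTrace (h : IsSetting U α) (hp : IsGoodSolution m cP p Ψ) {t : ℝ} (ht : 0 < t) :
    (p.val t - Ψ.val t, p.grad t - Ψ.grad t) ∈ zeroTrace h m := hp.sol.2 t ht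

theorem deriv_mem_zeroTrace (h : IsSetting U α) (hp : IsGoodSolution m cP p Ψ) {t : ℝ}
    (ht : 0 < t) : (p.dval t - Ψ.dval t, p.dgrad t - Ψ.dgrad t) ∈ zeroTrace h m :=
  HasDerivAt.mem_of_isClosed (isClosed_zeroTrace h m) ht
    (HasDerivAt.prodMk ((p.hasDerivAt_val t ht).sub (Ψ.hasDerivAt_val t ht))
      ((p.hasDerivAt_grad t ht).sub (Ψ.hasDerivAt_grad t ht)))
    fun _ hs => hp.mem_zeroTrace h hs

theorem inner_dval_val (h : IsSetting U α) (hp : IsGoodSolution m cP p Ψ) {t : ℝ} (ht : 0 < t) :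
    ⟪p.dval t, p.val t - Ψ.val t⟫ = -⟪fluxLp m (p.grad t), p.grad t - Ψ.grad t⟫ :=
  hp.sol.1.inner_eq h ht (hp.mem_zeroTrace h ht)

theorem inner_dval_dval (h : IsSetting U α) (hp : IsGoodSolution m cP p Ψ) {t : ℝ} (ht : 0 < t) :
    ⟪p.dval t, p.dval t - Ψ.dval t⟫ = -⟪fluxLp m (p.grad t), p.dgrad t - Ψ.dgrad t⟫ :=
  hp.sol.1.inner_eq h ht (hp.deriv_mem_zeroTrace h ht)

/-- The equation differentiated in time, tested with `p̄ₜ`. -/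
theorem inner_ddval_le (h : IsSetting U α) (hp : IsGoodSolution m cP p Ψ) {t : ℝ} (ht : 0 < t) :
    ⟪p.ddval t, p.dval t - Ψ.dval t⟫ ≤ 1 / 4 * ‖Ψ.dgrad t‖ ^ 2 := by
  have h1 := hasDerivAt_iff_tendsto_slope.1 (p.hasDerivAt_dval t ht)
  have h2 := hasDerivAt_iff_tendsto_slope.1
    ((p.hasDerivAt_val t ht).sub (Ψ.hasDerivAt_val t ht))
  have h3 := hasDerivAt_iff_tendsto_slope.1 (Ψ.hasDerivAt_grad t ht)
  refine le_of_tendsto_of_tendsto (h1.inner h2) ((h3.norm.pow 2).const_mul (1 / 4)) ?_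
  have hpos : ∀ᶠ s in 𝓝[≠] t, 0 < s := nhdsWithin_le_nhds (lt_mem_nhds ht)
  filter_upwards [hpos] with s hs
  have hmem := (zeroTrace h m).sub_mem (hp.mem_zeroTrace h hs) (hp.mem_zeroTrace h ht)
  have e1 := hp.sol.1.inner_eq h hs hmem
  have e2 := hp.sol.1.inner_eq h ht hmem
  simp only [Prod.fst_sub, Prod.snd_sub] at e1 e2
  -- The flux need not be differentiable. Subtract the equations at times `s` and `t` and test with
  -- the increment of `p̄`: cocoercivity supplies minus the squared flux increment, which absorbs
  -- the cross term and leaves a quarter of the squared increment of `∇Ψ`. Dividing by `(s - t)²`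
  -- gives the claim in the limit.
  have e3 : ⟪p.dval s - p.dval t, (p.val s - Ψ.val s) - (p.val t - Ψ.val t)⟫ ≤
      1 / 4 * ‖Ψ.grad s - Ψ.grad t‖ ^ 2 := by
    have c1 := fluxLp_cocoercive h m (p.grad s) (p.grad t)
    have c2 := real_inner_le_norm (fluxLp m (p.grad s) - fluxLp m (p.grad t))
      (Ψ.grad s - Ψ.grad t)
    have c3 : (p.grad s - Ψ.grad s) - (p.grad t - Ψ.grad t) =
      (p.grad s - p.grad t) - (Ψ.grad s - Ψ.grad t) := by abel
    rw [c3] at e1 e2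
    rw [inner_sub_left, e1, e2]
    rw [inner_sub_right] at e1 e2 ⊢
    rw [inner_sub_left] at c1 c2
    rw [inner_sub_right (fluxLp m (p.grad t))]
    nlinarith [sq_nonneg (‖fluxLp m (p.grad s) - fluxLp m (p.grad t)‖ -
      1 / 2 * ‖Ψ.grad s - Ψ.grad t‖)]
  simp only [slope, vsub_eq_sub, real_inner_smul_left, real_inner_smul_right, norm_smul, mul_pow,
    Pi.sub_apply]
  have e4 := mul_le_mul_of_nonneg_left e3 (sq_nonneg (s - t)⁻¹)
  rw [Real.norm_eq_abs, sq_abs]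
  linarith

end IsGoodSolution

/-- The differential inequalities for `‖p̄‖²`, for the energy, and for `‖p̄ₜ‖²`. -/
structure EnergyIneq (h : IsSetting U α) (C : ℝ) (m : Medium U α) (p Ψ : RegularPath m) (t : ℝ) :
    Prop where
  coercive : (‖p.val t - Ψ.val t‖ ^ 2) ^ ((2 - expA α) / 2) ≤
    C * (dissip m (p.grad t) + G m Ψ t)
  val : ∃ y', HasDerivAt (fun s => ‖p.val s - Ψ.val s‖ ^ 2) y' t ∧
    y' ≤ -dissip m (p.grad t) + C * G m Ψ t
  energy : ∃ z', HasDerivAt (fun s => energy m (p.grad s) + ‖p.val s - Ψ.val s‖ ^ 2) z' t ∧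
    z' ≤ -(energy m (p.grad t) + ‖p.val t - Ψ.val t‖ ^ 2) / 4 + ‖p.val t - Ψ.val t‖ ^ 2 / 4
      - ‖p.dval t - Ψ.dval t‖ ^ 2 + C * G m Ψ t + 2 * G1 m Ψ t
  dval : ∃ x', HasDerivAt (fun s => ‖p.dval s - Ψ.dval s‖ ^ 2) x' t ∧
    x' ≤ G1 m Ψ t / 2 + ‖p.dval t - Ψ.dval t‖ ^ 2 + G2 m Ψ t

/-- The test functions are `p̄` for `val`, `p̄` and `p̄ₜ` for `energy`, and `inner_ddval_le` gives
`dval`. Cross terms are absorbed through `‖flux‖² ≤ dissip`. The term `-‖p̄ₜ‖²` kept in `energy`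
compensates the `+‖p̄ₜ‖²` in `dval`. -/
theorem exists_energyIneq {α : Fin (N + 1) → ℝ}
    (h : IsSetting U α) {cP : ℝ} (hcP : 0 < cP) :
    ∃ C : ℝ, 1 ≤ C ∧ ∀ (m : Medium U α) (p Ψ : RegularPath m), IsGoodSolution m cP p Ψ →
      ∀ t, 0 < t → EnergyIneq h C m p Ψ t := by
  obtain ⟨C, hC, hyoung⟩ := exists_young_const U h hcP
  refine ⟨C + 3, by linarith, fun m p Ψ hp t ht => ?_⟩
  obtain ⟨y1, y2⟩ := hyoung m p Ψ hp t ht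
  obtain ⟨g1, g2, g3, g4, g5⟩ := G_bounds h m Ψ t
  have hQ := dissip_nonneg h m (p.grad t)
  have hF := normSq_fluxLp_le h m (p.grad t)
  have hdy := ((p.hasDerivAt_val t ht).sub (Ψ.hasDerivAt_val t ht)).norm_sq
  have hdE := hasDerivAt_energy h m (p.hasDerivAt_grad t ht)
  have hdx := ((p.hasDerivAt_dval t ht).sub (Ψ.hasDerivAt_dval t ht)).norm_sq
  have hy : 2 * ⟪p.val t - Ψ.val t, p.dval t - Ψ.dval t⟫ ≤
      -dissip m (p.grad t) + (C + 2) * G m Ψ t := by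
    have e1 := hp.inner_dval_val h ht
    have e2 := real_inner_le_norm (fluxLp m (p.grad t)) (Ψ.grad t)
    have e3 := (abs_le.1 (abs_real_inner_le_norm (Ψ.dval t) (p.val t - Ψ.val t))).1
    rw [inner_sub_right (fluxLp m (p.grad t))] at e1
    have e4 : ⟪fluxLp m (p.grad t), p.grad t⟫ = dissip m (p.grad t) := rfl
    rw [real_inner_comm, inner_sub_left, e1, e4]
    nlinarith [sq_nonneg (‖fluxLp m (p.grad t)‖ / 2 - ‖Ψ.grad t‖)]
  refine ⟨?_, ⟨_, hdy, ?_⟩, ⟨_, hdE.add hdy, ?_⟩, ⟨_, hdx, ?_⟩⟩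
  · rw [← Real.rpow_natCast, ← Real.rpow_mul (norm_nonneg _)]
    have e : ((2 : ℕ) : ℝ) * ((2 - expA α) / 2) = 2 - expA α := by push_cast; ring
    rw [e]
    refine y1.trans ?_
    gcongr
    linarith
  · simp only [Pi.sub_apply]
    linarith
  · simp only [Pi.sub_apply]
    have e1 := hp.inner_dval_dval h ht
    have e2 := real_inner_le_norm (fluxLp m (p.grad t)) (Ψ.dgrad t)
    have e3 := (abs_le.1 (abs_real_inner_le_norm (Ψ.dval t) (p.dval t - Ψ.dval t))).1
    have e4 := real_inner_self_eq_norm_sq (p.dval t - Ψ.dval t)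
    have e5 := energy_le h m (p.grad t)
    rw [inner_sub_right (fluxLp m (p.grad t))] at e1
    rw [inner_sub_left] at e4
    rw [G1_eq h]
    nlinarith [sq_nonneg (‖fluxLp m (p.grad t)‖ / 2 - ‖Ψ.dgrad t‖),
      sq_nonneg (‖Ψ.dval t‖ - ‖p.dval t - Ψ.dval t‖)]
  · simp only [Pi.sub_apply]
    have e1 := hp.inner_ddval_le h ht
    have e2 := (abs_le.1 (abs_real_inner_le_norm (Ψ.ddval t) (p.dval t - Ψ.dval t))).1
    rw [real_inner_comm, inner_sub_left, G1_eq h, G2_eq h]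
    nlinarith [sq_nonneg (‖Ψ.ddval t‖ - ‖p.dval t - Ψ.dval t‖)]

/-! ### Comparison principles for scalar functions of time -/

section Comparison

/-- After the last time at which `f` is at most the maximum it exceeds `L`, so it is nonincreasing
from there on. -/
theorem le_max_of_deriv_nonpos {f : ℝ → ℝ} {a b L : ℝ} (hab : a ≤ b)
    (hf : ContinuousOn f (Icc a b))
    (hd : ∀ x ∈ Ioo a b, L < f x → ∃ f', HasDerivAt f f' x ∧ f' ≤ 0) :
    f b ≤ max (f a) L := by
  by_contra! hlt
  set M := max (f a) L
  set S := Icc a b ∩ f ⁻¹' Iic M with hS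
  have hScl : IsClosed S := hf.preimage_isClosed_of_isClosed isClosed_Icc isClosed_Iic
  have hSne : S.Nonempty := ⟨a, ⟨le_rfl, hab⟩, le_max_left (f a) L⟩
  have hSbdd : BddAbove S := ⟨b, fun x hx => hx.1.2⟩
  have hc : sSup S ∈ S := hScl.csSup_mem hSne hSbdd
  set c := sSup S
  have hgt : ∀ x ∈ Ioo c b, M < f x := by
    intro x hx
    by_contra! hle
    exact absurd (le_csSup hSbdd ⟨⟨hc.1.1.trans hx.1.le, hx.2.le⟩, hle⟩) (not_le.2 hx.1)
  have hder : ∀ x ∈ Ioo c b, ∃ f', HasDerivAt f f' x ∧ f' ≤ 0 := fun x hx =>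
    hd x ⟨hc.1.1.trans_lt hx.1, hx.2⟩ ((le_max_right _ _).trans_lt (hgt x hx))
  have hanti : AntitoneOn f (Icc c b) := by
    refine antitoneOn_of_deriv_nonpos (convex_Icc c b)
      (hf.mono (Icc_subset_Icc_left hc.1.1)) ?_ ?_
    · rw [interior_Icc]
      intro x hx
      obtain ⟨f', h1, -⟩ := hder x hx
      exact h1.differentiableAt.differentiableWithinAt
    · rw [interior_Icc]
      intro x hx
      obtain ⟨f', h1, h2⟩ := hder x hx
      rwa [h1.deriv]
  have := hanti ⟨le_rfl, hc.1.2⟩ ⟨hc.1.2, le_rfl⟩ hc.1.2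
  exact absurd (this.trans hc.2) (not_le.2 hlt)

theorem sub_le_mul_of_deriv_le {f : ℝ → ℝ} {a b S : ℝ} (hab : a ≤ b)
    (hf : ContinuousOn f (Icc a b))
    (hd : ∀ x ∈ Ioo a b, ∃ f', HasDerivAt f f' x ∧ f' ≤ S) :
    f b ≤ f a + S * (b - a) := by
  have h := Convex.image_sub_le_mul_sub_of_deriv_le (convex_Icc a b) hf (C := S) ?_ ?_ a
    ⟨le_rfl, hab⟩ b ⟨hab, le_rfl⟩ hab
  · linarith
  · rw [interior_Icc]
    intro x hx
    obtain ⟨f', h1, -⟩ := hd x hx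
    exact h1.differentiableAt.differentiableWithinAt
  · rw [interior_Icc]
    intro x hx
    obtain ⟨f', h1, h2⟩ := hd x hx
    rwa [h1.deriv]

/-- Decrease at rate at least `δ` above `L` forces a visit below `L` in finite time; afterwards
`le_max_of_deriv_nonpos` keeps `f` there. -/
theorem eventually_le_of_deriv_le_neg {f : ℝ → ℝ} {L δ : ℝ} (hδ : 0 < δ)
    (hd : ∀ᶠ x in atTop, ∃ f', HasDerivAt f f' x ∧ (L < f x → f' ≤ -δ)) :
    ∀ᶠ x in atTop, f x ≤ L := by
  obtain ⟨T, hT⟩ := eventually_atTop.1 hd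
  have hcont : ∀ x, T ≤ x → ContinuousAt f x := fun x hx => by
    obtain ⟨f', h1, -⟩ := hT x hx
    exact h1.continuousAt
  have hex : ∃ x, T ≤ x ∧ f x ≤ L := by
    by_contra! hne
    set b := T + (f T - L) / δ with hb
    have hpos : 0 ≤ (f T - L) / δ := div_nonneg (sub_nonneg.2 (hne T le_rfl).le) hδ.le
    have hTb : T ≤ b := by linarith
    have := sub_le_mul_of_deriv_le (S := -δ) hTb
      (fun x hx => (hcont x hx.1).continuousWithinAt) fun x hx => by
        obtain ⟨f', h1, h2⟩ := hT x hx.1.le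
        exact ⟨f', h1, h2 (hne x hx.1.le)⟩
    have h3 := hne b hTb
    have h4 : -δ * (b - T) = L - f T := by rw [hb]; field_simp; ring
    linarith
  obtain ⟨x₀, hx₀, hle⟩ := hex
  filter_upwards [eventually_ge_atTop x₀] with x hx
  refine (le_max_of_deriv_nonpos (L := L) hx
    (fun y hy => (hcont y (hx₀.trans hy.1)).continuousWithinAt) fun y hy hLy => ?_).trans
    (max_le hle le_rfl)
  obtain ⟨f', h1, h2⟩ := hT y (hx₀.trans hy.1.le)
  exact ⟨f', h1, (h2 hLy).trans (neg_nonpos.2 hδ.le)⟩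

end Comparison

/-! ### A priori bounds for one solution -/

theorem IsSetting.two_div_ge_one (h : IsSetting U α) : 1 ≤ 2 / (2 - expA α) := by
  have ha := h.expA_pos
  have ha1 := h.expA_lt_one
  rw [le_div_iff₀ (by linarith)]
  linarith

theorem le_rpow_two_div (h : IsSetting U α) {g : ℝ} (hg : 1 ≤ g) :
    g ≤ g ^ (2 / (2 - expA α)) := by
  have := Real.rpow_le_rpow_of_exponent_le hg h.two_div_ge_one
  rwa [Real.rpow_one] at this

/-- `∫_U H(x,|∇p(t)|) dx + ‖p̄(t)‖²`. -/
noncomputable def totalEnergy {m : Medium U α} (p Ψ : RegularPath m) (t : ℝ) : ℝ :=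
  energy m (p.grad t) + ‖p.val t - Ψ.val t‖ ^ 2

theorem continuousOn_totalEnergy (h : IsSetting U α) {m : Medium U α} (p Ψ : RegularPath m) :
    ContinuousOn (totalEnergy p Ψ) (Ici 0) :=
  ((continuous_energy h m).comp_continuousOn p.continuousOn_grad).add
    ((p.continuousOn_val.sub Ψ.continuousOn_val).norm.pow 2)

theorem totalEnergy_nonneg (h : IsSetting U α) {m : Medium U α} (p Ψ : RegularPath m) (t : ℝ) :
    0 ≤ totalEnergy p Ψ t :=
  add_nonneg (energy_nonneg h m _) (sq_nonneg _)

namespace EnergyIneq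

variable {h : IsSetting U α} {C : ℝ} {m : Medium U α} {p Ψ : RegularPath m} {t g g₁ g₂ Y : ℝ}

/-- Above the threshold, coercivity forces the dissipation to be at least `(1 + C) g`, which beats
the source `C g` by `g ≥ 1`. Inverting the power `(2-a)/2` is what produces `g^{2/(2-a)}`. -/
theorem val_decay (hC : 1 ≤ C) (hI : EnergyIneq h C m p Ψ t) (hg : 1 ≤ g) (hG : G m Ψ t ≤ g) :
    ∃ y', HasDerivAt (fun s => ‖p.val s - Ψ.val s‖ ^ 2) y' t ∧
      ((C * (2 + C)) ^ (2 / (2 - expA α)) * g ^ (2 / (2 - expA α)) <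
        ‖p.val t - Ψ.val t‖ ^ 2 → y' ≤ -1) := by
  obtain ⟨y', hy', hle⟩ := hI.val
  refine ⟨y', hy', fun hlt => ?_⟩
  have ha := h.expA_pos
  have ha1 := h.expA_lt_one
  have h1 := hI.coercive
  rw [← Real.mul_rpow (by positivity) (by positivity)] at hlt
  have h2 := Real.rpow_le_rpow (by positivity) hlt.le (z := (2 - expA α) / 2) (by linarith)
  have e : 2 / (2 - expA α) * ((2 - expA α) / 2) = 1 := by
    have : 2 - expA α ≠ 0 := by linarith
    field_simp
  rw [← Real.rpow_mul (by positivity), e, Real.rpow_one] at h2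
  have h3 : (2 + C) * g ≤ dissip m (p.grad t) + G m Ψ t := by
    have : C * ((2 + C) * g) ≤ C * (dissip m (p.grad t) + G m Ψ t) := by
      refine le_trans (le_of_eq ?_) (h2.trans h1)
      ring
    exact le_of_mul_le_mul_left this (by linarith)
  nlinarith

theorem energy_decay (hC : 1 ≤ C) (hI : EnergyIneq h C m p Ψ t) (hG : G m Ψ t ≤ g)
    (hG1 : G1 m Ψ t ≤ g₁) (hY : ‖p.val t - Ψ.val t‖ ^ 2 ≤ Y) :
    ∃ z', HasDerivAt (totalEnergy p Ψ) z' t ∧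
      z' ≤ -totalEnergy p Ψ t / 4 + (Y / 4 + C * g + 2 * g₁) - ‖p.dval t - Ψ.dval t‖ ^ 2 := by
  obtain ⟨z', hz', hle⟩ := hI.energy
  refine ⟨z', hz', ?_⟩
  have := mul_le_mul_of_nonneg_left hG (zero_le_one.trans hC)
  unfold totalEnergy
  linarith

theorem dval_growth (hI : EnergyIneq h C m p Ψ t)
    (hG1 : G1 m Ψ t ≤ g₁) (hG2 : G2 m Ψ t ≤ g₂) :
    ∃ x', HasDerivAt (fun s => ‖p.dval s - Ψ.dval s‖ ^ 2) x' t ∧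
      x' ≤ g₁ / 2 + ‖p.dval t - Ψ.dval t‖ ^ 2 + g₂ := by
  obtain ⟨x', hx', hle⟩ := hI.dval
  exact ⟨x', hx', by linarith⟩

theorem val_le (hC : 1 ≤ C) (hI : ∀ s, 0 < s → EnergyIneq h C m p Ψ s) (ht : 0 ≤ t) (hg : 1 ≤ g)
    (hG : ∀ s ∈ Icc 0 t, G m Ψ s ≤ g) :
    ‖p.val t - Ψ.val t‖ ^ 2 ≤ totalEnergy p Ψ 0 +
      (C * (2 + C)) ^ (2 / (2 - expA α)) * g ^ (2 / (2 - expA α)) := by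
  have hcont : ContinuousOn (fun s => ‖p.val s - Ψ.val s‖ ^ 2) (Icc 0 t) :=
    ((p.continuousOn_val.sub Ψ.continuousOn_val).norm.pow 2).mono Icc_subset_Ici_self
  refine (le_max_of_deriv_nonpos (f := fun s => ‖p.val s - Ψ.val s‖ ^ 2) ht hcont
    (L := (C * (2 + C)) ^ (2 / (2 - expA α)) * g ^ (2 / (2 - expA α))) ?_).trans ?_
  · intro s hs hlt
    obtain ⟨y', h1, h2⟩ := (hI s hs.1).val_decay hC hg (hG s ⟨hs.1.le, hs.2.le⟩)
    exact ⟨y', h1, (h2 hlt).trans (by norm_num)⟩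
  · have h1 := energy_nonneg h m (p.grad 0)
    have h2 := sq_nonneg ‖p.val 0 - Ψ.val 0‖
    have h3 : 0 ≤ (C * (2 + C)) ^ (2 / (2 - expA α)) * g ^ (2 / (2 - expA α)) := by positivity
    unfold totalEnergy
    exact max_le (by linarith) (by linarith)

theorem totalEnergy_le (hC : 1 ≤ C) (hI : ∀ s, 0 < s → EnergyIneq h C m p Ψ s) (ht : 0 ≤ t)
    (hG : ∀ s ∈ Icc 0 t, G m Ψ s ≤ g) (hG1 : ∀ s ∈ Icc 0 t, G1 m Ψ s ≤ g₁)
    (hY : ∀ s ∈ Icc 0 t, ‖p.val s - Ψ.val s‖ ^ 2 ≤ Y) :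
    totalEnergy p Ψ t ≤ max (totalEnergy p Ψ 0) (4 * (Y / 4 + C * g + 2 * g₁)) := by
  refine le_max_of_deriv_nonpos ht
    ((continuousOn_totalEnergy h p Ψ).mono Icc_subset_Ici_self) fun s hs hlt => ?_
  have hs' : s ∈ Icc 0 t := ⟨hs.1.le, hs.2.le⟩
  obtain ⟨z', h1, h2⟩ := (hI s hs.1).energy_decay hC (hG s hs') (hG1 s hs') (hY s hs')
  have := sq_nonneg ‖p.dval s - Ψ.dval s‖
  exact ⟨z', h1, by linarith⟩

/-- Consider the total energy plus `(s - r)‖p̄ₜ‖²/2`. Differentiating the weight costs `‖p̄ₜ‖²/2`,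
the growth of `‖p̄ₜ‖²` at most as much again since `s - r ≤ 1`, and both are paid by `-‖p̄ₜ‖²` in
the energy inequality. The weight vanishes at `r`, where nothing is known about `p̄ₜ`. -/
theorem dval_le_aux (hC : 1 ≤ C) (hI : ∀ s, 0 < s → EnergyIneq h C m p Ψ s) {r : ℝ} (hr : 0 < r)
    (hrt : r < t) (htr : t - r ≤ 1) (hg₁ : 0 ≤ g₁) (hg₂ : 0 ≤ g₂)
    (hG : ∀ s ∈ Icc 0 t, G m Ψ s ≤ g) (hG1 : ∀ s ∈ Icc 0 t, G1 m Ψ s ≤ g₁)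
    (hG2 : ∀ s ∈ Icc 0 t, G2 m Ψ s ≤ g₂)
    (hY : ∀ s ∈ Icc 0 t, ‖p.val s - Ψ.val s‖ ^ 2 ≤ Y) :
    (t - r) * ‖p.dval t - Ψ.dval t‖ ^ 2 ≤
      2 * totalEnergy p Ψ r + 2 * (Y / 4 + C * g + 3 * g₁ + g₂) * (t - r) := by
  have hder : ∀ s, 0 < s → s ∈ Icc r t → ∃ f', HasDerivAt
      (fun s => totalEnergy p Ψ s + (s - r) * ‖p.dval s - Ψ.dval s‖ ^ 2 / 2) f' s ∧
      f' ≤ Y / 4 + C * g + 3 * g₁ + g₂ := by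
    intro s hs0 hs
    have hs' : s ∈ Icc 0 t := ⟨hs0.le, hs.2⟩
    obtain ⟨z', h1, h2⟩ := (hI s hs0).energy_decay hC (hG s hs') (hG1 s hs') (hY s hs')
    obtain ⟨x', h3, h4⟩ := (hI s hs0).dval_growth (hG1 s hs') (hG2 s hs')
    refine ⟨_, h1.add ((((hasDerivAt_id s).sub_const r).mul h3).div_const 2), ?_⟩
    have h5 := totalEnergy_nonneg h p Ψ s
    have h6 := sq_nonneg ‖p.dval s - Ψ.dval s‖
    have h7 : 0 ≤ s - r := sub_nonneg.2 hs.1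
    have h8 : s - r ≤ 1 := by linarith [hs.2]
    have h9 := mul_le_mul_of_nonneg_left h4 h7
    have h10 : (s - r) * (g₁ / 2 + ‖p.dval s - Ψ.dval s‖ ^ 2 + g₂) ≤
        1 * (g₁ / 2 + ‖p.dval s - Ψ.dval s‖ ^ 2 + g₂) := by gcongr
    simp only [id]
    linarith
  have := sub_le_mul_of_deriv_le hrt.le (f := fun s => totalEnergy p Ψ s +
    (s - r) * ‖p.dval s - Ψ.dval s‖ ^ 2 / 2) (S := Y / 4 + C * g + 3 * g₁ + g₂)
    (fun s hs => by
      obtain ⟨f', h1, -⟩ := hder s (hr.trans_le hs.1) hs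
      exact h1.continuousAt.continuousWithinAt)
    fun s hs => hder s (hr.trans hs.1) ⟨hs.1.le, hs.2.le⟩
  have h5 := totalEnergy_nonneg h p Ψ t
  simp only [sub_self, zero_mul, zero_div, add_zero] at this
  linarith

theorem dval_le (hC : 1 ≤ C) (hI : ∀ s, 0 < s → EnergyIneq h C m p Ψ s) {t₀ : ℝ}
    (ht₀ : t₀ ∈ Ioc (0 : ℝ) 1) (ht : t₀ ≤ t) (hg : 0 ≤ g) (hg₁ : 0 ≤ g₁) (hg₂ : 0 ≤ g₂)
    (hG : ∀ s ∈ Icc 0 t, G m Ψ s ≤ g) (hG1 : ∀ s ∈ Icc 0 t, G1 m Ψ s ≤ g₁)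
    (hG2 : ∀ s ∈ Icc 0 t, G2 m Ψ s ≤ g₂) (hY0 : 0 ≤ Y)
    (hY : ∀ s ∈ Icc 0 t, ‖p.val s - Ψ.val s‖ ^ 2 ≤ Y) :
    ‖p.dval t - Ψ.dval t‖ ^ 2 ≤
      2 * (t₀⁻¹ * totalEnergy p Ψ 0) + 10 * (Y / 4 + C * g + 3 * g₁ + g₂) := by
  have htpos := ht₀.1.trans_le ht
  have hE0 := totalEnergy_nonneg h p Ψ 0
  have hinv : 1 ≤ t₀⁻¹ := (one_le_inv₀ ht₀.1).2 ht₀.2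
  have hS : 0 ≤ Y / 4 + C * g + 3 * g₁ + g₂ := by positivity
  rcases le_or_gt t 1 with h1 | h1
  -- The differential inequalities hold only at positive times, so the starting time `0` is reached
  -- as a limit; it produces the factor `t₀⁻¹`.
  · have hlim : ∀ᶠ r in 𝓝[>] (0 : ℝ), (t - r) * ‖p.dval t - Ψ.dval t‖ ^ 2 ≤
        2 * totalEnergy p Ψ r + 2 * (Y / 4 + C * g + 3 * g₁ + g₂) * (t - r) := by
      filter_upwards [Ioo_mem_nhdsGT htpos] with r hr
      exact dval_le_aux hC hI hr.1 hr.2 (by linarith [hr.1]) hg₁ hg₂ hG hG1 hG2 hY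
    have hsub : Tendsto (fun r : ℝ => t - r) (𝓝[>] 0) (𝓝 (t - 0)) :=
      ((continuous_const.sub continuous_id).tendsto 0).mono_left nhdsWithin_le_nhds
    have hE : Tendsto (totalEnergy p Ψ) (𝓝[>] 0) (𝓝 (totalEnergy p Ψ 0)) :=
      (continuousOn_totalEnergy h p Ψ 0 self_mem_Ici).mono_left
        (nhdsWithin_mono _ Ioi_subset_Ici_self)
    have key := le_of_tendsto_of_tendsto (hsub.mul_const _)
      ((hE.const_mul 2).add (hsub.const_mul _)) hlim
    rw [sub_zero, ← le_div_iff₀' htpos] at key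
    refine key.trans ?_
    rw [add_div, mul_div_cancel_right₀ _ htpos.ne']
    have : 2 * totalEnergy p Ψ 0 / t ≤ 2 * (t₀⁻¹ * totalEnergy p Ψ 0) := by
      rw [mul_div_assoc, div_eq_inv_mul]
      have := ht₀.1
      gcongr
    linarith
  -- For `t > 1`, start at `t - 1` and use the energy bound there.
  · have key := dval_le_aux hC hI (sub_pos.2 h1) (by linarith) (by linarith) hg₁ hg₂ hG hG1
      hG2 hY
    have hsub : Icc 0 (t - 1) ⊆ Icc 0 t := Icc_subset_Icc_right (by linarith)
    have h2 := totalEnergy_le hC hI (sub_pos.2 h1).le (fun s hs => hG s (hsub hs))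
      (fun s hs => hG1 s (hsub hs)) fun s hs => hY s (hsub hs)
    have h3 : totalEnergy p Ψ (t - 1) ≤ totalEnergy p Ψ 0 + 4 * (Y / 4 + C * g + 2 * g₁) :=
      h2.trans (max_le (by linarith [show 0 ≤ Y / 4 + C * g + 2 * g₁ by positivity])
        (by linarith))
    rw [show t - (t - 1) = 1 by ring] at key
    nlinarith

end EnergyIneq

/-- Uniform bounds on a finite time interval. -/
theorem exists_energy_bound {α : Fin (N + 1) → ℝ} (h : IsSetting U α) {cP : ℝ} (hcP : 0 < cP) :
    ∃ C : ℝ, 1 ≤ C ∧ ∀ (m : Medium U α) (p Ψ : RegularPath m), IsGoodSolution m cP p Ψ →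
      ∀ t g g₁ : ℝ, 0 ≤ t → 1 ≤ g → 0 ≤ g₁ → (∀ s ∈ Icc 0 t, G m Ψ s ≤ g) →
        (∀ s ∈ Icc 0 t, G1 m Ψ s ≤ g₁) →
        totalEnergy p Ψ t ≤ C * (totalEnergy p Ψ 0 + g ^ (2 / (2 - expA α)) + g₁) ∧
        ∀ t₀ ∈ Ioc (0 : ℝ) 1, t₀ ≤ t → ∀ g₂ : ℝ, 0 ≤ g₂ → (∀ s ∈ Icc 0 t, G2 m Ψ s ≤ g₂) →
          ‖p.dval t - Ψ.dval t‖ ^ 2 ≤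
            C * (t₀⁻¹ * totalEnergy p Ψ 0 + g ^ (2 / (2 - expA α)) + g₁ + g₂) := by
  obtain ⟨C, hC, hI⟩ := exists_energyIneq h hcP
  set k := (C * (2 + C)) ^ (2 / (2 - expA α)) with hk
  have hk0 : 0 ≤ k := by positivity
  refine ⟨40 + 10 * k + 10 * C, by linarith, fun m p Ψ hp t g g₁ ht hg hg₁ hG hG1 => ?_⟩
  have hI' := hI m p Ψ hp
  have hE0 := totalEnergy_nonneg h p Ψ 0
  have hgg := le_rpow_two_div h hg
  have hY : ∀ s ∈ Icc 0 t, ‖p.val s - Ψ.val s‖ ^ 2 ≤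
      totalEnergy p Ψ 0 + k * g ^ (2 / (2 - expA α)) := fun s hs =>
    EnergyIneq.val_le hC hI' hs.1 hg fun r hr => hG r ⟨hr.1, hr.2.trans hs.2⟩
  set γ := g ^ (2 / (2 - expA α)) with hγ
  have hCg := mul_le_mul_of_nonneg_left hgg (zero_le_one.trans hC)
  have hγ0 : 0 ≤ γ := by linarith
  have hkγ : 0 ≤ k * γ := by positivity
  have hCγ : 0 ≤ C * γ := by positivity
  have hkg : 0 ≤ k * g₁ := by positivity
  have hCg₁ : 0 ≤ C * g₁ := by positivity
  have hkE : 0 ≤ k * totalEnergy p Ψ 0 := by positivity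
  have hCE : 0 ≤ C * totalEnergy p Ψ 0 := by positivity
  constructor
  · refine (EnergyIneq.totalEnergy_le hC hI' ht hG hG1 hY).trans (max_le ?_ ?_) <;> linarith
  · intro t₀ ht₀ htt g₂ hg₂ hG2
    have := EnergyIneq.dval_le hC hI' ht₀ htt (by linarith) hg₁ hg₂ hG hG1 hG2
      (by positivity) hY
    have hinv : 1 ≤ t₀⁻¹ := (one_le_inv₀ ht₀.1).2 ht₀.2
    have hE1 : totalEnergy p Ψ 0 ≤ t₀⁻¹ * totalEnergy p Ψ 0 := le_mul_of_one_le_left hE0 hinv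
    have := mul_le_mul_of_nonneg_left hE1 hk0
    have := mul_le_mul_of_nonneg_left hE1 (zero_le_one.trans hC)
    have : 0 ≤ k * g₂ := by positivity
    have : 0 ≤ C * g₂ := by positivity
    linarith

/-- Uniform bounds for large times. -/
theorem exists_eventual_energy_bound {α : Fin (N + 1) → ℝ} (h : IsSetting U α) {cP : ℝ}
    (hcP : 0 < cP) :
    ∃ C : ℝ, 1 ≤ C ∧ ∀ (m : Medium U α) (p Ψ : RegularPath m), IsGoodSolution m cP p Ψ →
      ∀ g g₁ g₂ : ℝ, 1 ≤ g → 0 ≤ g₁ → 0 ≤ g₂ → (∀ᶠ s in atTop, G m Ψ s ≤ g) →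
        (∀ᶠ s in atTop, G1 m Ψ s ≤ g₁) → (∀ᶠ s in atTop, G2 m Ψ s ≤ g₂) →
        ∀ᶠ t in atTop, totalEnergy p Ψ t ≤ C * (g ^ (2 / (2 - expA α)) + g₁) ∧
          ‖p.dval t - Ψ.dval t‖ ^ 2 ≤ C * (g ^ (2 / (2 - expA α)) + g₁ + g₂) := by
  obtain ⟨C, hC, hI⟩ := exists_energyIneq h hcP
  set k := (C * (2 + C)) ^ (2 / (2 - expA α)) with hk
  have hk0 : 0 ≤ k := by positivity
  refine ⟨40 + 10 * k + 10 * C, by linarith, fun m p Ψ hp g g₁ g₂ hg hg₁ hg₂ hG hG1 hG2 => ?_⟩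
  have hI' := hI m p Ψ hp
  have hgg := le_rpow_two_div h hg
  -- The initial data are forgotten: only the eventual bound on `G` sets the threshold.
  have hY : ∀ᶠ s in atTop, ‖p.val s - Ψ.val s‖ ^ 2 ≤ k * g ^ (2 / (2 - expA α)) := by
    refine eventually_le_of_deriv_le_neg one_pos ?_
    filter_upwards [hG, eventually_gt_atTop 0] with s hs hs0
    exact (hI' s hs0).val_decay hC hg hs
  set γ := g ^ (2 / (2 - expA α)) with hγ
  have hCg := mul_le_mul_of_nonneg_left hgg (zero_le_one.trans hC)
  have hγ0 : 0 ≤ γ := by linarith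
  have hkγ : 0 ≤ k * γ := by positivity
  have hCγ : 0 ≤ C * γ := by positivity
  have hkg : 0 ≤ k * g₁ := by positivity
  have hCg₁ : 0 ≤ C * g₁ := by positivity
  have hkg₂ : 0 ≤ k * g₂ := by positivity
  have hCg₂ : 0 ≤ C * g₂ := by positivity
  have hz : ∀ᶠ s in atTop, totalEnergy p Ψ s ≤ 4 * (k * γ / 4 + C * g + 2 * g₁ + 1) := by
    refine eventually_le_of_deriv_le_neg one_pos ?_
    filter_upwards [hG, hG1, hY, eventually_gt_atTop 0] with s h1 h2 h3 hs0
    obtain ⟨z', h4, h5⟩ := (hI' s hs0).energy_decay hC h1 h2 h3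
    refine ⟨z', h4, fun hlt => ?_⟩
    have := sq_nonneg ‖p.dval s - Ψ.dval s‖
    linarith
  -- No time weight is needed now: in this sum the terms in `‖p̄ₜ‖²` add up to `-‖p̄ₜ‖²/2`, so it
  -- decays above the threshold; the `+ 1` fixes the rate.
  have hx : ∀ᶠ s in atTop, totalEnergy p Ψ s + ‖p.dval s - Ψ.dval s‖ ^ 2 / 2 ≤
      4 * (k * γ / 4 + C * g + 3 * g₁ + g₂ + 1) := by
    refine eventually_le_of_deriv_le_neg one_pos ?_
    filter_upwards [hG, hG1, hG2, hY, eventually_gt_atTop 0] with s h1 h2 h2' h3 hs0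
    obtain ⟨z', h4, h5⟩ := (hI' s hs0).energy_decay hC h1 h2 h3
    obtain ⟨x', h6, h7⟩ := (hI' s hs0).dval_growth h2 h2'
    refine ⟨_, h4.add (h6.div_const 2), fun hlt => ?_⟩
    have := sq_nonneg ‖p.dval s - Ψ.dval s‖
    linarith
  filter_upwards [hz, hx] with s h1 h2
  have := totalEnergy_nonneg h p Ψ s
  constructor <;> linarith

/-! ### Running suprema and Gronwall's inequality -/

section Calculus

/-- Rescaling `[0, t]` to `[0, 1]` makes this the supremum of a jointly continuous function over a
fixed compact set. -/
theorem continuousOn_sSup_image_Icc {f : ℝ → ℝ} (hf : ContinuousOn f (Ici 0)) :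
    ContinuousOn (fun t => sSup (f '' Icc 0 t)) (Ici 0) := by
  have h1 : Continuous fun t : ℝ =>
      sSup ((fun t r : ℝ => f (max (t * r) 0)) t '' Icc (0 : ℝ) 1) := by
    refine isCompact_Icc.continuous_sSup ?_
    exact hf.comp_continuous ((continuous_fst.mul continuous_snd).max continuous_const)
      fun x => mem_Ici.2 (le_max_right _ _)
  refine h1.continuousOn.congr fun t ht => ?_
  congr 1
  have ht0 : (0 : ℝ) ≤ t := ht
  ext y
  constructor
  · rintro ⟨s, hs, rfl⟩
    rcases eq_or_lt_of_le ht0 with rfl | htp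
    · exact ⟨0, ⟨le_rfl, zero_le_one⟩, by simp [le_antisymm hs.2 hs.1]⟩
    · refine ⟨s / t, ⟨div_nonneg hs.1 ht0, (div_le_one htp).2 hs.2⟩, ?_⟩
      simp only
      rw [mul_div_cancel₀ s htp.ne', max_eq_left hs.1]
  · rintro ⟨r, hr, rfl⟩
    refine ⟨t * r, ⟨mul_nonneg ht0 hr.1, mul_le_of_le_one_right ht0 hr.2⟩, ?_⟩
    simp only
    rw [max_eq_left (mul_nonneg ht0 hr.1)]

theorem le_sSup_image_Icc {f : ℝ → ℝ} (hf : ContinuousOn f (Ici 0)) {s t : ℝ} (hs : s ∈ Icc 0 t) :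
    f s ≤ sSup (f '' Icc 0 t) :=
  le_csSup (isCompact_Icc.image_of_continuousOn (hf.mono Icc_subset_Ici_self)).bddAbove
    (mem_image_of_mem f hs)

/-- Gronwall's inequality for `w' ≤ -k w + b`. -/
theorem gronwall_le {k b w : ℝ → ℝ} {t : ℝ} (ht : 0 ≤ t) (hk : ContinuousOn k (Ici 0))
    (hb : IntervalIntegrable b volume 0 t) (hw : ContinuousOn w (Icc 0 t))
    (hd : ∀ s ∈ Ioo 0 t, ∃ w', HasDerivAt w w' s ∧ w' ≤ -k s * w s + b s) :
    w t ≤ Real.exp (-∫ τ in (0 : ℝ)..t, k τ) * w 0 +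
      ∫ s in (0 : ℝ)..t, Real.exp (-∫ τ in s..t, k τ) * b s := by
  -- Extending `k` continuously to the line makes its primitive differentiable everywhere.
  set kk : ℝ → ℝ := fun s => k (max s 0) with hkk
  have hkc : Continuous kk := hk.comp_continuous (continuous_id.max continuous_const)
    fun x => mem_Ici.2 (le_max_right _ _)
  have hint : ∀ r s : ℝ, 0 ≤ r → 0 ≤ s → ∫ τ in r..s, k τ = ∫ τ in r..s, kk τ := by
    intro r s hr hs
    refine intervalIntegral.integral_congr fun τ hτ => ?_
    have : 0 ≤ τ := (le_min hr hs).trans hτ.1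
    simp only [hkk, max_eq_left this]
  set E : ℝ → ℝ := fun s => ∫ τ in (0 : ℝ)..s, kk τ with hE
  have hEd : ∀ s, HasDerivAt E (kk s) s := fun s =>
    intervalIntegral.integral_hasDerivAt_right (hkc.intervalIntegrable _ _)
      (hkc.stronglyMeasurableAtFilter _ _) hkc.continuousAt
  have hEc : Continuous E := continuous_iff_continuousAt.2 fun s => (hEd s).continuousAt
  choose! w' hw' hle using hd
  -- Integrating factor `exp E`. This form asks only for pointwise derivatives inside and
  -- integrability of the majorant, not of `w'`.
  have key := intervalIntegral.sub_le_integral_of_hasDeriv_right_of_le (a := 0) (b := t)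
    (g := fun s => Real.exp (E s) * w s)
    (g' := fun s => Real.exp (E s) * kk s * w s + Real.exp (E s) * w' s)
    (φ := fun s => Real.exp (E s) * b s) ht
    ((Real.continuous_exp.comp hEc).continuousOn.mul hw)
    (fun s hs => ((hEd s).exp.mul (hw' s hs)).hasDerivWithinAt)
    (by
      rw [← intervalIntegrable_iff_integrableOn_Icc_of_le ht]
      exact hb.continuousOn_mul (Real.continuous_exp.comp hEc).continuousOn)
    (fun s hs => by
      have h1 : kk s = k s := by simp only [hkk, max_eq_left hs.1.le]
      have h2 := mul_le_mul_of_nonneg_left (hle s hs) (Real.exp_pos (E s)).le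
      rw [h1]
      linarith)
  have hE0 : E 0 = 0 := by simp [hE]
  simp only [hE0, Real.exp_zero, one_mul] at key
  have h1 : w t = Real.exp (-E t) * (Real.exp (E t) * w t) := by
    rw [← mul_assoc, ← Real.exp_add, neg_add_cancel, Real.exp_zero, one_mul]
  have h2 : ∫ s in (0 : ℝ)..t, Real.exp (-∫ τ in s..t, k τ) * b s =
      Real.exp (-E t) * ∫ s in (0 : ℝ)..t, Real.exp (E s) * b s := by
    rw [← intervalIntegral.integral_const_mul]
    refine intervalIntegral.integral_congr fun s hs => ?_
    rw [uIcc_of_le ht] at hs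
    have h3 : ∫ τ in s..t, k τ = E t - E s := by
      rw [hint s t hs.1 ht, hE]
      simp only
      rw [intervalIntegral.integral_interval_sub_left (hkc.intervalIntegrable _ _)
        (hkc.intervalIntegrable _ _)]
    rw [h3, ← mul_assoc, ← Real.exp_add]
    congr 2
    ring
  rw [hint 0 t le_rfl ht, h2, h1, ← mul_add]
  gcongr
  linarith

end Calculus

/-! ### The difference of two solutions -/

/-- Two solutions, with the Poincaré inequality for the difference. -/
structure IsGoodPair (m : Medium U α) (cP : ℝ) (p₁ Ψ₁ p₂ Ψ₂ : RegularPath m) : Prop where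
  fst : IsGoodSolution m cP p₁ Ψ₁
  snd : IsGoodSolution m cP p₂ Ψ₂
  poincare : ∀ t, 0 < t →
    PoincareSobolev m cP (Pbar p₁ Ψ₁ p₂ Ψ₂ t) (gradPbar p₁ Ψ₁ p₂ Ψ₂ t)

section Pair

variable {m : Medium U α} {cP : ℝ} {p₁ Ψ₁ p₂ Ψ₂ : RegularPath m}

theorem gradPbar_eq (p₁ Ψ₁ p₂ Ψ₂ : RegularPath m) (t : ℝ) :
    gradPbar p₁ Ψ₁ p₂ Ψ₂ t =
      p₁.grad t - p₂.grad t - (Ψ₁.grad t - Ψ₂.grad t) := by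
  unfold gradPbar
  abel

/-- Both equations are tested with `P̄`, whose gradient is `∇(p₁ - p₂) - ∇Φ`: a monotone part and a
data part. -/
theorem IsGoodPair.inner_eq (h : IsSetting U α) (hp : IsGoodPair m cP p₁ Ψ₁ p₂ Ψ₂) {t : ℝ}
    (ht : 0 < t) : ⟪p₁.dval t - p₂.dval t, Pbar p₁ Ψ₁ p₂ Ψ₂ t⟫ =
      -⟪fluxLp m (p₁.grad t) - fluxLp m (p₂.grad t), p₁.grad t - p₂.grad t⟫
        + ⟪fluxLp m (p₁.grad t) - fluxLp m (p₂.grad t), Ψ₁.grad t - Ψ₂.grad t⟫ := by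
  have hmem : (Pbar p₁ Ψ₁ p₂ Ψ₂ t, gradPbar p₁ Ψ₁ p₂ Ψ₂ t) ∈ zeroTrace h m :=
    (zeroTrace h m).sub_mem (hp.fst.mem_zeroTrace h ht) (hp.snd.mem_zeroTrace h ht)
  have e1 := hp.fst.sol.1.inner_eq h ht hmem
  have e2 := hp.snd.sol.1.inner_eq h ht hmem
  simp only at e1 e2
  rw [inner_sub_left (p₁.dval t), e1, e2, gradPbar_eq]
  simp only [inner_sub_left, inner_sub_right]
  ring

theorem hasDerivAt_normSq_Pbar (p₁ Ψ₁ p₂ Ψ₂ : RegularPath m) {t : ℝ} (ht : 0 < t) :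
    HasDerivAt (fun s => ‖Pbar p₁ Ψ₁ p₂ Ψ₂ s‖ ^ 2)
      (2 * ⟪Pbar p₁ Ψ₁ p₂ Ψ₂ t,
        (p₁.dval t - p₂.dval t) - (Ψ₁.dval t - Ψ₂.dval t)⟫) t := by
  have h1 : HasDerivAt (Pbar p₁ Ψ₁ p₂ Ψ₂)
      ((p₁.dval t - p₂.dval t) - (Ψ₁.dval t - Ψ₂.dval t)) t := by
    have e : (p₁.dval t - p₂.dval t) - (Ψ₁.dval t - Ψ₂.dval t) =
      (p₁.dval t - Ψ₁.dval t) - (p₂.dval t - Ψ₂.dval t) := by abel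
    rw [e]
    exact ((p₁.hasDerivAt_val t ht).sub (Ψ₁.hasDerivAt_val t ht)).sub
      ((p₂.hasDerivAt_val t ht).sub (Ψ₂.hasDerivAt_val t ht))
  exact h1.norm_sq

theorem continuousOn_Pbar (p₁ Ψ₁ p₂ Ψ₂ : RegularPath m) :
    ContinuousOn (Pbar p₁ Ψ₁ p₂ Ψ₂) (Ici 0) :=
  (p₁.continuousOn_val.sub Ψ₁.continuousOn_val).sub
    (p₂.continuousOn_val.sub Ψ₂.continuousOn_val)

/-- The two readings of `IsGoodPair.inner_eq`. For the first, the Poincaré inequality and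
`wNorm_sq_le` bound `R + ‖∇Φ‖²` below by `c j^{-a/(2-a)} ‖P̄‖²`. For the second, Cauchy–Schwarz on
`(p₁ₜ - p₂ₜ, P̄)` bounds `R` above. -/
theorem exists_pair_estimate {α : Fin (N + 1) → ℝ} (h : IsSetting U α) {cP : ℝ} (hcP : 0 < cP) :
    ∃ c C : ℝ, 0 < c ∧ 1 ≤ C ∧ ∀ (m : Medium U α) (p₁ Ψ₁ p₂ Ψ₂ : RegularPath m),
      IsGoodPair m cP p₁ Ψ₁ p₂ Ψ₂ → ∀ t j : ℝ, 0 < t →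
        totalEnergy p₁ Ψ₁ t + totalEnergy p₂ Ψ₂ t + Bstar m ≤ j →
        (∃ w', HasDerivAt (fun s => ‖Pbar p₁ Ψ₁ p₂ Ψ₂ s‖ ^ 2) w' t ∧
          w' ≤ -(c * j ^ (-(expA α / (2 - expA α)))) * ‖Pbar p₁ Ψ₁ p₂ Ψ₂ t‖ ^ 2
            + 4 * (j ^ (1 / 2 : ℝ) * D m Ψ₁ Ψ₂ t)) ∧
        ∀ x : ℝ, ‖p₁.dval t‖ ^ 2 + ‖p₂.dval t‖ ^ 2 ≤ x →
          wNorm U m.W1 (2 - expA α) (gradPbar p₁ Ψ₁ p₂ Ψ₂ t) ^ 2 ≤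
            C * j ^ (expA α / (2 - expA α)) *
              (x ^ (1 / 2 : ℝ) * ‖Pbar p₁ Ψ₁ p₂ Ψ₂ t‖ + D m Ψ₁ Ψ₂ t) := by
  have ha := h.expA_pos
  have ha1 := h.expA_lt_one
  set b := expA α / (2 - expA α) with hb
  have hb0 : 0 < b := div_pos ha (by linarith)
  set k : ℝ := 2 * (2 + 2 * max 1 (α (Fin.last N))) with hk
  have hk1 : 4 ≤ k := by
    have : 1 ≤ max 1 (α (Fin.last N)) := le_max_left _ _
    linarith
  have hk0 : 0 < k := by linarith
  refine ⟨1 / (cP ^ 2 * k), 4 * k, by positivity, by linarith,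
    fun m p₁ Ψ₁ p₂ Ψ₂ hp t j ht hj => ?_⟩
  have hB := one_le_Bstar m
  have hE1 := totalEnergy_nonneg h p₁ Ψ₁ t
  have hE2 := totalEnergy_nonneg h p₂ Ψ₂ t
  have hj1 : 1 ≤ j := by linarith
  have hj0 : 0 < j := by linarith
  set R := ⟪fluxLp m (p₁.grad t) - fluxLp m (p₂.grad t), p₁.grad t - p₂.grad t⟫ with hR
  set P := Pbar p₁ Ψ₁ p₂ Ψ₂ t with hP
  set F := ‖Ψ₁.grad t - Ψ₂.grad t‖ with hF
  set V := ‖Ψ₁.dval t - Ψ₂.dval t‖ with hV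
  have hF0 : 0 ≤ F := norm_nonneg _
  have hV0 : 0 ≤ V := norm_nonneg _
  have hP0 : 0 ≤ ‖P‖ := norm_nonneg _
  have hD : D m Ψ₁ Ψ₂ t = F ^ 2 + F + V := D_eq h m Ψ₁ Ψ₂ t
  have hcoco := fluxLp_cocoercive h m (p₁.grad t) (p₂.grad t)
  rw [← hR] at hcoco
  have hR0 : 0 ≤ R := (sq_nonneg _).trans hcoco
  have hN := wNorm_sq_le h m (p₁.grad t) (p₂.grad t) (Ψ₁.grad t - Ψ₂.grad t)
  rw [← gradPbar_eq, ← hR, ← hF, ← hk, ← hb] at hN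
  set W := wNorm U m.W1 (2 - expA α) (gradPbar p₁ Ψ₁ p₂ Ψ₂ t) with hW
  have hJ : (dissip m (p₁.grad t) + dissip m (p₂.grad t) + Bstar m) ^ b ≤ j ^ b := by
    have h1 := dissip_le_energy h m (p₁.grad t)
    have h2 := dissip_le_energy h m (p₂.grad t)
    have h3 := dissip_nonneg h m (p₁.grad t)
    have h4 := dissip_nonneg h m (p₂.grad t)
    have h5 := sq_nonneg ‖p₁.val t - Ψ₁.val t‖
    have h6 := sq_nonneg ‖p₂.val t - Ψ₂.val t‖
    unfold totalEnergy at hj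
    refine Real.rpow_le_rpow (by linarith) (by linarith) hb0.le
  have hN' : W ^ 2 ≤ k * (R + F ^ 2) * j ^ b :=
    hN.trans (mul_le_mul_of_nonneg_left hJ (by positivity))
  -- By cocoercivity the squared flux difference is at most `R`, so half of `R` absorbs the data
  -- term.
  have hcross : |⟪fluxLp m (p₁.grad t) - fluxLp m (p₂.grad t), Ψ₁.grad t - Ψ₂.grad t⟫| ≤
      R / 2 + F ^ 2 / 2 := by
    refine (abs_real_inner_le_norm _ _).trans ?_
    rw [← hF]
    nlinarith [sq_nonneg (‖fluxLp m (p₁.grad t) - fluxLp m (p₂.grad t)‖ - F)]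
  have hinner := hp.inner_eq h ht
  rw [← hR, ← hP] at hinner
  constructor
  · refine ⟨_, hasDerivAt_normSq_Pbar p₁ Ψ₁ p₂ Ψ₂ ht, ?_⟩
    rw [← hP]
    have e1 := (abs_le.1 hcross).2
    have e2 := (abs_le.1 (abs_real_inner_le_norm (Ψ₁.dval t - Ψ₂.dval t) P)).1
    rw [← hV] at e2
    have hpoin : ‖P‖ ^ 2 ≤ cP ^ 2 * W ^ 2 := by
      have h1 := hp.poincare t ht
      rw [PoincareSobolev, h.wNorm_phi, ← hP, ← hW] at h1
      rw [← mul_pow]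
      gcongr
    have hRlow : 1 / (cP ^ 2 * k) * j ^ (-b) * ‖P‖ ^ 2 ≤ R + F ^ 2 := by
      rw [Real.rpow_neg hj0.le, one_div, ← mul_inv, inv_mul_le_iff₀ (by positivity)]
      have := mul_le_mul_of_nonneg_left hN' (sq_nonneg cP)
      linarith
    -- A crude bound that makes `‖Φₜ‖ ‖P̄‖` linear in `D`, at the price of the factor `j^{1/2}`.
    have hPj : ‖P‖ ≤ 2 * j ^ (1 / 2 : ℝ) := by
      rw [← Real.sqrt_eq_rpow]
      have h1 : ‖P‖ ≤ ‖p₁.val t - Ψ₁.val t‖ + ‖p₂.val t - Ψ₂.val t‖ := norm_sub_le _ _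
      have h2 : ∀ (p Ψ : RegularPath m), totalEnergy p Ψ t ≤ j →
          ‖p.val t - Ψ.val t‖ ≤ Real.sqrt j := fun p Ψ hle => by
        refine Real.le_sqrt_of_sq_le (le_trans ?_ hle)
        have := energy_nonneg h m (p.grad t)
        unfold totalEnergy
        linarith
      have h3 := h2 p₁ Ψ₁ (by linarith)
      have h4 := h2 p₂ Ψ₂ (by linarith)
      linarith
    have hjh : 1 ≤ j ^ (1 / 2 : ℝ) := Real.one_le_rpow hj1 (by norm_num)
    have e3 : V * ‖P‖ ≤ V * (2 * j ^ (1 / 2 : ℝ)) := by gcongr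
    have e4 : F ^ 2 ≤ j ^ (1 / 2 : ℝ) * F ^ 2 := le_mul_of_one_le_left (sq_nonneg F) hjh
    have e5 : 0 ≤ j ^ (1 / 2 : ℝ) * F := by positivity
    rw [real_inner_comm, inner_sub_left, hinner, hD]
    linarith [sq_nonneg F]
  · intro x hx
    have e1 := (abs_le.1 hcross).2
    have e2 := (abs_le.1 (abs_real_inner_le_norm (p₁.dval t - p₂.dval t) P)).1
    have h1 : ‖p₁.dval t - p₂.dval t‖ ≤ 2 * x ^ (1 / 2 : ℝ) := by
      rw [← Real.sqrt_eq_rpow]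
      have h2 := norm_sub_le (p₁.dval t) (p₂.dval t)
      have h3 : ‖p₁.dval t‖ ≤ Real.sqrt x :=
        Real.le_sqrt_of_sq_le (by linarith [sq_nonneg ‖p₂.dval t‖])
      have h4 : ‖p₂.dval t‖ ≤ Real.sqrt x :=
        Real.le_sqrt_of_sq_le (by linarith [sq_nonneg ‖p₁.dval t‖])
      linarith
    have h5 : ‖p₁.dval t - p₂.dval t‖ * ‖P‖ ≤ 2 * x ^ (1 / 2 : ℝ) * ‖P‖ := by gcongr
    have h6 : R + F ^ 2 ≤ 4 * (x ^ (1 / 2 : ℝ) * ‖P‖ + D m Ψ₁ Ψ₂ t) := by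
      rw [hD]
      linarith [sq_nonneg F]
    refine hN'.trans ?_
    calc k * (R + F ^ 2) * j ^ b
        ≤ k * (4 * (x ^ (1 / 2 : ℝ) * ‖P‖ + D m Ψ₁ Ψ₂ t)) * j ^ b := by gcongr
      _ = _ := by ring

end Pair

/-! ### The estimate at finite times -/

section Majorants

variable {m : Medium U α} {p₁ p₂ Ψ₁ Ψ₂ : RegularPath m} {M₁ M₂ : ℝ → ℝ}

theorem H0_add_P0 (h : IsSetting U α) (m : Medium U α) (p₁ Ψ₁ p₂ Ψ₂ : RegularPath m) :
    H0 m p₁ p₂ + P0 m p₁ Ψ₁ p₂ Ψ₂ = totalEnergy p₁ Ψ₁ 0 + totalEnergy p₂ Ψ₂ 0 := by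
  unfold H0 P0 totalEnergy energy
  rw [h.normSq_L2Phi', h.normSq_L2Phi']
  ring

theorem one_le_majorant (h : IsSetting U α) {Ψ : RegularPath m} {M : ℝ → ℝ}
    (hM : IsMajorant M (G m Ψ)) {t : ℝ} (ht : 0 ≤ t) : 1 ≤ M t :=
  (G_bounds h m Ψ t).1.trans (hM.2.2 t ht)

theorem continuousOn_calM1 (h : IsSetting U α) (hM₁ : IsMajorant M₁ (G m Ψ₁))
    (hM₂ : IsMajorant M₂ (G m Ψ₂)) (hG₁ : ContinuousOn (G1 m Ψ₁) (Ici 0))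
    (hG₂ : ContinuousOn (G1 m Ψ₂) (Ici 0)) :
    ContinuousOn (calM1 m p₁ Ψ₁ p₂ Ψ₂ M₁ M₂) (Ici 0) := by
  refine (continuousOn_const.add ((hM₁.1.add hM₂.1).rpow_const fun t _ => Or.inr ?_)).add
    (continuousOn_sSup_image_Icc (hG₁.add hG₂))
  exact zero_le_one.trans h.two_div_ge_one

end Majorants

/-- The pair estimate is applied with `j` a multiple of `ℳ₁` and `x` a multiple of `ℳ₂`. Gronwall's
inequality then controls `‖P̄‖²`. -/
theorem exists_gradient_estimate {α : Fin (N + 1) → ℝ} (h : IsSetting U α) {cP : ℝ}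
    (hcP : 0 < cP) :
    ∃ C d₄ : ℝ, 0 < C ∧ 0 < d₄ ∧ ∀ (m : Medium U α) (p₁ p₂ Ψ₁ Ψ₂ : RegularPath m),
      IsGoodPair m cP p₁ Ψ₁ p₂ Ψ₂ →
      ContinuousOn (G1 m Ψ₁) (Ici 0) → ContinuousOn (G1 m Ψ₂) (Ici 0) →
      ContinuousOn (G2 m Ψ₁) (Ici 0) → ContinuousOn (G2 m Ψ₂) (Ici 0) →
      ∀ M₁ M₂ : ℝ → ℝ, IsMajorant M₁ (G m Ψ₁) → IsMajorant M₂ (G m Ψ₂) →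
        ∀ t₀ ∈ Ioc (0 : ℝ) 1, ∀ t, t₀ ≤ t →
          wNorm U m.W1 (2 - expA α) (gradPbar p₁ Ψ₁ p₂ Ψ₂ t) ^ 2 ≤
            C * (calM2 m p₁ Ψ₁ p₂ Ψ₂ M₁ M₂ t₀ t ^ kappa α *
              (Real.exp (-d₄ * ∫ τ in (0 : ℝ)..t,
                    calM1 m p₁ Ψ₁ p₂ Ψ₂ M₁ M₂ τ ^ (-(expA α / (2 - expA α)))) *
                  wNorm U m.phi 2 (Pbar p₁ Ψ₁ p₂ Ψ₂ 0) ^ 2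
                + D m Ψ₁ Ψ₂ t ^ 2
                + (∫ s in (0 : ℝ)..t,
                    Real.exp (-d₄ * ∫ τ in s..t,
                      calM1 m p₁ Ψ₁ p₂ Ψ₂ M₁ M₂ τ ^ (-(expA α / (2 - expA α)))) *
                    calM1 m p₁ Ψ₁ p₂ Ψ₂ M₁ M₂ s ^ (1 / 2 : ℝ) * D m Ψ₁ Ψ₂ s)) ^ (1 / 2 : ℝ)) := by
  obtain ⟨Ce, hCe, hEn⟩ := exists_energy_bound h hcP
  obtain ⟨c, Cp, hc, hCp, hPair⟩ := exists_pair_estimate h hcP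
  have ha := h.expA_pos
  have ha1 := h.expA_lt_one
  set β := expA α / (2 - expA α) with hβ
  have hβ0 : 0 < β := div_pos ha (by linarith)
  have hκ : kappa α = β + 1 / 2 := rfl
  set K₁ : ℝ := 2 * Ce + 1 with hK₁
  set K₂ : ℝ := 8 * Ce + 4 with hK₂
  have hK₁1 : 1 ≤ K₁ := by linarith
  have hK₂1 : 1 ≤ K₂ := by linarith
  have hK₁0 : 0 < K₁ := by linarith
  have hK₂0 : 0 < K₂ := by linarith
  set L : ℝ := 4 * K₁ ^ (1 / 2 : ℝ) with hL
  have hL1 : 1 ≤ L := by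
    have : 1 ≤ K₁ ^ (1 / 2 : ℝ) := Real.one_le_rpow hK₁1 (by norm_num)
    linarith
  refine ⟨Cp * K₁ ^ β * K₂ ^ (1 / 2 : ℝ) * (2 * L ^ (1 / 2 : ℝ)), c * K₁ ^ (-β),
    by positivity, by positivity, ?_⟩
  intro m p₁ p₂ Ψ₁ Ψ₂ hp hG11 hG12 hG21 hG22 M₁ M₂ hM₁ hM₂ t₀ ht₀ t ht
  have htpos : 0 < t := ht₀.1.trans_le ht
  set m1 := calM1 m p₁ Ψ₁ p₂ Ψ₂ M₁ M₂ with hm1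
  have hm1c : ContinuousOn m1 (Ici 0) := continuousOn_calM1 h hM₁ hM₂ hG11 hG12
  have hHP := H0_add_P0 h m p₁ Ψ₁ p₂ Ψ₂
  have hz1 := totalEnergy_nonneg h p₁ Ψ₁ 0
  have hz2 := totalEnergy_nonneg h p₂ Ψ₂ 0
  have hG1nn : ∀ (Ψ : RegularPath m) s, 0 ≤ G1 m Ψ s := fun Ψ s => by
    rw [G1_eq h]; positivity
  have hG2nn : ∀ (Ψ : RegularPath m) s, 0 ≤ G2 m Ψ s := fun Ψ s => by
    rw [G2_eq h]; positivity
  have hB : ∀ s, 0 ≤ s → Bstar m ≤ M₁ s + M₂ s := fun s hs => by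
    have h1 := one_le_majorant h hM₂ hs
    have h2 := (G_bounds h m Ψ₁ s).2.1
    have h3 := W1Int_nonneg h m (Ψ₁.grad s)
    have h4 := hM₁.2.2 s hs
    linarith
  have hMge : ∀ s, 0 ≤ s → 1 ≤ M₁ s + M₂ s := fun s hs => (one_le_Bstar m).trans (hB s hs)
  have hGle₁ : ∀ s r, r ∈ Icc 0 s → G m Ψ₁ r ≤ M₁ s + M₂ s := fun s r hr => by
    have h1 := one_le_majorant h hM₂ (hr.1.trans hr.2)
    have h2 := hM₁.2.2 r hr.1
    have h3 := hM₁.2.1 (mem_Ici.2 hr.1) (mem_Ici.2 (hr.1.trans hr.2)) hr.2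
    linarith
  have hGle₂ : ∀ s r, r ∈ Icc 0 s → G m Ψ₂ r ≤ M₁ s + M₂ s := fun s r hr => by
    have h1 := one_le_majorant h hM₁ (hr.1.trans hr.2)
    have h2 := hM₂.2.2 r hr.1
    have h3 := hM₂.2.1 (mem_Ici.2 hr.1) (mem_Ici.2 (hr.1.trans hr.2)) hr.2
    linarith
  have hsup1 : ∀ s r, r ∈ Icc 0 s → G1 m Ψ₁ r + G1 m Ψ₂ r ≤
      sSup ((fun τ => G1 m Ψ₁ τ + G1 m Ψ₂ τ) '' Icc 0 s) := fun s r hr =>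
    le_sSup_image_Icc (hG11.add hG12) hr
  have hsup2 : ∀ s r, r ∈ Icc 0 s → (G1 m Ψ₁ r + G1 m Ψ₂ r) + (G2 m Ψ₁ r + G2 m Ψ₂ r) ≤
      sSup ((fun τ => (G1 m Ψ₁ τ + G1 m Ψ₂ τ) + (G2 m Ψ₁ τ + G2 m Ψ₂ τ)) '' Icc 0 s) :=
    fun s r hr => le_sSup_image_Icc ((hG11.add hG12).add (hG21.add hG22)) hr
  have hj : ∀ s, 0 < s →
      totalEnergy p₁ Ψ₁ s + totalEnergy p₂ Ψ₂ s + Bstar m ≤ K₁ * m1 s ∧ 1 ≤ m1 s := by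
    intro s hs
    have hs0 : s ∈ Icc 0 s := ⟨hs.le, le_rfl⟩
    have h0 : 0 ≤ sSup ((fun τ => G1 m Ψ₁ τ + G1 m Ψ₂ τ) '' Icc 0 s) :=
      (add_nonneg (hG1nn _ _) (hG1nn _ _)).trans (hsup1 s s hs0)
    have e1 := (hEn m p₁ Ψ₁ hp.fst s (M₁ s + M₂ s) _ hs.le (hMge s hs.le) h0 (hGle₁ s)
      fun r hr => by linarith [hsup1 s r hr, hG1nn Ψ₂ r]).1
    have e2 := (hEn m p₂ Ψ₂ hp.snd s (M₁ s + M₂ s) _ hs.le (hMge s hs.le) h0 (hGle₂ s)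
      fun r hr => by linarith [hsup1 s r hr, hG1nn Ψ₁ r]).1
    have e3 := le_rpow_two_div h (hMge s hs.le)
    have e4 := hB s hs.le
    have e5 := hMge s hs.le
    have e6 : m1 s = totalEnergy p₁ Ψ₁ 0 + totalEnergy p₂ Ψ₂ 0 +
        (M₁ s + M₂ s) ^ (2 / (2 - expA α)) +
        sSup ((fun τ => G1 m Ψ₁ τ + G1 m Ψ₂ τ) '' Icc 0 s) := by rw [← hHP]; rfl
    set γ := (M₁ s + M₂ s) ^ (2 / (2 - expA α))
    set σ := sSup ((fun τ => G1 m Ψ₁ τ + G1 m Ψ₂ τ) '' Icc 0 s)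
    have hle : 1 ≤ m1 s := by rw [e6]; linarith
    refine ⟨?_, hle⟩
    rw [hK₁, add_mul, one_mul]
    have e7 : Ce * (totalEnergy p₁ Ψ₁ 0 + γ + σ) + Ce * (totalEnergy p₂ Ψ₂ 0 + γ + σ) ≤
        2 * Ce * m1 s := by
      rw [← mul_add, mul_comm 2 Ce, mul_assoc]
      gcongr
      rw [e6]
      linarith
    have e8 : Bstar m ≤ m1 s := by rw [e6]; linarith
    linarith
  -- Time `0` is obtained by continuity from positive times.
  have hj1 : ∀ s, 0 ≤ s → 1 ≤ m1 s := fun s hs => by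
    rcases eq_or_lt_of_le hs with rfl | hs'
    · have h1 : Tendsto m1 (𝓝[>] 0) (𝓝 (m1 0)) :=
        (hm1c 0 self_mem_Ici).mono_left (nhdsWithin_mono _ Ioi_subset_Ici_self)
      exact ge_of_tendsto h1 (by filter_upwards [self_mem_nhdsWithin] with r hr using (hj r hr).2)
    · exact (hj s hs').2
  set m2 := calM2 m p₁ Ψ₁ p₂ Ψ₂ M₁ M₂ t₀ t with hm2
  have hm2x : ‖p₁.dval t‖ ^ 2 + ‖p₂.dval t‖ ^ 2 ≤ K₂ * m2 ∧ m1 t ≤ m2 := by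
    have ht0 : t ∈ Icc 0 t := ⟨htpos.le, le_rfl⟩
    have hnn : ∀ r, 0 ≤ G2 m Ψ₁ r + G2 m Ψ₂ r := fun r => add_nonneg (hG2nn _ _) (hG2nn _ _)
    have hnn1 : ∀ r, 0 ≤ G1 m Ψ₁ r + G1 m Ψ₂ r := fun r => add_nonneg (hG1nn _ _) (hG1nn _ _)
    have h0 : 0 ≤ sSup ((fun τ => (G1 m Ψ₁ τ + G1 m Ψ₂ τ) + (G2 m Ψ₁ τ + G2 m Ψ₂ τ)) ''
        Icc 0 t) := (add_nonneg (hnn1 t) (hnn t)).trans (hsup2 t t ht0)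
    -- One supremum serves as the bound for `G1` and for `G2`.
    have e1 := (hEn m p₁ Ψ₁ hp.fst t (M₁ t + M₂ t) _ htpos.le (hMge t htpos.le) h0 (hGle₁ t)
      fun r hr => by linarith [hsup2 t r hr, hG1nn Ψ₂ r, hnn r]).2 t₀ ht₀ ht _ h0
      fun r hr => by linarith [hsup2 t r hr, hG2nn Ψ₂ r, hnn1 r]
    have e2 := (hEn m p₂ Ψ₂ hp.snd t (M₁ t + M₂ t) _ htpos.le (hMge t htpos.le) h0 (hGle₂ t)
      fun r hr => by linarith [hsup2 t r hr, hG1nn Ψ₁ r, hnn r]).2 t₀ ht₀ ht _ h0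
      fun r hr => by linarith [hsup2 t r hr, hG2nn Ψ₁ r, hnn1 r]
    have e3 := le_rpow_two_div h (hMge t htpos.le)
    have e5 := hMge t htpos.le
    have hinv : 1 ≤ t₀⁻¹ := (one_le_inv₀ ht₀.1).2 ht₀.2
    have hσ : sSup ((fun τ => G1 m Ψ₁ τ + G1 m Ψ₂ τ) '' Icc 0 t) ≤
        sSup ((fun τ => (G1 m Ψ₁ τ + G1 m Ψ₂ τ) + (G2 m Ψ₁ τ + G2 m Ψ₂ τ)) '' Icc 0 t) := by
      refine csSup_le ⟨_, mem_image_of_mem _ ht0⟩ ?_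
      rintro _ ⟨r, hr, rfl⟩
      exact (le_add_of_nonneg_right (hnn r)).trans (hsup2 t r hr)
    have e6 : m2 = t₀⁻¹ * (totalEnergy p₁ Ψ₁ 0 + totalEnergy p₂ Ψ₂ 0) +
        (M₁ t + M₂ t) ^ (2 / (2 - expA α)) +
        sSup ((fun τ => (G1 m Ψ₁ τ + G1 m Ψ₂ τ) + (G2 m Ψ₁ τ + G2 m Ψ₂ τ)) '' Icc 0 t) := by
      rw [← hHP]; rfl
    have e7 : m1 t = totalEnergy p₁ Ψ₁ 0 + totalEnergy p₂ Ψ₂ 0 +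
        (M₁ t + M₂ t) ^ (2 / (2 - expA α)) +
        sSup ((fun τ => G1 m Ψ₁ τ + G1 m Ψ₂ τ) '' Icc 0 t) := by rw [← hHP]; rfl
    have hd : ∀ (p Ψ : RegularPath m), G m Ψ t ≤ M₁ t + M₂ t →
        ‖p.dval t‖ ^ 2 ≤ 2 * ‖p.dval t - Ψ.dval t‖ ^ 2 + 2 * (M₁ t + M₂ t) := fun p Ψ hle => by
      have h1 : ‖p.dval t‖ ≤ ‖p.dval t - Ψ.dval t‖ + ‖Ψ.dval t‖ := by
        have := norm_add_le (p.dval t - Ψ.dval t) (Ψ.dval t)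
        rwa [sub_add_cancel] at this
      have h2 := (G_bounds h m Ψ t).2.2.2.2
      nlinarith [sq_nonneg (‖p.dval t - Ψ.dval t‖ - ‖Ψ.dval t‖), norm_nonneg (p.dval t)]
    have d1 := hd p₁ Ψ₁ (hGle₁ t t ht0)
    have d2 := hd p₂ Ψ₂ (hGle₂ t t ht0)
    set γ := (M₁ t + M₂ t) ^ (2 / (2 - expA α))
    set σ := sSup ((fun τ => (G1 m Ψ₁ τ + G1 m Ψ₂ τ) + (G2 m Ψ₁ τ + G2 m Ψ₂ τ)) '' Icc 0 t)
    have hzt : totalEnergy p₁ Ψ₁ 0 + totalEnergy p₂ Ψ₂ 0 ≤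
      t₀⁻¹ * (totalEnergy p₁ Ψ₁ 0 + totalEnergy p₂ Ψ₂ 0) :=
      le_mul_of_one_le_left (by linarith) hinv
    constructor
    · have e8 : Ce * (t₀⁻¹ * totalEnergy p₁ Ψ₁ 0 + γ + σ + σ) +
          Ce * (t₀⁻¹ * totalEnergy p₂ Ψ₂ 0 + γ + σ + σ) ≤ Ce * (4 * m2) := by
        rw [← mul_add]
        gcongr
        rw [e6]
        linarith
      have e9 : M₁ t + M₂ t ≤ m2 := by rw [e6]; linarith
      rw [hK₂]
      linarith
    · rw [e6, e7]
      linarith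
  obtain ⟨hx, hm12⟩ := hm2x
  have hm2_one : 1 ≤ m2 := (hj1 t htpos.le).trans hm12
  have hm2pos : 0 < m2 := by linarith
  have hDnn : ∀ s, 0 ≤ D m Ψ₁ Ψ₂ s := fun s => by rw [D_eq h]; positivity
  -- `Ψᵢₜ` is continuous only on `(0, ∞)`, with no constraint at `0`; boundedness comes from `G` and
  -- its majorant.
  have hDint : IntervalIntegrable (D m Ψ₁ Ψ₂) volume 0 t := by
    have e : D m Ψ₁ Ψ₂ = fun s => (‖Ψ₁.grad s - Ψ₂.grad s‖ ^ 2 + ‖Ψ₁.grad s - Ψ₂.grad s‖)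
      + ‖Ψ₁.dval s - Ψ₂.dval s‖ := funext fun s => D_eq h m Ψ₁ Ψ₂ s
    have hF : ContinuousOn (fun s => ‖Ψ₁.grad s - Ψ₂.grad s‖) (uIcc 0 t) := by
      rw [uIcc_of_le htpos.le]
      exact (Ψ₁.continuousOn_grad.sub Ψ₂.continuousOn_grad).norm.mono Icc_subset_Ici_self
    have hV : ContinuousOn (fun s => ‖Ψ₁.dval s - Ψ₂.dval s‖) (Ioc 0 t) := fun s hs =>
      ((Ψ₁.hasDerivAt_dval s hs.1).continuousAt.sub
        (Ψ₂.hasDerivAt_dval s hs.1).continuousAt).norm.continuousWithinAt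
    rw [e]
    refine ((hF.pow 2).add hF).intervalIntegrable.add ?_
    rw [intervalIntegrable_iff_integrableOn_Ioc_of_le htpos.le]
    refine Integrable.of_bound (hV.aestronglyMeasurable measurableSet_Ioc)
      (2 * Real.sqrt (M₁ t + M₂ t)) ?_
    filter_upwards [ae_restrict_mem measurableSet_Ioc] with s hs
    have hs' : s ∈ Icc 0 t := ⟨hs.1.le, hs.2⟩
    have h1 := Real.le_sqrt_of_sq_le ((G_bounds h m Ψ₁ s).2.2.2.2.trans (hGle₁ t s hs'))
    have h2 := Real.le_sqrt_of_sq_le ((G_bounds h m Ψ₂ s).2.2.2.2.trans (hGle₂ t s hs'))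
    rw [norm_norm]
    have := norm_sub_le (Ψ₁.dval s) (Ψ₂.dval s)
    linarith
  have hbint : IntervalIntegrable (fun s => L * (m1 s ^ (1 / 2 : ℝ) * D m Ψ₁ Ψ₂ s)) volume 0 t := by
    refine (hDint.continuousOn_mul ?_).const_mul L
    rw [uIcc_of_le htpos.le]
    exact (hm1c.mono Icc_subset_Ici_self).rpow_const fun s _ => Or.inr (by norm_num)
  have hkc : ContinuousOn (fun s => c * K₁ ^ (-β) * m1 s ^ (-β)) (Ici 0) :=
    continuousOn_const.mul (hm1c.rpow_const fun s hs =>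
      Or.inl (zero_lt_one.trans_le (hj1 s hs)).ne')
  have hgron := gronwall_le htpos.le hkc hbint
    ((continuousOn_Pbar p₁ Ψ₁ p₂ Ψ₂).norm.pow 2 |>.mono Icc_subset_Ici_self) fun s hs => by
      obtain ⟨⟨w', h1, h2⟩, -⟩ := hPair m p₁ Ψ₁ p₂ Ψ₂ hp s (K₁ * m1 s) hs.1 (hj s hs.1).1
      refine ⟨w', h1, h2.trans (le_of_eq ?_)⟩
      have h3 : 0 ≤ m1 s := zero_le_one.trans (hj s hs.1).2
      rw [Real.mul_rpow hK₁0.le h3, Real.mul_rpow hK₁0.le h3, hL]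
      simp only [Pi.pow_apply]
      ring
  simp only [intervalIntegral.integral_const_mul] at hgron
  rw [h.wNorm_phi]
  set I : ℝ := ∫ s in (0 : ℝ)..t, Real.exp (-(c * K₁ ^ (-β)) * ∫ τ in s..t, m1 τ ^ (-β)) *
    m1 s ^ (1 / 2 : ℝ) * D m Ψ₁ Ψ₂ s with hI
  have hIeq : ∫ s in (0 : ℝ)..t, Real.exp (-(c * K₁ ^ (-β) * ∫ τ in s..t, m1 τ ^ (-β))) *
      (L * (m1 s ^ (1 / 2 : ℝ) * D m Ψ₁ Ψ₂ s)) = L * I := by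
    rw [hI, ← intervalIntegral.integral_const_mul]
    refine intervalIntegral.integral_congr fun s _ => ?_
    simp only [neg_mul]
    ring
  have hI0 : 0 ≤ I := intervalIntegral.integral_nonneg htpos.le fun s hs => by
    have := hDnn s
    have := zero_le_one.trans (hj1 s hs.1)
    positivity
  rw [hIeq] at hgron
  have hEeq : Real.exp (-(c * K₁ ^ (-β) * ∫ τ in (0 : ℝ)..t, m1 τ ^ (-β))) =
    Real.exp (-(c * K₁ ^ (-β)) * ∫ τ in (0 : ℝ)..t, m1 τ ^ (-β)) := by rw [neg_mul]
  rw [hEeq] at hgron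
  set X : ℝ := Real.exp (-(c * K₁ ^ (-β)) * ∫ τ in (0 : ℝ)..t, m1 τ ^ (-β)) *
    ‖Pbar p₁ Ψ₁ p₂ Ψ₂ 0‖ ^ 2 with hX
  have hX0 : 0 ≤ X := by positivity
  have hD0 := hDnn t
  set d := D m Ψ₁ Ψ₂ t with hd
  set r := ‖Pbar p₁ Ψ₁ p₂ Ψ₂ t‖ with hr
  have hr0 : 0 ≤ r := norm_nonneg _
  -- With `d²` inside the root, both `r` and `d` are at most the root.
  have hsum : r + d ≤ 2 * L ^ (1 / 2 : ℝ) * (X + d ^ 2 + I) ^ (1 / 2 : ℝ) := by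
    rw [mul_assoc, ← Real.mul_rpow (by linarith) (by positivity), ← Real.sqrt_eq_rpow]
    have h1 : r ^ 2 + d ^ 2 ≤ L * (X + d ^ 2 + I) := by
      have h2 : X ≤ L * X := le_mul_of_one_le_left hX0 hL1
      have h3 : d ^ 2 ≤ L * d ^ 2 := le_mul_of_one_le_left (sq_nonneg d) hL1
      simp only [Pi.pow_apply] at hgron
      linarith
    have h2 : r ≤ Real.sqrt (L * (X + d ^ 2 + I)) :=
      Real.le_sqrt_of_sq_le (by linarith [sq_nonneg d])
    have h3 : d ≤ Real.sqrt (L * (X + d ^ 2 + I)) :=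
      Real.le_sqrt_of_sq_le (by linarith [sq_nonneg r])
    linarith
  have hfin := (hPair m p₁ Ψ₁ p₂ Ψ₂ hp t (K₁ * m1 t) htpos (hj t htpos).1).2 _ hx
  have hm1t := hj1 t htpos.le
  -- This lets the factor multiply `d` as well, so that `m2 ^ kappa α` comes out in common.
  have hx1 : 1 ≤ (K₂ * m2) ^ (1 / 2 : ℝ) :=
    Real.one_le_rpow (one_le_mul_of_one_le_of_one_le hK₂1 hm2_one) (by norm_num)
  calc wNorm U m.W1 (2 - expA α) (gradPbar p₁ Ψ₁ p₂ Ψ₂ t) ^ 2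
      ≤ Cp * (K₁ * m1 t) ^ β * ((K₂ * m2) ^ (1 / 2 : ℝ) * r + d) := hfin
    _ ≤ Cp * (K₁ * m2) ^ β * ((K₂ * m2) ^ (1 / 2 : ℝ) * r + (K₂ * m2) ^ (1 / 2 : ℝ) * d) := by
        gcongr
        exact le_mul_of_one_le_left hD0 hx1
    _ = Cp * K₁ ^ β * K₂ ^ (1 / 2 : ℝ) * (m2 ^ kappa α * (r + d)) := by
        rw [Real.mul_rpow hK₁0.le hm2pos.le, Real.mul_rpow hK₂0.le hm2pos.le, hκ,
          Real.rpow_add hm2pos]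
        ring
    _ ≤ Cp * K₁ ^ β * K₂ ^ (1 / 2 : ℝ) *
        (m2 ^ kappa α * (2 * L ^ (1 / 2 : ℝ) * (X + d ^ 2 + I) ^ (1 / 2 : ℝ))) := by gcongr
    _ = _ := by ring

/-! ### The estimate at large times -/

/-- Bounds for large times, in terms of bounds on the data for large times. -/
theorem exists_eventual_gradient_estimate {α : Fin (N + 1) → ℝ} (h : IsSetting U α) {cP : ℝ}
    (hcP : 0 < cP) :
    ∃ C : ℝ, 0 < C ∧ ∀ (m : Medium U α) (p₁ p₂ Ψ₁ Ψ₂ : RegularPath m),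
      IsGoodPair m cP p₁ Ψ₁ p₂ Ψ₂ → ∀ g g₁ g₂ δ : ℝ, 0 ≤ g₁ → 0 ≤ g₂ → 0 < δ →
      (∀ᶠ s in atTop, G m Ψ₁ s ≤ g) → (∀ᶠ s in atTop, G m Ψ₂ s ≤ g) →
      (∀ᶠ s in atTop, G1 m Ψ₁ s ≤ g₁) → (∀ᶠ s in atTop, G1 m Ψ₂ s ≤ g₁) →
      (∀ᶠ s in atTop, G2 m Ψ₁ s ≤ g₂) → (∀ᶠ s in atTop, G2 m Ψ₂ s ≤ g₂) →
      (∀ᶠ s in atTop, D m Ψ₁ Ψ₂ s ≤ δ) →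
      ∀ᶠ t in atTop, wNorm U m.W1 (2 - expA α) (gradPbar p₁ Ψ₁ p₂ Ψ₂ t) ^ 2 ≤
        C * ((g ^ (2 / (2 - expA α)) + g₁ + g₂) ^ (3 * kappa α) * δ) ^ (1 / 2 : ℝ)
          + C * ((g ^ (2 / (2 - expA α)) + g₁) ^ kappa α * δ) := by
  obtain ⟨Ce, hCe, hEn⟩ := exists_eventual_energy_bound h hcP
  obtain ⟨c, Cp, hc, hCp, hPair⟩ := exists_pair_estimate h hcP
  have ha := h.expA_pos
  have ha1 := h.expA_lt_one
  set β := expA α / (2 - expA α) with hβ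
  have hβ0 : 0 < β := div_pos ha (by linarith)
  have hκ : kappa α = β + 1 / 2 := rfl
  have hκ0 : 0 < kappa α := by rw [hκ]; linarith
  set K : ℝ := 4 * Ce + 4 with hK
  have hK0 : 0 < K := by linarith
  refine ⟨Cp * K ^ β * (K ^ (1 / 2 : ℝ) * (8 / c * K ^ kappa α) ^ (1 / 2 : ℝ) + 1),
    by positivity, ?_⟩
  intro m p₁ p₂ Ψ₁ Ψ₂ hp g g₁ g₂ δ hg₁ hg₂ hδ hGA hGB hG1A hG1B hG2A hG2B hD
  have hg : 1 ≤ g := by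
    obtain ⟨s, hs⟩ := hGA.exists
    exact (G_bounds h m Ψ₁ s).1.trans hs
  have hγ := le_rpow_two_div h hg
  have hB : Bstar m ≤ g := by
    obtain ⟨s, hs⟩ := hGA.exists
    have h1 := (G_bounds h m Ψ₁ s).2.1
    have h2 := W1Int_nonneg h m (Ψ₁.grad s)
    linarith
  set γ := g ^ (2 / (2 - expA α)) with hγdef
  set J := γ + g₁ with hJ
  set J₂ := γ + g₁ + g₂ with hJ₂
  have hJ1 : 1 ≤ J := by linarith
  have hJJ₂ : J ≤ J₂ := by linarith
  have hJ0 : 0 < J := by linarith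
  have hJ₂0 : 0 < J₂ := by linarith
  have hKJ0 : 0 < K * J := by positivity
  have hE := (hEn m p₁ Ψ₁ hp.fst g g₁ g₂ hg hg₁ hg₂ hGA hG1A hG2A).and
    (hEn m p₂ Ψ₂ hp.snd g g₁ g₂ hg hg₁ hg₂ hGB hG1B hG2B)
  have hj : ∀ᶠ t in atTop,
      totalEnergy p₁ Ψ₁ t + totalEnergy p₂ Ψ₂ t + Bstar m ≤ K * J := by
    filter_upwards [hE] with t ht
    have h1 : Ce * J + Ce * J + J ≤ K * J := by rw [hK]; nlinarith
    linarith [ht.1.1, ht.2.1]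
  have hx : ∀ᶠ t in atTop, ‖p₁.dval t‖ ^ 2 + ‖p₂.dval t‖ ^ 2 ≤ K * J₂ := by
    have hd : ∀ (p Ψ : RegularPath m) (t : ℝ), G m Ψ t ≤ g →
        ‖p.dval t‖ ^ 2 ≤ 2 * ‖p.dval t - Ψ.dval t‖ ^ 2 + 2 * g := fun p Ψ t hle => by
      have h1 : ‖p.dval t‖ ≤ ‖p.dval t - Ψ.dval t‖ + ‖Ψ.dval t‖ := by
        have := norm_add_le (p.dval t - Ψ.dval t) (Ψ.dval t)
        rwa [sub_add_cancel] at this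
      have h2 := (G_bounds h m Ψ t).2.2.2.2
      nlinarith [sq_nonneg (‖p.dval t - Ψ.dval t‖ - ‖Ψ.dval t‖), norm_nonneg (p.dval t)]
    filter_upwards [hE, hGA, hGB] with t ht hA hB'
    have d1 := hd p₁ Ψ₁ t hA
    have d2 := hd p₂ Ψ₂ t hB'
    rw [hK, add_mul]
    linarith [ht.1.2, ht.2.2]
  -- At this threshold the damping is `8 (KJ)^{1/2} δ`, twice the forcing; `δ > 0` makes the
  -- resulting rate of decrease positive.
  have hw : ∀ᶠ t in atTop, ‖Pbar p₁ Ψ₁ p₂ Ψ₂ t‖ ^ 2 ≤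
      8 / c * (K * J) ^ kappa α * δ := by
    refine eventually_le_of_deriv_le_neg (δ := 4 * ((K * J) ^ (1 / 2 : ℝ) * δ))
      (by positivity) ?_
    filter_upwards [hj, hD, eventually_gt_atTop 0] with t ht hDt ht0
    obtain ⟨⟨w', h1, h2⟩, -⟩ := hPair m p₁ Ψ₁ p₂ Ψ₂ hp t (K * J) ht0 ht
    refine ⟨w', h1, fun hlt => ?_⟩
    have h3 : (K * J) ^ (1 / 2 : ℝ) * D m Ψ₁ Ψ₂ t ≤ (K * J) ^ (1 / 2 : ℝ) * δ := by gcongr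
    have h4 : c * (K * J) ^ (-β) * (8 / c * (K * J) ^ kappa α * δ) ≤
        c * (K * J) ^ (-β) * ‖Pbar p₁ Ψ₁ p₂ Ψ₂ t‖ ^ 2 := by gcongr
    have h5 : c * (K * J) ^ (-β) * (8 / c * (K * J) ^ kappa α * δ) =
        8 * ((K * J) ^ (1 / 2 : ℝ) * δ) := by
      rw [hκ, Real.rpow_add hKJ0, Real.rpow_neg hKJ0.le]
      have : (K * J) ^ β ≠ 0 := (Real.rpow_pos_of_pos hKJ0 _).ne'
      field_simp
    linarith
  filter_upwards [hj, hx, hw, hD, eventually_gt_atTop 0] with t htj htx htw hDt ht0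
  have hfin := (hPair m p₁ Ψ₁ p₂ Ψ₂ hp t (K * J) ht0 htj).2 _ htx
  set r := ‖Pbar p₁ Ψ₁ p₂ Ψ₂ t‖ with hr
  have hr1 : r ≤ (8 / c * K ^ kappa α) ^ (1 / 2 : ℝ) * (J₂ ^ kappa α * δ) ^ (1 / 2 : ℝ) := by
    rw [← Real.mul_rpow (by positivity) (by positivity), ← Real.sqrt_eq_rpow]
    refine Real.le_sqrt_of_sq_le (htw.trans ?_)
    rw [Real.mul_rpow hK0.le hJ0.le]
    have : J ^ kappa α ≤ J₂ ^ kappa α := by gcongr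
    calc 8 / c * (K ^ kappa α * J ^ kappa α) * δ
        ≤ 8 / c * (K ^ kappa α * J₂ ^ kappa α) * δ := by gcongr
      _ = _ := by ring
  -- The prefactor has exponent `κ₀` and the root of the bound for `‖P̄‖²` has `κ₀/2`; together this
  -- is `3κ₀/2`.
  have hpow : J₂ ^ β * J₂ ^ (1 / 2 : ℝ) * (J₂ ^ kappa α * δ) ^ (1 / 2 : ℝ) =
      (J₂ ^ (3 * kappa α) * δ) ^ (1 / 2 : ℝ) := by
    rw [← Real.rpow_add hJ₂0, ← hκ, Real.mul_rpow (by positivity) hδ.le,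
      Real.mul_rpow (by positivity) hδ.le, ← Real.rpow_mul hJ₂0.le, ← Real.rpow_mul hJ₂0.le,
      ← mul_assoc, ← Real.rpow_add hJ₂0]
    congr 2
    ring
  have hJβ : J ^ β ≤ J ^ kappa α :=
    Real.rpow_le_rpow_of_exponent_le hJ1 (by rw [hκ]; linarith)
  have hDnn : 0 ≤ D m Ψ₁ Ψ₂ t := by rw [D_eq h]; positivity
  set A := (8 / c * K ^ kappa α) ^ (1 / 2 : ℝ) with hA
  have hA0 : 0 < A := by positivity
  set S := (J₂ ^ (3 * kappa α) * δ) ^ (1 / 2 : ℝ) with hS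
  have hS0 : 0 ≤ S := by positivity
  have hC1 : Cp * K ^ β * (K ^ (1 / 2 : ℝ) * A) ≤
      Cp * K ^ β * (K ^ (1 / 2 : ℝ) * A + 1) := by gcongr; linarith
  have hC2 : Cp * K ^ β ≤ Cp * K ^ β * (K ^ (1 / 2 : ℝ) * A + 1) :=
    le_mul_of_one_le_right (by positivity) (by linarith [show 0 ≤ K ^ (1 / 2 : ℝ) * A by positivity])
  calc wNorm U m.W1 (2 - expA α) (gradPbar p₁ Ψ₁ p₂ Ψ₂ t) ^ 2
      ≤ Cp * (K * J) ^ β * ((K * J₂) ^ (1 / 2 : ℝ) * r + D m Ψ₁ Ψ₂ t) := hfin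
    _ = Cp * (K * J) ^ β * ((K * J₂) ^ (1 / 2 : ℝ) * r)
        + Cp * (K * J) ^ β * D m Ψ₁ Ψ₂ t := by ring
    _ ≤ Cp * (K * J₂) ^ β * ((K * J₂) ^ (1 / 2 : ℝ) *
          (A * (J₂ ^ kappa α * δ) ^ (1 / 2 : ℝ))) + Cp * (K ^ β * J ^ kappa α) * δ := by
        gcongr ?_ + ?_
        · gcongr
        · rw [Real.mul_rpow hK0.le hJ0.le]
          gcongr
    _ = Cp * K ^ β * (K ^ (1 / 2 : ℝ) * A) *
          (J₂ ^ β * J₂ ^ (1 / 2 : ℝ) * (J₂ ^ kappa α * δ) ^ (1 / 2 : ℝ))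
        + Cp * K ^ β * (J ^ kappa α * δ) := by
        rw [Real.mul_rpow hK0.le hJ₂0.le, Real.mul_rpow hK0.le hJ₂0.le]
        ring
    _ ≤ _ := by
        rw [hpow]
        gcongr

theorem eventually_le_of_limsupInfty_lt {f : ℝ → ℝ} {a : ℝ≥0∞} (ha : a ≠ ⊤)
    (hf : limsupInfty f ≤ a) {ε : ℝ} (hε : 0 < ε) : ∀ᶠ s in atTop, f s ≤ a.toReal + ε := by
  have h1 : limsupInfty f < ENNReal.ofReal (a.toReal + ε) := by
    refine hf.trans_lt ?_
    rw [ENNReal.ofReal_add ENNReal.toReal_nonneg hε.le, ENNReal.ofReal_toReal ha]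
    exact ENNReal.lt_add_right ha (by simpa using hε)
  filter_upwards [eventually_lt_of_limsup_lt h1] with s hs
  exact (ENNReal.ofReal_lt_ofReal_iff'.1 hs).1.le

/-- The upper limits enlarged by `ε` are eventual bounds; then `ε → 0` by continuity. If one of the
quantities is infinite, the right side is infinite. -/
theorem exists_limsup_gradient_estimate {α : Fin (N + 1) → ℝ} (h : IsSetting U α) {cP : ℝ}
    (hcP : 0 < cP) :
    ∃ C : ℝ, 0 < C ∧ ∀ (m : Medium U α) (p₁ p₂ Ψ₁ Ψ₂ : RegularPath m),
      IsGoodPair m cP p₁ Ψ₁ p₂ Ψ₂ → ∀ (A 𝒢₁ 𝒢₂ 𝒟 : ℝ≥0∞),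
        A = limsupInfty (G m Ψ₁) + limsupInfty (G m Ψ₂) →
        𝒢₁ = limsupInfty (G1 m Ψ₁) + limsupInfty (G1 m Ψ₂) →
        𝒢₂ = limsupInfty (G2 m Ψ₁) + limsupInfty (G2 m Ψ₂) →
        𝒟 = limsupInfty (D m Ψ₁ Ψ₂) →
        (𝒟 ≠ 0 ∨ (A ≠ ⊤ ∧ 𝒢₁ ≠ ⊤ ∧ 𝒢₂ ≠ ⊤)) →
        limsupInfty (fun t =>
            wNorm U m.W1 (2 - expA α) (gradPbar p₁ Ψ₁ p₂ Ψ₂ t) ^ 2) ≤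
          ENNReal.ofReal C *
              ((A ^ (2 / (2 - expA α)) + 𝒢₁ + 𝒢₂) ^ (3 * kappa α) * 𝒟) ^ (1 / 2 : ℝ)
            + ENNReal.ofReal C *
              ((A ^ (2 / (2 - expA α)) + 𝒢₁) ^ kappa α * 𝒟) := by
  obtain ⟨C, hC, hmain⟩ := exists_eventual_gradient_estimate h hcP
  refine ⟨C, hC, ?_⟩
  intro m p₁ p₂ Ψ₁ Ψ₂ hp A 𝒢₁ 𝒢₂ 𝒟 hA h𝒢₁ h𝒢₂ h𝒟 hcase
  have ha := h.expA_pos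
  have ha1 := h.expA_lt_one
  have hq : 0 < 2 / (2 - expA α) := div_pos two_pos (by linarith)
  have hκ0 : 0 < kappa α := by
    have : 0 < expA α / (2 - expA α) := div_pos ha (by linarith)
    unfold kappa
    linarith
  have hCne : ENNReal.ofReal C ≠ 0 := by simpa using hC
  have hA1 : 1 ≤ A := by
    rw [hA]
    refine le_trans ?_ le_self_add
    refine le_limsup_of_frequently_le (Eventually.frequently ?_)
    filter_upwards with s
    simpa using (G_bounds h m Ψ₁ s).1
  have hAq : A ^ (2 / (2 - expA α)) ≠ 0 := by
    simp [hq, hq.le, (zero_lt_one.trans_le hA1).ne']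
  by_cases hfin : A ≠ ⊤ ∧ 𝒢₁ ≠ ⊤ ∧ 𝒢₂ ≠ ⊤ ∧ 𝒟 ≠ ⊤
  swap
  -- The base is nonzero because `B_* ≥ 1` forces `A ≥ 1`, and `hcase` rules out `∞ · 0`.
  · have htop : (A ^ (2 / (2 - expA α)) + 𝒢₁ + 𝒢₂) ^ (3 * kappa α) * 𝒟 = ⊤ := by
      have hbase : (A ^ (2 / (2 - expA α)) + 𝒢₁ + 𝒢₂) ^ (3 * kappa α) ≠ 0 := by
        have : A ^ (2 / (2 - expA α)) + 𝒢₁ + 𝒢₂ ≠ 0 := by simp [hAq]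
        rw [Ne, ENNReal.rpow_eq_zero_iff_of_pos (by positivity)]
        exact this
      by_cases hD : 𝒟 = ⊤
      · rw [hD, ENNReal.mul_top hbase]
      · have hD0 : 𝒟 ≠ 0 := by
          rcases hcase with h1 | h1
          · exact h1
          · exact absurd ⟨h1.1, h1.2.1, h1.2.2, hD⟩ hfin
        have hsum : A ^ (2 / (2 - expA α)) + 𝒢₁ + 𝒢₂ = ⊤ := by
          by_contra hne
          simp only [ENNReal.add_eq_top, not_or, ENNReal.rpow_eq_top_iff_of_pos hq] at hne
          exact hfin ⟨hne.1.1, hne.1.2, hne.2, hD⟩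
        rw [hsum, ENNReal.top_rpow_of_pos (by positivity), ENNReal.top_mul hD0]
    rw [htop, ENNReal.top_rpow_of_pos (by norm_num), ENNReal.mul_top hCne, top_add]
    exact le_top
  obtain ⟨hAt, h1t, h2t, hDt⟩ := hfin
  have hA1' : 1 ≤ A.toReal := by
    rw [← ENNReal.toReal_one]
    exact ENNReal.toReal_mono hAt hA1
  -- The enlargement also supplies a positive `δ` when `𝒟 = 0`.
  have hev : ∀ ε : ℝ, 0 < ε → limsupInfty (fun t =>
      wNorm U m.W1 (2 - expA α) (gradPbar p₁ Ψ₁ p₂ Ψ₂ t) ^ 2) ≤ ENNReal.ofReal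
        (C * (((A.toReal + ε) ^ (2 / (2 - expA α)) + (𝒢₁.toReal + ε) + (𝒢₂.toReal + ε)) ^
          (3 * kappa α) * (𝒟.toReal + ε)) ^ (1 / 2 : ℝ)
          + C * (((A.toReal + ε) ^ (2 / (2 - expA α)) + (𝒢₁.toReal + ε)) ^ kappa α *
            (𝒟.toReal + ε))) := by
    intro ε hε
    have key := hmain m p₁ p₂ Ψ₁ Ψ₂ hp (A.toReal + ε) (𝒢₁.toReal + ε) (𝒢₂.toReal + ε)
      (𝒟.toReal + ε) (by positivity) (by positivity) (by positivity)
      (eventually_le_of_limsupInfty_lt hAt (hA ▸ le_self_add) hε)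
      (eventually_le_of_limsupInfty_lt hAt (hA ▸ le_add_self) hε)
      (eventually_le_of_limsupInfty_lt h1t (h𝒢₁ ▸ le_self_add) hε)
      (eventually_le_of_limsupInfty_lt h1t (h𝒢₁ ▸ le_add_self) hε)
      (eventually_le_of_limsupInfty_lt h2t (h𝒢₂ ▸ le_self_add) hε)
      (eventually_le_of_limsupInfty_lt h2t (h𝒢₂ ▸ le_add_self) hε)
      (eventually_le_of_limsupInfty_lt hDt h𝒟.ge hε)
    refine limsup_le_of_le (by isBoundedDefault) ?_
    filter_upwards [key] with t ht
    exact ENNReal.ofReal_le_ofReal ht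
  set f : ℝ → ℝ := fun ε =>
    C * (((A.toReal + ε) ^ (2 / (2 - expA α)) + (𝒢₁.toReal + ε) + (𝒢₂.toReal + ε)) ^
      (3 * kappa α) * (𝒟.toReal + ε)) ^ (1 / 2 : ℝ)
      + C * (((A.toReal + ε) ^ (2 / (2 - expA α)) + (𝒢₁.toReal + ε)) ^ kappa α *
        (𝒟.toReal + ε)) with hf
  have hfc : Continuous f := by
    have hadd : ∀ b : ℝ, Continuous fun ε : ℝ => b + ε := fun b => continuous_const.add continuous_id
    have hr : ∀ {u : ℝ → ℝ} {e : ℝ}, 0 ≤ e → Continuous u → Continuous fun ε => u ε ^ e :=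
      fun he hu => (Real.continuous_rpow_const he).comp hu
    have c1 := hr hq.le (hadd A.toReal)
    have c2 := c1.add (hadd 𝒢₁.toReal)
    exact (continuous_const.mul (hr (by norm_num) ((hr (by positivity)
      (c2.add (hadd 𝒢₂.toReal))).mul (hadd _)))).add
      (continuous_const.mul ((hr hκ0.le c2).mul (hadd _)))
  have hlim : Tendsto (fun ε => ENNReal.ofReal (f ε)) (𝓝[>] 0) (𝓝 (ENNReal.ofReal (f 0))) :=
    ((ENNReal.continuous_ofReal.comp hfc).tendsto 0).mono_left nhdsWithin_le_nhds
  refine (ge_of_tendsto hlim (by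
    filter_upwards [self_mem_nhdsWithin] with ε hε using hev ε hε)).trans (le_of_eq ?_)
  have hAr : ENNReal.ofReal (A.toReal ^ (2 / (2 - expA α))) = A ^ (2 / (2 - expA α)) := by
    rw [← ENNReal.ofReal_rpow_of_nonneg ENNReal.toReal_nonneg hq.le, ENNReal.ofReal_toReal hAt]
  have n0 : 0 ≤ A.toReal ^ (2 / (2 - expA α)) := Real.rpow_nonneg ENNReal.toReal_nonneg _
  have n1 : 0 ≤ 𝒢₁.toReal := ENNReal.toReal_nonneg
  have n2 : 0 ≤ 𝒢₂.toReal := ENNReal.toReal_nonneg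
  have n3 : 0 ≤ 𝒟.toReal := ENNReal.toReal_nonneg
  simp only [hf, add_zero]
  rw [ENNReal.ofReal_add (by positivity) (by positivity), ENNReal.ofReal_mul hC.le,
    ENNReal.ofReal_mul hC.le, ← ENNReal.ofReal_rpow_of_nonneg (by positivity) (by norm_num),
    ENNReal.ofReal_mul (by positivity), ENNReal.ofReal_mul (by positivity),
    ← ENNReal.ofReal_rpow_of_nonneg (by positivity) (by positivity),
    ← ENNReal.ofReal_rpow_of_nonneg (by positivity) hκ0.le,
    ENNReal.ofReal_add (by positivity) n2, ENNReal.ofReal_add n0 n1, hAr,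
    ENNReal.ofReal_toReal h1t, ENNReal.ofReal_toReal h2t, ENNReal.ofReal_toReal hDt]

end Forchheimer

/-! ### The theorem -/

theorem mainTheorem6 {n : ℕ} (hn : 2 ≤ n) (U : Set (EuclideanSpace ℝ (Fin n)))
    (hU_open : IsOpen U) (hU_conn : IsConnected U) (hU_bdd : Bornology.IsBounded U)
    {N : ℕ} (hN : 1 ≤ N) (α : Fin (N + 1) → ℝ) (hα0 : α 0 = 0) (hα : StrictMono α)
    (cP : ℝ) (hcP : 0 < cP) :
    ∃ C d₄ : ℝ, 0 < C ∧ 0 < d₄ ∧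
      ∀ (m : Medium U α) (p₁ p₂ Ψ₁ Ψ₂ : RegularPath m),
        IsSolution m p₁ Ψ₁ → IsSolution m p₂ Ψ₂ →
        ContinuousOn (G m Ψ₁) (Ici 0) → ContinuousOn (G m Ψ₂) (Ici 0) →
        ContinuousOn (G1 m Ψ₁) (Ici 0) → ContinuousOn (G1 m Ψ₂) (Ici 0) →
        ContinuousOn (G2 m Ψ₁) (Ici 0) → ContinuousOn (G2 m Ψ₂) (Ici 0) →
        (∀ t, 0 < t →
          PoincareSobolev m cP (p₁.val t - Ψ₁.val t) (p₁.grad t - Ψ₁.grad t) ∧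
          PoincareSobolev m cP (p₂.val t - Ψ₂.val t) (p₂.grad t - Ψ₂.grad t) ∧
          PoincareSobolev m cP (Pbar p₁ Ψ₁ p₂ Ψ₂ t) (gradPbar p₁ Ψ₁ p₂ Ψ₂ t)) →
        (∀ M₁ M₂ : ℝ → ℝ, IsMajorant M₁ (G m Ψ₁) → IsMajorant M₂ (G m Ψ₂) →
          ∀ t₀ ∈ Ioc (0 : ℝ) 1, ∀ t, t₀ ≤ t →
            wNorm U m.W1 (2 - expA α) (gradPbar p₁ Ψ₁ p₂ Ψ₂ t) ^ 2 ≤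
              C * calM2 m p₁ Ψ₁ p₂ Ψ₂ M₁ M₂ t₀ t ^ kappa α *
                (Real.exp (-d₄ * ∫ τ in (0 : ℝ)..t,
                      calM1 m p₁ Ψ₁ p₂ Ψ₂ M₁ M₂ τ ^ (-(expA α / (2 - expA α)))) *
                    wNorm U m.phi 2 (Pbar p₁ Ψ₁ p₂ Ψ₂ 0) ^ 2
                  + D m Ψ₁ Ψ₂ t ^ 2
                  + (∫ s in (0 : ℝ)..t,
                      Real.exp (-d₄ * ∫ τ in s..t,
                        calM1 m p₁ Ψ₁ p₂ Ψ₂ M₁ M₂ τ ^ (-(expA α / (2 - expA α)))) *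
                      calM1 m p₁ Ψ₁ p₂ Ψ₂ M₁ M₂ s ^ (1 / 2 : ℝ) * D m Ψ₁ Ψ₂ s)) ^ (1 / 2 : ℝ)) ∧
        (∀ (A 𝒢₁ 𝒢₂ 𝒟 : ℝ≥0∞),
          A = limsupInfty (G m Ψ₁) + limsupInfty (G m Ψ₂) →
          𝒢₁ = limsupInfty (G1 m Ψ₁) + limsupInfty (G1 m Ψ₂) →
          𝒢₂ = limsupInfty (G2 m Ψ₁) + limsupInfty (G2 m Ψ₂) →
          𝒟 = limsupInfty (D m Ψ₁ Ψ₂) →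
          (𝒟 ≠ 0 ∨ (A ≠ ⊤ ∧ 𝒢₁ ≠ ⊤ ∧ 𝒢₂ ≠ ⊤)) →
          limsupInfty (fun t =>
              wNorm U m.W1 (2 - expA α) (gradPbar p₁ Ψ₁ p₂ Ψ₂ t) ^ 2) ≤
            ENNReal.ofReal C *
                ((A ^ (2 / (2 - expA α)) + 𝒢₁ + 𝒢₂) ^ (3 * kappa α) * 𝒟) ^ (1 / 2 : ℝ)
              + ENNReal.ofReal C *
                ((A ^ (2 / (2 - expA α)) + 𝒢₁) ^ kappa α * 𝒟)) := by
  have h : IsSetting U α := ⟨hU_open, hα0, hα, hN⟩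
  obtain ⟨C₁, d₄, hC₁, hd₄, h₁⟩ := exists_gradient_estimate h hcP
  obtain ⟨C₂, hC₂, h₂⟩ := exists_limsup_gradient_estimate h hcP
  refine ⟨max C₁ C₂, d₄, lt_max_of_lt_left hC₁, hd₄, ?_⟩
  intro m p₁ p₂ Ψ₁ Ψ₂ hs₁ hs₂ _ _ hG11 hG12 hG21 hG22 hP
  have hp : IsGoodPair m cP p₁ Ψ₁ p₂ Ψ₂ :=
    ⟨⟨hs₁, fun t ht => (hP t ht).1⟩, ⟨hs₂, fun t ht => (hP t ht).2.1⟩, fun t ht => (hP t ht).2.2⟩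
  constructor
  · intro M₁ M₂ hM₁ hM₂ t₀ ht₀ t ht
    rw [mul_assoc]
    have hle := h₁ m p₁ p₂ Ψ₁ Ψ₂ hp hG11 hG12 hG21 hG22 M₁ M₂ hM₁ hM₂ t₀ ht₀ t ht
    -- Enlarging `C₁` needs the factor it multiplies to be nonnegative; this is read off from the
    -- estimate itself, whose left side is a square.
    by_contra! hlt
    refine absurd (hlt.trans_le hle) (not_lt.2 (mul_le_mul_of_nonneg_right (le_max_left _ _) ?_))
    by_contra! hneg
    exact absurd (hle.trans_lt (mul_neg_of_pos_of_neg hC₁ hneg)) (not_lt.2 (sq_nonneg _))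
  · intro A 𝒢₁ 𝒢₂ 𝒟 hA h𝒢₁ h𝒢₂ h𝒟 hcase
    refine (h₂ m p₁ p₂ Ψ₁ Ψ₂ hp A 𝒢₁ 𝒢₂ 𝒟 hA h𝒢₁ h𝒢₂ h𝒟 hcase).trans ?_
    gcongr <;> exact le_max_right _ _
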